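/- Let $N\ge 2$ be an integer, $\rho>0$, $n_0,k\in\mathbb{C}$, and let $\nu=\tfrac12\bigl(-1+\sqrt{1+4n_0^2k^2\rho^2}\bigr)$, with either choice of the complex square root (in particular the one for which $\nu\to0$ as $n_0\to0$). Assume that $\nu\ne n+\frac N2-1$ and $\nu\ne -n-\frac N2$ for all $n=0,1,2,\dots$. Write $r=|\boldsymbol r|$, $r'=|\boldsymbol r'|$ for $\boldsymbol r,\boldsymbol r'\in\mathbb{R}^N$, and let $S_{N-1}=2\pi^{N/2}/\Gamma(N/2)$. A Green's function of the fish-eye equation is a function $G_\nu(\boldsymbol r,\boldsymbol r')$, $\boldsymbol r\neq\boldsymbol r'$, which for each fixed $\boldsymbol r'\in\mathbb{R}^N$ is, as a function of $\boldsymbol r$, complex-valued and of class $C^2$ on $\mathbb{R}^N\setminus\{\boldsymbol r'\}$ and satisfies $$\Bigl[\nabla^2+\frac{4n_0^2k^2\rho^4}{(r^2+\rho^2)^2}\Bigr]G_\nu(\boldsymbol r,\boldsymbol r')=0\qquad(\boldsymbol r\ne\boldsymbol r');$$ as $\boldsymbol r\to\boldsymbol r'$, $$G_\nu\sim\frac1{2\pi}\ln|\boldsymbol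 r-\boldsymbol r'|\quad(N=2),\qquad G_\nu\sim-\frac{1}{(N-2)S_{N-1}|\boldsymbol r-\boldsymbol r'|^{N-2}}\quad(N\ge3),$$ where $\sim$ means that the quotient tends to $1$; and $r^{N-2}G_\nu(\boldsymbol r,\boldsymbol r')$ has a finite limit $C_\nu(\boldsymbol r')$ as $r\to\infty$. Let $x=-1+\dfrac{2\rho^2|\boldsymbol r-\boldsymbol r'|^2}{(r^2+\rho^2)(r'^2+\rho^2)}$ and $A_\nu=-\dfrac{\Gamma(\frac N2+\nu)\Gamma(\frac N2-\nu-1)}{4\pi^{N/2}}$. For $-1<x\le1$ let $$P_\nu^{-\mu}(x)=\frac{1}{\Gamma(1+\mu)}\Bigl(\frac{1-x}{1+x}\Bigr)^{\mu/2}{}_2F_1\bigl(-\nu,\nu+1;1+\mu;\tfrac{1-x}2\bigr)\quad(\mu\ge0)$$ be the associated Legendre function on the cut, and $$C_\alpha^\lambda(x)=\frac{\Gamma(\alpha+2\lambda)}{\Gamma(2\lambda)\Gamma(\alpha+1)}\,{}_2F_1\bigl(-\alpha,\alpha+2\lambda;\lambda+\tfrac12;\tfrac{1-x}2\bigr)\quad(\lambda>0)$$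 the Gegenbauer function of the first kind. Then a Green's function exists, it is unique, and it has the following properties for all $\boldsymbol r\ne\boldsymbol r'$. 1. If $\boldsymbol r'\ne\boldsymbol 0$ and $\boldsymbol r\neq-\boldsymbol r'\rho^2/r'^2$, then $$G_\nu(\boldsymbol r,\boldsymbol r')=A_\nu\Bigl(\frac{\rho}{r'}\Bigr)^{N/2-1}\frac{P_\nu^{-N/2+1}(x)}{|\boldsymbol r-\boldsymbol r'|^{N/2-1}\,\bigl|\boldsymbol r+\boldsymbol r'\frac{\rho^2}{r'^2}\bigr|^{N/2-1}};$$ at the remaining point $\boldsymbol r=-\boldsymbol r'\rho^2/r'^2$ (with $\boldsymbol r'\neq\boldsymbol0$) the value is $\dfrac{A_\nu}{\Gamma(N/2)}\Bigl(\dfrac{r'}{r'^2+\rho^2}\Bigr)^{N-2}$. 2. The constant at infinity is $$C_\nu(\boldsymbol r')=A_\nu\Bigl(\frac{\rho}{r'}\Bigr)^{N/2-1}P_\nu^{-N/2+1}\Bigl(\frac{\rho^2-r'^2}{\rho^2+r'^2}\Bigr)\quad(\boldsymbol r'\ne\boldsymbol 0),\qquad C_\nu(\boldsymbol 0)=\frac{A_\nu}{\Gamma(N/2)}.$$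 3. $G_\nu(\boldsymbol r,\boldsymbol r')=G_\nu(\boldsymbol r',\boldsymbol r)$. 4. If $r^2r'^2+2\rho^2\boldsymbol r\cdot\boldsymbol r'+\rho^4\ne0$ (in particular if $\boldsymbol r'=\boldsymbol 0$), then $$G_\nu(\boldsymbol r,\boldsymbol r')=A_\nu\frac{\rho^{N/2-1}P_\nu^{-N/2+1}(x)}{|\boldsymbol r-\boldsymbol r'|^{N/2-1}\,(r^2r'^2+2\rho^2\boldsymbol r\cdot\boldsymbol r'+\rho^4)^{N/4-1/2}}.$$ 5. If $\boldsymbol r,\boldsymbol r'\ne\boldsymbol 0$ and $\boldsymbol r\neq-\boldsymbol r'\rho^2/r'^2$, then $$G_\nu(\boldsymbol r,\boldsymbol r')=A_\nu\frac{\rho^{N/2-1}P_\nu^{-N/2+1}(x)}{(rr')^{N/4-1/2}|\boldsymbol r-\boldsymbol r'|^{N/2-1}\bigl|\boldsymbol r+\boldsymbol r'\frac{\rho^2}{r'^2}\bigr|^{N/4-1/2}\bigl|\boldsymbol r'+\boldsymbol r\frac{\rho^2}{r^2}\bigr|^{N/4-1/2}}.$$ 6. If $\sin[\pi(\frac N2-\nu)]\ne0$,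 then $$G_\nu(\boldsymbol r,\boldsymbol r')=\frac{2^{N-4}\,\Gamma(\frac{N-1}2)}{\pi^{(N-1)/2}\sin[\pi(\frac N2-\nu)]}\,\frac{\rho^{N-2}\,C_{\nu-N/2+1}^{(N-1)/2}(x)}{(r^2+\rho^2)^{N/2-1}(r'^2+\rho^2)^{N/2-1}};$$ if $\sin[\pi(\frac N2-\nu)]=0$, then $G_\nu(\boldsymbol r,\boldsymbol r')$ is the limit of the right-hand side, with $\nu$ replaced by $\nu'\neq\nu$, as $\nu'\to\nu$. -/

import Mathlib

open Filter Topology Asymptotics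
open scoped InnerProductSpace Laplacian

noncomputable section

/-- The associated Legendre (Ferrers) function of the first kind on the cut, `P_ν^μ(x)`, for
`-1 < x ≤ 1`, complex degree `ν` and real order `μ` that is not a positive integer:
`P_ν^μ(x) = ((1-x)/(1+x))^(-μ/2) / Γ(1-μ) * ₂F₁(-ν, ν+1; 1-μ; (1-x)/2)`. -/
def ferrersP (ν : ℂ) (μ : ℝ) (x : ℝ) : ℂ :=
  ((((1 - x) / (1 + x)) ^ (-μ / 2) : ℝ) : ℂ) / Complex.Gamma (1 - (μ : ℂ)) *
    ordinaryHypergeometric (-ν) (ν + 1) (1 - (μ : ℂ)) ((((1 - x) / 2 : ℝ)) : ℂ)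

/-- The Gegenbauer function of the first kind `C_α^λ(x)`, for `-1 < x ≤ 1`, complex degree `α`
and real `λ > 0`:
`C_α^λ(x) = Γ(α+2λ) / (Γ(2λ) Γ(α+1)) * ₂F₁(-α, α+2λ; λ+1/2; (1-x)/2)`. -/
def gegenbauerC (lam : ℝ) (α : ℂ) (x : ℝ) : ℂ :=
  Complex.Gamma (α + 2 * lam) / (Complex.Gamma (2 * lam) * Complex.Gamma (α + 1)) *
    ordinaryHypergeometric (-α) (α + 2 * lam) ((lam : ℂ) + 1 / 2) ((((1 - x) / 2 : ℝ)) : ℂ)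

/-- `2π^(N/2) / Γ(N/2)`, the surface area of the unit sphere in `ℝ^N`. -/
def unitSphereArea (N : ℕ) : ℝ :=
  2 * Real.pi ^ ((N : ℝ) / 2) / Real.Gamma ((N : ℝ) / 2)

/-- `ν = (-1 + √(1 + 4 n₀² k² ρ²)) / 2`, with either determination `s` of the square root. -/
def IsFishEyeIndex (n₀ k : ℂ) (ρ : ℝ) (ν : ℂ) : Prop :=
  ∃ s : ℂ, s ^ 2 = 1 + 4 * n₀ ^ 2 * k ^ 2 * (ρ : ℂ) ^ 2 ∧ ν = (-1 + s) / 2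

/-- The values `ν = n + N/2 - 1` and `ν = -n - N/2`, `n = 0, 1, 2, …`, for which no Green's
function exists. -/
def IsExceptionalIndex (N : ℕ) (ν : ℂ) : Prop :=
  ∃ n : ℕ, ν = (n : ℂ) + (N : ℂ) / 2 - 1 ∨ ν = -(n : ℂ) - (N : ℂ) / 2

/-- `g` is a Green's function with source point `r'` of the fish-eye equation
`[∇² + 4 n₀² k² ρ⁴ / (r² + ρ²)²] g = 0` in `ℝ^N`: a classical solution away from `r'`, with the
prescribed leading singularity at `r'`, and such that `r^(N-2) g(r)` has a limit at infinity. -/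
structure IsFishEyeGreen (N : ℕ) (ρ : ℝ) (n₀ k : ℂ) (r' : EuclideanSpace ℝ (Fin N))
    (g : EuclideanSpace ℝ (Fin N) → ℂ) : Prop where
  contDiffOn : ContDiffOn ℝ 2 g {r'}ᶜ
  equation : ∀ r, r ≠ r' →
    Laplacian.laplacian g r +
      4 * n₀ ^ 2 * k ^ 2 * (ρ : ℂ) ^ 4 / (((‖r‖ ^ 2 + ρ ^ 2) ^ 2 : ℝ) : ℂ) * g r = 0
  singularity_two : N = 2 →
    g ~[𝓝[≠] r'] fun r => ((1 / (2 * Real.pi) * Real.log ‖r - r'‖ : ℝ) : ℂ)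
  singularity_ge_three : 3 ≤ N →
    g ~[𝓝[≠] r'] fun r =>
      ((-(1 / (((N : ℝ) - 2) * unitSphereArea N * ‖r - r'‖ ^ (N - 2))) : ℝ) : ℂ)
  decay : ∃ C : ℂ,
    Tendsto (fun r => ((‖r‖ ^ (N - 2) : ℝ) : ℂ) * g r)
      (Bornology.cobounded (EuclideanSpace ℝ (Fin N))) (𝓝 C)

/-- `-Γ(N/2+ν) Γ(N/2-ν-1) / (4 π^(N/2))`. -/
def greenPrefactor (N : ℕ) (ν : ℂ) : ℂ :=
  -(Complex.Gamma ((N : ℂ) / 2 + ν) * Complex.Gamma ((N : ℂ) / 2 - ν - 1) /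
    ((4 * Real.pi ^ ((N : ℝ) / 2) : ℝ) : ℂ))

/-- `-1 + 2ρ²|r-r'|² / ((r²+ρ²)(r'²+ρ²))`. -/
def fishEyeArg {N : ℕ} (ρ : ℝ) (r r' : EuclideanSpace ℝ (Fin N)) : ℝ :=
  -1 + 2 * ρ ^ 2 * ‖r - r'‖ ^ 2 / ((‖r‖ ^ 2 + ρ ^ 2) * (‖r'‖ ^ 2 + ρ ^ 2))

/-- The right-hand side of the Gegenbauer-function representation of the Green's function. -/
def greenGegenbauer {N : ℕ} (ρ : ℝ) (ν : ℂ) (r r' : EuclideanSpace ℝ (Fin N)) : ℂ :=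
  (((2 : ℝ) ^ ((N : ℝ) - 4) * Real.Gamma (((N : ℝ) - 1) / 2) : ℝ) : ℂ) /
      (((Real.pi ^ (((N : ℝ) - 1) / 2) : ℝ) : ℂ) *
        Complex.sin ((Real.pi : ℂ) * ((N : ℂ) / 2 - ν))) *
    (((ρ ^ (N - 2) : ℝ) : ℂ) *
        gegenbauerC (((N : ℝ) - 1) / 2) (ν - (N : ℂ) / 2 + 1) (fishEyeArg ρ r r') /
      (((‖r‖ ^ 2 + ρ ^ 2) ^ ((N : ℝ) / 2 - 1) *
        (‖r'‖ ^ 2 + ρ ^ 2) ^ ((N : ℝ) / 2 - 1) : ℝ) : ℂ))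

end

/-! Inverse stereographic projection sends ℝ^N to the N-sphere minus a point, and x = -cos θ, where
θ is the angle between the images of r and r'. The source sits at x = -1 and its antipode at x = 1.
With the conformal weight w = (r²+ρ²)^(1-N/2), the fish-eye operator applied to w p(x) is
4ρ²w/(r²+ρ²)² times (1-x²)p'' - N x p' + (ν(ν+1) - N(N-2)/4) p; this is `laplacian_conformalZonal`.
The fish-eye equation is thus a Helmholtz equation on the sphere, where the zonal part has
eigenvalues d(d+N-1), and the exceptional indices are those meeting this spectrum.

Existence: in z = (1-x)/2 the zonal equation is Gauss's equation with a = N/2-1-ν, b = N/2+ν, c =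
N/2. Its solution regular at z = 0 is smooth at the antipode and singular only at the source z = 1.
An Abelian comparison of Taylor coefficients with those of (1-z)^(-s) or -log(1-z) gives the
singularity at z = 1, and the Gamma factors in the prefactor normalise it.

Uniqueness: the difference h of two Green's functions is of smaller order than the fundamental
solution at the source c and O(r^(2-N)) at infinity. A cutoff in log|r-c| removes both ends at once;
its commutator with the Laplacian contributes nothing in the limit, so h is orthogonal to the image
of the operator on w x^d, where x is now centred at an arbitrary point e. That image is triangular
in powers of x with diagonal entries ν(ν+1) - N(N-2)/4 - d(d+N-1), nonzero off the exceptional set,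
so all moments of h in x vanish (`integral_mul_zonal_pow_eq_zero`). By Weierstrass, h is then
orthogonal to bumps concentrated at e, whence h(e) = 0 (`eq_zero_of_growth`).

Closed forms: Euler's transformation trades the conformal weights for |r-r'|^(2-N) and yields the
Legendre forms, the symmetry and the constant at infinity. The untransformed function is already the
Gegenbauer function; only the reflection and duplication formulas for Γ are needed to match
constants. -/

/-! ### Power series on the open unit disc. -/

/-- The coefficients of a power series converging on the open unit disc. -/
def UnitDiscSummable (c : ℕ → ℂ) : Prop :=
  ∀ r : ℝ, 0 ≤ r → r < 1 → Summable fun n => ‖c n‖ * r ^ n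

theorem UnitDiscSummable.summable {c : ℕ → ℂ} (hc : UnitDiscSummable c) {z : ℂ} (hz : ‖z‖ < 1) :
    Summable fun n => c n * z ^ n := by
  refine Summable.of_norm ?_
  simpa [norm_mul, norm_pow] using hc ‖z‖ (norm_nonneg z) hz

theorem UnitDiscSummable.hasSum_deriv {c : ℕ → ℂ} (hc : UnitDiscSummable c) {z : ℂ}
    (hz : ‖z‖ < 1) :
    HasSum (fun n => c n * (n * z ^ (n - 1))) (deriv (fun w => ∑' n, c n * w ^ n) z) := by
  obtain ⟨r, hr1, hr2⟩ := exists_between hz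
  have hr0 : 0 ≤ r := (norm_nonneg z).trans hr1.le
  have := Complex.hasSum_deriv_of_summable_norm (F := fun n w => c n * w ^ n)
    (U := Metric.ball 0 r) (hc r hr0 hr2) (fun n => by fun_prop) Metric.isOpen_ball
    (fun n w hw => by
      rw [norm_mul, norm_pow]
      have : ‖w‖ < r := by simpa using hw
      gcongr) (z := z) (by simpa using hr1)
  refine this.congr_fun ?_
  intro n
  simp

theorem UnitDiscSummable.hasDerivAt {c : ℕ → ℂ} (hc : UnitDiscSummable c) {z : ℂ}
    (hz : ‖z‖ < 1) :
    HasDerivAt (fun w => ∑' n, c n * w ^ n) (∑' n, c (n + 1) * (n + 1) * z ^ n) z := by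
  obtain ⟨r, hr1, hr2⟩ := exists_between hz
  have hr0 : 0 ≤ r := (norm_nonneg z).trans hr1.le
  have hd : DifferentiableOn ℂ (fun w => ∑' n, c n * w ^ n) (Metric.ball 0 r) :=
    Complex.differentiableOn_tsum_of_summable_norm (hc r hr0 hr2) (fun n => by fun_prop)
      Metric.isOpen_ball (fun n w hw => by
      rw [norm_mul, norm_pow]
      have : ‖w‖ < r := by simpa using hw
      gcongr)
  have h1 := (hd.differentiableAt (Metric.isOpen_ball.mem_nhds
    (show z ∈ Metric.ball 0 r by simpa using hr1))).hasDerivAt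
  have h2 := (hasSum_nat_add_iff' 1).2 (hc.hasSum_deriv hz)
  simp only [Finset.range_one, Finset.sum_singleton, Nat.cast_zero, zero_mul, mul_zero,
    sub_zero, Nat.add_sub_cancel] at h2
  rw [← h2.tsum_eq] at h1
  refine h1.congr_deriv (tsum_congr fun n => ?_)
  push_cast
  ring

/-- Termwise differentiation does not shrink the disc: at an intermediate radius s the factor n + 1
is absorbed by the geometric decay of (r/s)^n. -/
theorem UnitDiscSummable.succ_mul {c : ℕ → ℂ} (hc : UnitDiscSummable c) :
    UnitDiscSummable fun n => c (n + 1) * (n + 1) := by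
  intro r hr0 hr1
  obtain ⟨s, hrs, hs1⟩ := exists_between hr1
  have hs0 : 0 < s := hr0.trans_lt hrs
  have h1 : Summable fun n : ℕ => ‖c (n + 1)‖ * s ^ (n + 1) :=
    (summable_nat_add_iff 1).2 (hc s hs0.le hs1)
  have h2 : Tendsto (fun n : ℕ => (n : ℝ) * (r / s) ^ n) atTop (𝓝 0) :=
    tendsto_self_mul_const_pow_of_lt_one (div_nonneg hr0 hs0.le) ((div_lt_one hs0).2 hrs)
  have h3 : Tendsto (fun n : ℕ => (r / s) ^ n) atTop (𝓝 0) :=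
    tendsto_pow_atTop_nhds_zero_of_lt_one (div_nonneg hr0 hs0.le) ((div_lt_one hs0).2 hrs)
  -- The bound is s rather than 1 because the comparison series carries s^(n+1), one power more than
  -- s^n.
  have h4 : ∀ᶠ n : ℕ in atTop, (n : ℝ) * (r / s) ^ n + (r / s) ^ n < s := by
    have := h2.add h3
    rw [add_zero] at this
    exact this.eventually_lt_const hs0
  refine Summable.of_norm_bounded_eventually_nat h1 ?_
  filter_upwards [h4] with n hn
  have e : ‖c (n + 1) * ((n : ℂ) + 1)‖ = ‖c (n + 1)‖ * (n + 1) := by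
    rw [norm_mul]; congr 1; exact_mod_cast Complex.norm_natCast (n + 1)
  rw [e, Real.norm_of_nonneg (by positivity)]
  have : r ^ n = s ^ n * (r / s) ^ n := by rw [← mul_pow]; congr 1; field_simp
  rw [this, pow_succ, mul_assoc]
  refine mul_le_mul_of_nonneg_left ?_ (norm_nonneg _)
  have h5 : (0 : ℝ) < s ^ n := by positivity
  nlinarith

/-! ### Gauss's equation and Euler's transformation. -/

section Hypergeometric

variable {a b c : ℂ}

theorem ascPochhammer_eval_ne_zero (hc : ∀ k : ℕ, c ≠ -k) (n : ℕ) :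
    (ascPochhammer ℂ n).eval c ≠ 0 := by
  rw [Ne, ascPochhammer_eval_eq_zero_iff]
  rintro ⟨k, -, hk⟩
  exact hc k (by rw [hk]; ring)

/-- Gauss's differential equation read off coefficient by coefficient. -/
theorem ordinaryHypergeometricCoefficient_succ (hc : ∀ k : ℕ, c ≠ -k) (n : ℕ) :
    ordinaryHypergeometricCoefficient a b c (n + 1) * (n + 1) * (n + c) =
      ordinaryHypergeometricCoefficient a b c n * ((n + a) * (n + b)) := by
  have h1 := ascPochhammer_eval_ne_zero hc n
  have h2 := ascPochhammer_eval_ne_zero hc (n + 1)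
  have h3 : (n.factorial : ℂ) ≠ 0 := by exact_mod_cast n.factorial_ne_zero
  have h4 : (n : ℂ) + 1 ≠ 0 := by exact_mod_cast n.succ_ne_zero
  simp only [ordinaryHypergeometricCoefficient, ascPochhammer_succ_eval, Nat.factorial_succ,
    Nat.cast_mul, Nat.cast_add, Nat.cast_one] at h2 ⊢
  have h5 : c + n ≠ 0 := right_ne_zero_of_mul h2
  field_simp
  ring

theorem ordinaryHypergeometric_eq_tsum_mul (a b c z : ℂ) :
    ordinaryHypergeometric a b c z =
      ∑' n, ordinaryHypergeometricCoefficient a b c n * z ^ n := by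
  simp [ordinaryHypergeometric_eq_tsum, ordinaryHypergeometricCoefficient]

/-- The regularized series has radius at least 1 and differs from this one by the factor 1/Γ(c),
nonzero off the poles. -/
theorem unitDiscSummable_ordinaryHypergeometricCoefficient (a b : ℂ) (hc : ∀ k : ℕ, c ≠ -k) :
    UnitDiscSummable (ordinaryHypergeometricCoefficient a b c) := by
  intro r hr0 hr1
  have h := Complex.radius_regularizedGaussHGFunSeries_ge_one a b c
  lift r to NNReal using hr0
  have h1 : (r : ENNReal) < (Complex.regularizedGaussHGFunSeries a b c).radius :=
    lt_of_lt_of_le (by exact_mod_cast hr1) h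
  have h2 := (Complex.regularizedGaussHGFunSeries a b c).summable_norm_mul_pow h1
  have hG : Complex.Gamma c ≠ 0 := Complex.Gamma_ne_zero hc
  refine (h2.mul_left ‖Complex.Gamma c‖).congr fun n => ?_
  rw [FormalMultilinearSeries.norm_apply_eq_norm_coef,
    ← Complex.Gamma_inv_mul_ordinaryHypergeometricSeries_eq hc, ordinaryHypergeometricSeries,
    FormalMultilinearSeries.coeff_ofScalars, norm_mul, norm_inv]
  field_simp

/-- The first and second derivatives of the Gauss hypergeometric function on the unit disc,
together with the hypergeometric differential equation. -/
theorem exists_hasDerivAt_ordinaryHypergeometric (a b : ℂ) (hc : ∀ k : ℕ, c ≠ -k) :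
    ∃ F₁ F₂ : ℂ → ℂ, ∀ z : ℂ, ‖z‖ < 1 →
      HasDerivAt (ordinaryHypergeometric a b c) (F₁ z) z ∧ HasDerivAt F₁ (F₂ z) z ∧
      z * (1 - z) * F₂ z + (c - (a + b + 1) * z) * F₁ z
        = a * b * ordinaryHypergeometric a b c z := by
  set C := ordinaryHypergeometricCoefficient a b c with hC
  have hF : ordinaryHypergeometric a b c = fun z => ∑' n, C n * z ^ n :=
    funext (ordinaryHypergeometric_eq_tsum_mul a b c)
  have s0 : UnitDiscSummable C := unitDiscSummable_ordinaryHypergeometricCoefficient a b hc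
  have s1 := s0.succ_mul
  have s2 := s1.succ_mul
  refine ⟨fun z => ∑' n, C (n + 1) * (n + 1) * z ^ n, fun z => ∑' n : ℕ,
    C (n + 1 + 1) * (((n + 1 : ℕ) : ℂ) + 1) * (n + 1) * z ^ n, fun z hz => ⟨?_, ?_, ?_⟩⟩
  · rw [hF]; exact s0.hasDerivAt hz
  · exact s1.hasDerivAt hz
  · rw [hF]
    have h0 := (s0.summable hz).hasSum
    have h1 := (s1.summable hz).hasSum
    have h2 := (s2.summable hz).hasSum
    set A0 := ∑' n, C n * z ^ n
    set A1 := ∑' n, C (n + 1) * (n + 1) * z ^ n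
    set A2 := ∑' n : ℕ, C (n + 1 + 1) * (((n + 1 : ℕ) : ℂ) + 1) * (n + 1) * z ^ n
    have h2' : HasSum (fun n : ℕ => C (n + 1) * (n + 1) * n * z ^ n) (z * A2) := by
      rw [← hasSum_nat_add_iff' 1]
      simp only [Finset.range_one, Finset.sum_singleton, Nat.cast_zero, zero_mul, mul_zero,
        sub_zero]
      refine (h2.mul_left z).congr_fun fun n => ?_
      push_cast; ring
    have h1' : HasSum (fun n : ℕ => C n * n * z ^ n) (z * A1) := by
      rw [← hasSum_nat_add_iff' 1]
      simp only [Finset.range_one, Finset.sum_singleton, Nat.cast_zero, zero_mul, mul_zero,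
        sub_zero]
      refine (h1.mul_left z).congr_fun fun n => ?_
      push_cast; ring
    have h2'' : HasSum (fun n : ℕ => C n * n * (n - 1) * z ^ n) (z * (z * A2)) := by
      rw [← hasSum_nat_add_iff' 1]
      simp only [Finset.range_one, Finset.sum_singleton, Nat.cast_zero, zero_mul, mul_zero,
        sub_zero]
      refine (h2'.mul_left z).congr_fun fun n => ?_
      push_cast; ring
    -- `e1` sums z F'' + c F', and `e2` sums z² F'' + (a+b+1) z F' + ab F; the coefficient
    -- recurrence makes the two series equal term by term.
    have e1 := h2'.add (h1.mul_left c)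
    have e2 := (h2''.add (h1'.mul_left (a + b + 1))).add (h0.mul_left (a * b))
    have := e1.unique (e2.congr_fun fun n => by
      have := ordinaryHypergeometricCoefficient_succ (a := a) (b := b) hc n
      rw [← hC] at this
      linear_combination (z ^ n) * this)
    linear_combination this

/-- A solution of the hypergeometric equation which is holomorphic on the unit disc and vanishes
at the origin is zero. -/
theorem eq_zero_of_hypergeometric_equation (hc : ∀ k : ℕ, c ≠ -k) {w w₁ w₂ : ℂ → ℂ}
    (h1 : ∀ z : ℂ, ‖z‖ < 1 → HasDerivAt w (w₁ z) z)
    (h2 : ∀ z : ℂ, ‖z‖ < 1 → HasDerivAt w₁ (w₂ z) z)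
    (hode : ∀ z : ℂ, ‖z‖ < 1 →
      z * (1 - z) * w₂ z + (c - (a + b + 1) * z) * w₁ z = a * b * w z)
    (h0 : w 0 = 0) {z : ℂ} (hz : ‖z‖ < 1) : w z = 0 := by
  have hd : DifferentiableOn ℂ w (Metric.ball 0 1) := fun z hz =>
    (h1 z (by simpa using hz)).differentiableAt.differentiableWithinAt
  have han : AnalyticOnNhd ℂ w (Metric.ball 0 1) := hd.analyticOnNhd Metric.isOpen_ball
  have hz0 : (0 : ℂ) ∈ Metric.ball (0 : ℂ) 1 := by simp
  by_cases hloc : ∀ᶠ z in 𝓝 0, w z = 0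
  · exact han.eqOn_zero_of_preconnected_of_eventuallyEq_zero
      (convex_ball 0 1).isPreconnected hz0 hloc (by simpa using hz)
  exfalso
  -- Factor out the exact order of vanishing, w = z^(m+1) g with g(0) ≠ 0, and examine the
  -- lowest-order term of the equation.
  obtain ⟨n, g, hg, hg0, hwg⟩ :=
    (han 0 hz0).exists_eventuallyEq_pow_smul_nonzero_iff.2 hloc
  simp only [sub_zero, smul_eq_mul] at hwg
  obtain _ | m := n
  · have := hwg.self_of_nhds
    simp [h0] at this
    exact hg0 this.symm
  have hball : ∀ᶠ z : ℂ in 𝓝 0, ‖z‖ < 1 := by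
    filter_upwards [Metric.ball_mem_nhds (0 : ℂ) one_pos] with z hz
    simpa using hz
  have hga := hg.eventually_analyticAt
  have hw1 : ∀ᶠ z in 𝓝 (0 : ℂ), w₁ z = (m + 1) * z ^ m * g z + z ^ (m + 1) * deriv g z := by
    filter_upwards [hwg.eventually_nhds, hga, hball] with z e1 e2 e3
    have d1 := (h1 z e3).congr_of_eventuallyEq (EventuallyEq.symm e1)
    have d2 := ((hasDerivAt_pow (m + 1) z).mul e2.differentiableAt.hasDerivAt)
    have := d1.unique d2
    rw [this]; push_cast; simp
  have hw2 : ∀ᶠ z in 𝓝 (0 : ℂ), w₂ z = (m + 1) * (m * z ^ (m - 1)) * g z +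
      2 * (m + 1) * z ^ m * deriv g z + z ^ (m + 1) * deriv (deriv g) z := by
    filter_upwards [hw1.eventually_nhds, hga, hball] with z e1 e2 e3
    have d1 := (h2 z e3).congr_of_eventuallyEq (EventuallyEq.symm e1)
    have d2 := (((hasDerivAt_pow m z).const_mul ((m : ℂ) + 1)).mul
      e2.differentiableAt.hasDerivAt).add
      ((hasDerivAt_pow (m + 1) z).mul e2.deriv.differentiableAt.hasDerivAt)
    have := d1.unique d2
    rw [this]; push_cast; ring
  -- `B` is the equation divided by z^m. Its value at 0 is the indicial polynomial (m+1)(m+c) times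
  -- g(0), so the exponent m+1 would force c = -m.
  let B : ℂ → ℂ := fun z => (1 - z) * ((m + 1) * m * g z + 2 * (m + 1) * z * deriv g z +
    z ^ 2 * deriv (deriv g) z) + (c - (a + b + 1) * z) * ((m + 1) * g z + z * deriv g z) -
    a * b * z * g z
  have hB : ∀ᶠ z in 𝓝[≠] (0 : ℂ), B z = 0 := by
    filter_upwards [hwg.filter_mono nhdsWithin_le_nhds, hw1.filter_mono nhdsWithin_le_nhds,
      hw2.filter_mono nhdsWithin_le_nhds, hball.filter_mono nhdsWithin_le_nhds,
      self_mem_nhdsWithin] with z e0 e1 e2 e3 e4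
    have e4 : z ≠ 0 := e4
    have := hode z e3
    rw [e0, e1, e2] at this
    -- At m = 0 the truncated exponent is harmless, since the factor m vanishes.
    have hm : (m : ℂ) * z ^ (m - 1) * z = m * z ^ m := by
      rcases m with _ | m
      · simp
      · simp [pow_succ, mul_assoc]
    refine (mul_eq_zero.1 (?_ : z ^ m * B z = 0)).resolve_left (pow_ne_zero _ e4)
    simp only [B]
    linear_combination this - (m + 1) * (1 - z) * g z * hm
  have hBc : ContinuousAt B 0 := by
    have c1 := hg.continuousAt
    have c2 := hg.deriv.continuousAt
    have c3 := hg.deriv.deriv.continuousAt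
    fun_prop
  have hB0 : B 0 = 0 := by
    refine tendsto_nhds_unique (hBc.tendsto.mono_left nhdsWithin_le_nhds : Tendsto B (𝓝[≠] 0) _) ?_
    exact tendsto_const_nhds.congr' (hB.mono fun z hz => hz.symm)
  have : ((m : ℂ) + 1) * (m + c) * g 0 = 0 := by
    simp only [B] at hB0
    linear_combination hB0
  rcases mul_eq_zero.1 this with h | h
  · rcases mul_eq_zero.1 h with h | h
    · exact Nat.cast_add_one_ne_zero m h
    · exact hc m (by linear_combination h)
  · exact hg0 h

/-- **Euler's transformation** of the Gauss hypergeometric function. -/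
theorem ordinaryHypergeometric_eq_cpow_mul (a b : ℂ) (hc : ∀ k : ℕ, c ≠ -k) {z : ℂ}
    (hz : ‖z‖ < 1) :
    ordinaryHypergeometric a b c z =
      (1 - z) ^ (c - a - b) * ordinaryHypergeometric (c - a) (c - b) c z := by
  obtain ⟨F₁, F₂, hF⟩ := exists_hasDerivAt_ordinaryHypergeometric a b hc
  obtain ⟨V₁, V₂, hV⟩ := exists_hasDerivAt_ordinaryHypergeometric (c - a) (c - b) hc
  set F : ℂ → ℂ := ordinaryHypergeometric a b c
  set V : ℂ → ℂ := ordinaryHypergeometric (c - a) (c - b) c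
  set s := c - a - b with hs
  have hne : ∀ z : ℂ, ‖z‖ < 1 → 1 - z ≠ 0 := by
    intro z hz h
    rw [← sub_eq_zero.1 h] at hz
    simp at hz
  have hpow : ∀ z : ℂ, ‖z‖ < 1 → ∀ t : ℂ,
      HasDerivAt (fun z => (1 - z) ^ t) (-t * (1 - z) ^ (t - 1)) z := by
    intro z hz t
    have hsl : 1 - z ∈ Complex.slitPlane := by
      rw [sub_eq_add_neg]
      exact Complex.mem_slitPlane_of_norm_lt_one (by simpa using hz)
    have := ((hasDerivAt_id z).const_sub 1).cpow_const (c := t) hsl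
    simpa using this
  -- Both sides are holomorphic solutions of the same Gauss equation with value 1 at 0, so their
  -- difference vanishes.
  have key := eq_zero_of_hypergeometric_equation (a := a) (b := b) hc
    (w := fun z => F z - (1 - z) ^ s * V z)
    (w₁ := fun z => F₁ z - (-s * (1 - z) ^ (s - 1) * V z + (1 - z) ^ s * V₁ z))
    (w₂ := fun z => F₂ z - (-s * (-(s - 1) * (1 - z) ^ (s - 1 - 1)) * V z +
      -s * (1 - z) ^ (s - 1) * V₁ z +
      (-s * (1 - z) ^ (s - 1) * V₁ z + (1 - z) ^ s * V₂ z)))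
    (fun z hz => (hF z hz).1.sub ((hpow z hz s).mul (hV z hz).1))
    (fun z hz => (hF z hz).2.1.sub ((((hpow z hz (s - 1)).const_mul (-s)).mul (hV z hz).1).add
      ((hpow z hz s).mul (hV z hz).2.1)))
    (fun z hz => by
      have h1 := hne z hz
      have e1 : (1 - z) ^ s = (1 - z) ^ (s - 1 - 1) * (1 - z) ^ 2 := by
        rw [← Complex.cpow_natCast, ← Complex.cpow_add _ _ h1]; congr 1; push_cast; ring
      have e2 : (1 - z) ^ (s - 1) = (1 - z) ^ (s - 1 - 1) * (1 - z) := by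
        nth_rw 1 [← sub_add_cancel (s - 1) 1]
        rw [Complex.cpow_add _ _ h1, Complex.cpow_one]
      have o1 := (hF z hz).2.2
      have o2 := (hV z hz).2.2
      rw [e1, e2]
      generalize (1 - z) ^ (s - 1 - 1) = X
      simp only [hs]
      linear_combination o1 - X * (1 - z) ^ 2 * o2)
    (by simp [F, V]) hz
  exact sub_eq_zero.1 key

end Hypergeometric

theorem ordinaryHypergeometric_ofReal_eq_rpow_mul {a b c : ℂ} (hc : ∀ k : ℕ, c ≠ -k) {t : ℝ}
    (ht : c - a - b = t) {z : ℝ} (hz0 : 0 ≤ z) (hz1 : z < 1) :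
    ordinaryHypergeometric a b c (z : ℂ) =
      (((1 - z) ^ t : ℝ) : ℂ) * ordinaryHypergeometric (c - a) (c - b) c (z : ℂ) := by
  rw [ordinaryHypergeometric_eq_cpow_mul a b hc
    (by rwa [Complex.norm_real, Real.norm_of_nonneg hz0]), ht,
    Complex.ofReal_cpow (by linarith)]
  push_cast
  rfl

/-! ### Continuity in the parameters. -/

/-- Factor by factor |a + k| ≤ R + k. This gives a majorant of the hypergeometric coefficients that
is uniform over a ball of parameters. -/
theorem norm_ascPochhammer_eval_le {a : ℂ} {R : ℝ} (h : ‖a‖ ≤ R) (n : ℕ) :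
    ‖(ascPochhammer ℂ n).eval a‖ ≤ ‖(ascPochhammer ℂ n).eval (R : ℂ)‖ := by
  have hR : 0 ≤ R := (norm_nonneg a).trans h
  induction n with
  | zero => simp
  | succ n ih =>
    rw [ascPochhammer_succ_eval, ascPochhammer_succ_eval, norm_mul, norm_mul]
    refine mul_le_mul ih ?_ (norm_nonneg _) (norm_nonneg _)
    have : ‖(R : ℂ) + n‖ = R + n := by
      rw [← Complex.ofReal_natCast, ← Complex.ofReal_add, Complex.norm_real,
        Real.norm_of_nonneg (by positivity)]
    rw [this]
    refine (norm_add_le _ _).trans ?_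
    simpa using h

/-- The Gauss hypergeometric function depends continuously on its numerator parameters. -/
theorem continuous_ordinaryHypergeometric_param {c : ℂ} (hc : ∀ k : ℕ, c ≠ -k) {z : ℂ}
    (hz : ‖z‖ < 1) :
    Continuous fun p : ℂ × ℂ => ordinaryHypergeometric p.1 p.2 c z := by
  simp only [ordinaryHypergeometric_eq_tsum_mul]
  rw [continuous_iff_continuousAt]
  intro p
  -- On the ball of radius R around 0, which contains a neighbourhood of p, the series with both
  -- numerator parameters equal to R dominates.
  set R : ℝ := ‖p‖ + 1
  have hs := unitDiscSummable_ordinaryHypergeometricCoefficient (R : ℂ) (R : ℂ) hc ‖z‖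
    (norm_nonneg z) hz
  have : ContinuousOn (fun p : ℂ × ℂ => ∑' n, ordinaryHypergeometricCoefficient p.1 p.2 c n * z ^ n)
      (Metric.ball 0 R) := by
    refine continuousOn_tsum (fun n => ?_) hs fun n q hq => ?_
    · refine Continuous.continuousOn ?_
      unfold ordinaryHypergeometricCoefficient
      have h1 : Continuous fun q : ℂ × ℂ => (ascPochhammer ℂ n).eval q.1 :=
        (ascPochhammer ℂ n).continuous.comp continuous_fst
      have h2 : Continuous fun q : ℂ × ℂ => (ascPochhammer ℂ n).eval q.2 :=
        (ascPochhammer ℂ n).continuous.comp continuous_snd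
      fun_prop
    · have hq : ‖q‖ < R := by simpa using hq
      have e1 := norm_ascPochhammer_eval_le ((norm_fst_le q).trans hq.le) n
      have e2 := norm_ascPochhammer_eval_le ((norm_snd_le q).trans hq.le) n
      simp only [ordinaryHypergeometricCoefficient, norm_mul, norm_pow]
      gcongr
  exact this.continuousAt (Metric.isOpen_ball.mem_nhds (by simp [R]))

/-! ### Asymptotics at the singular point 1. -/

/-- An Abelian theorem for the ratio of two power series at the boundary of their common disc of
convergence. -/
theorem tendsto_tsum_div_tsum_of_tendsto_div {u : ℕ → ℂ} {v : ℕ → ℝ} {l : ℂ}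
    (hu : UnitDiscSummable u) (hv : ∀ x : ℝ, 0 ≤ x → x < 1 → Summable fun n => v n * x ^ n)
    (hv0 : ∀ n, 0 ≤ v n) (hv1 : ∀ᶠ n in atTop, v n ≠ 0)
    (hlim : Tendsto (fun n => u n / v n) atTop (𝓝 l))
    (hV : Tendsto (fun x : ℝ => ∑' n, v n * x ^ n) (𝓝[<] 1) atTop) :
    Tendsto (fun x : ℝ => (∑' n, u n * (x : ℂ) ^ n) / ((∑' n, v n * x ^ n : ℝ) : ℂ))
      (𝓝[<] 1) (𝓝 l) := by
  rw [Metric.tendsto_nhds]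
  intro ε hε
  have h1 : ∀ᶠ n in atTop, ‖u n - l * v n‖ ≤ ε / 2 * v n := by
    filter_upwards [Metric.tendsto_nhds.1 hlim (ε / 2) (by positivity), hv1] with n h h0
    rw [dist_eq_norm] at h
    have h0' : (v n : ℂ) ≠ 0 := by exact_mod_cast h0
    have : u n - l * v n = (u n / v n - l) * v n := by field_simp
    rw [this, norm_mul, Complex.norm_real, Real.norm_of_nonneg (hv0 n)]
    exact mul_le_mul_of_nonneg_right h.le (hv0 n)
  obtain ⟨M, hM⟩ := eventually_atTop.1 h1
  -- The tail error is at most ε/2 times the comparison sum; the finite head K is beaten because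
  -- that sum tends to infinity.
  set K := ∑ n ∈ Finset.range M, ‖u n - l * v n‖
  have hx0 : ∀ᶠ x : ℝ in 𝓝[<] 1, 0 < x ∧ x < 1 := by
    have : Set.Ioo (0 : ℝ) 1 ∈ 𝓝[<] (1 : ℝ) := Ioo_mem_nhdsLT one_pos
    exact this
  filter_upwards [hx0, hV.eventually_gt_atTop (2 * K / ε), hV.eventually_gt_atTop 0]
    with x ⟨hx0, hx1⟩ hK hpos
  set V := ∑' n, v n * x ^ n with hVdef
  have su : Summable fun n => u n * (x : ℂ) ^ n :=
    hu.summable (by rwa [Complex.norm_real, Real.norm_of_nonneg hx0.le])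
  have sv := hv x hx0.le hx1
  have svc : HasSum (fun n => (v n : ℂ) * (x : ℂ) ^ n) (V : ℂ) := by
    have := Complex.hasSum_ofReal.2 sv.hasSum
    simpa using this
  have hd : HasSum (fun n => (u n - l * v n) * (x : ℂ) ^ n)
      ((∑' n, u n * (x : ℂ) ^ n) - l * V) :=
    (su.hasSum.sub (svc.mul_left l)).congr_fun fun n => by ring
  have hfin : HasSum (fun n => if n ∈ Finset.range M then ‖u n - l * v n‖ else 0) K := by
    have := hasSum_sum_of_ne_finset_zero (L := .unconditional ℕ)
      (f := fun n => if n ∈ Finset.range M then ‖u n - l * v n‖ else 0) (s := Finset.range M)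
      (fun n hn => if_neg hn)
    rwa [Finset.sum_congr rfl (fun n hn => if_pos hn)] at this
  have hb := hfin.add (sv.hasSum.mul_left (ε / 2))
  have hle : ‖(∑' n, u n * (x : ℂ) ^ n) - l * V‖ ≤ K + ε / 2 * V := by
    rw [← hd.tsum_eq]
    refine tsum_of_norm_bounded hb fun n => ?_
    rw [norm_mul, norm_pow, Complex.norm_real, Real.norm_of_nonneg hx0.le]
    have hp : 0 < x ^ n := by positivity
    have hp1 : x ^ n ≤ 1 := pow_le_one₀ hx0.le hx1.le
    split_ifs with hn
    · have : 0 ≤ ε / 2 * (v n * x ^ n) := by have := hv0 n; positivity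
      have := mul_le_of_le_one_right (norm_nonneg (u n - l * v n)) hp1
      linarith
    · have := hM n (by simpa using hn)
      rw [zero_add, ← mul_assoc]
      exact mul_le_mul_of_nonneg_right this hp.le
  have hVne : (V : ℂ) ≠ 0 := by exact_mod_cast hpos.ne'
  rw [dist_eq_norm]
  have : (∑' n, u n * (x : ℂ) ^ n) / (V : ℂ) - l = ((∑' n, u n * (x : ℂ) ^ n) - l * V) / V := by
    field_simp
  rw [this, norm_div, Complex.norm_real, Real.norm_of_nonneg hpos.le, div_lt_iff₀ hpos]
  rw [div_lt_iff₀ hε] at hK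
  linarith

/-- Euler's limit formula for Γ, rearranged so that the growth of Pochhammer symbols follows from
the convergence of `Complex.GammaSeq`. -/
theorem ascPochhammer_eval_eq_div_GammaSeq {s : ℂ} (hs : ∀ k : ℕ, s ≠ -k) {n : ℕ} (hn : n ≠ 0) :
    (ascPochhammer ℂ (n + 1)).eval s = (n : ℂ) ^ s * n.factorial / Complex.GammaSeq s n ∧
      Complex.GammaSeq s n ≠ 0 := by
  have h1 := ascPochhammer_eval_ne_zero hs (n + 1)
  have h2 : ((n.factorial : ℕ) : ℂ) ≠ 0 := by exact_mod_cast n.factorial_ne_zero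
  have h3 : (n : ℂ) ^ s ≠ 0 := by
    rw [Ne, Complex.cpow_eq_zero_iff]; simp [hn]
  have h4 : (ascPochhammer ℂ (n + 1)).eval s = ∏ j ∈ Finset.range (n + 1), (s + j) := by
    generalize n + 1 = m
    induction m with
    | zero => simp
    | succ m ih => rw [ascPochhammer_succ_eval, Finset.prod_range_succ, ih]
  rw [h4] at h1 ⊢
  unfold Complex.GammaSeq
  constructor
  · field_simp
  · exact div_ne_zero (mul_ne_zero h3 h2) h1

/-- The balance a + b = c + s cancels all powers of n, leaving only Gamma values. -/
theorem tendsto_ascPochhammer_ratio {a b c s : ℂ} (ha : ∀ k : ℕ, a ≠ -k) (hb : ∀ k : ℕ, b ≠ -k)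
    (hc : ∀ k : ℕ, c ≠ -k) (hs : ∀ k : ℕ, s ≠ -k) (h : a + b = c + s) :
    Tendsto (fun n : ℕ => (ascPochhammer ℂ n).eval a * (ascPochhammer ℂ n).eval b /
      ((ascPochhammer ℂ n).eval c * (ascPochhammer ℂ n).eval s)) atTop
      (𝓝 (Complex.Gamma c * Complex.Gamma s / (Complex.Gamma a * Complex.Gamma b))) := by
  rw [← tendsto_add_atTop_iff_nat 1]
  have := ((Complex.GammaSeq_tendsto_Gamma c).mul (Complex.GammaSeq_tendsto_Gamma s)).div
    ((Complex.GammaSeq_tendsto_Gamma a).mul (Complex.GammaSeq_tendsto_Gamma b))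
    (mul_ne_zero (Complex.Gamma_ne_zero ha) (Complex.Gamma_ne_zero hb))
  refine this.congr' ?_
  filter_upwards [eventually_ne_atTop 0] with n hn
  obtain ⟨a1, a2⟩ := ascPochhammer_eval_eq_div_GammaSeq ha hn
  obtain ⟨b1, b2⟩ := ascPochhammer_eval_eq_div_GammaSeq hb hn
  obtain ⟨c1, c2⟩ := ascPochhammer_eval_eq_div_GammaSeq hc hn
  obtain ⟨s1, s2⟩ := ascPochhammer_eval_eq_div_GammaSeq hs hn
  have hn' : (n : ℂ) ≠ 0 := by exact_mod_cast hn
  have h2 : ((n.factorial : ℕ) : ℂ) ≠ 0 := by exact_mod_cast n.factorial_ne_zero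
  have hp : (n : ℂ) ^ a * (n : ℂ) ^ b = (n : ℂ) ^ c * (n : ℂ) ^ s := by
    rw [← Complex.cpow_add _ _ hn', ← Complex.cpow_add _ _ hn', h]
  have h3 : ∀ s : ℂ, (n : ℂ) ^ s ≠ 0 := fun s => by
    rw [Ne, Complex.cpow_eq_zero_iff]; simp [hn]
  have h4 := h3 c
  have h5 := h3 s
  simp only [Pi.div_apply]
  rw [a1, b1, c1, s1]
  have e : (n : ℂ) ^ a * (n.factorial : ℂ) / Complex.GammaSeq a n *
      ((n : ℂ) ^ b * (n.factorial : ℂ) / Complex.GammaSeq b n) =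
      ((n : ℂ) ^ c * (n : ℂ) ^ s) * (n.factorial : ℂ) ^ 2 /
        (Complex.GammaSeq a n * Complex.GammaSeq b n) := by
    rw [← hp]; field_simp
  rw [e]
  field_simp

/-- Behaviour of the Gauss hypergeometric function at `1` when `c - a - b < 0`. -/
theorem tendsto_ordinaryHypergeometric_mul_rpow {a b c : ℂ} {s : ℝ} (hs : 0 < s)
    (ha : ∀ k : ℕ, a ≠ -k) (hb : ∀ k : ℕ, b ≠ -k) (hc : ∀ k : ℕ, c ≠ -k)
    (h : a + b = c + s) :
    Tendsto (fun x : ℝ => ordinaryHypergeometric a b c (x : ℂ) * (((1 - x) ^ s : ℝ) : ℂ))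
      (𝓝[<] 1) (𝓝 (Complex.Gamma c * Complex.Gamma s / (Complex.Gamma a * Complex.Gamma b))) := by
  have hs' : ∀ k : ℕ, (s : ℂ) ≠ -k := by
    intro k hk
    have : s = -k := by exact_mod_cast hk
    have : (0 : ℝ) ≤ k := by positivity
    linarith
  -- The binomial coefficients of (1-x)^(-s), which are also the coefficients of ₂F₁(s, c; c; x).
  set v : ℕ → ℝ := fun n => (n.factorial : ℝ)⁻¹ * (ascPochhammer ℝ n).eval s with hvdef
  have hvc : ∀ n, (v n : ℂ) = ordinaryHypergeometricCoefficient (s : ℂ) c c n := by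
    intro n
    have h1 := ascPochhammer_eval_ne_zero hc n
    have h2 : (((ascPochhammer ℝ n).eval s : ℝ) : ℂ) = (ascPochhammer ℂ n).eval (s : ℂ) := by
      have := ascPochhammer_map (algebraMap ℝ ℂ) n
      rw [← this, Polynomial.eval_map_algebraMap, ← Complex.coe_algebraMap,
        Polynomial.aeval_algebraMap_apply]
      simp
    simp only [v, ordinaryHypergeometricCoefficient]
    push_cast
    rw [h2]
    field_simp
  have hv0 : ∀ n, 0 < v n := fun n => by
    have := ascPochhammer_pos n s hs
    positivity
  have hsv : ∀ x : ℝ, 0 ≤ x → x < 1 → Summable fun n => v n * x ^ n := by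
    intro x hx0 hx1
    refine (unitDiscSummable_ordinaryHypergeometricCoefficient (s : ℂ) c hc x hx0 hx1).congr ?_
    intro n
    rw [← hvc, Complex.norm_real, Real.norm_of_nonneg (hv0 n).le]
  have hVeq : ∀ x : ℝ, 0 ≤ x → x < 1 → ∑' n, v n * x ^ n = (1 - x) ^ (-s) := by
    intro x hx0 hx1
    -- The binomial series as a case of Euler's transformation: ₂F₁(s, c; c; x) = (1-x)^(-s)
    -- ₂F₁(c-s, 0; c; x), and the last factor is 1.
    have h1 := ordinaryHypergeometric_ofReal_eq_rpow_mul (a := s) (b := c) hc (t := -s)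
      (by push_cast; ring) hx0 hx1
    have h2 : ordinaryHypergeometric (c - s) (c - c) c (x : ℂ) = 1 := by
      rw [sub_self, ordinaryHypergeometric_eq_tsum_mul, tsum_eq_single 0]
      · simp [ordinaryHypergeometricCoefficient]
      · intro n hn
        have : (ascPochhammer ℂ n).eval (0 : ℂ) = 0 := by
          rw [ascPochhammer_eval_zero]; simp [hn]
        rw [ordinaryHypergeometricCoefficient, this]
        simp
    rw [h2, mul_one, ordinaryHypergeometric_eq_tsum_mul] at h1
    have h3 : ((∑' n, v n * x ^ n : ℝ) : ℂ) = (((1 - x) ^ (-s) : ℝ) : ℂ) := by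
      rw [Complex.ofReal_tsum, ← h1]
      simp only [Complex.ofReal_mul, Complex.ofReal_pow, hvc]
    exact_mod_cast h3
  have hx0 : ∀ᶠ x : ℝ in 𝓝[<] 1, 0 < x ∧ x < 1 := by
    have : Set.Ioo (0 : ℝ) 1 ∈ 𝓝[<] (1 : ℝ) := Ioo_mem_nhdsLT one_pos
    exact this
  have hV : Tendsto (fun x : ℝ => ∑' n, v n * x ^ n) (𝓝[<] 1) atTop := by
    have h1 : Tendsto (fun x : ℝ => 1 - x) (𝓝[<] 1) (𝓝[>] 0) := by
      refine tendsto_nhdsWithin_of_tendsto_nhds_of_eventually_within _ ?_ ?_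
      · have : Tendsto (fun x : ℝ => 1 - x) (𝓝 1) (𝓝 (1 - 1)) := by
          exact (continuous_const.sub continuous_id).tendsto _
        rw [sub_self] at this
        exact this.mono_left nhdsWithin_le_nhds
      · filter_upwards [hx0] with x hx
        exact sub_pos.2 hx.2
    refine ((tendsto_rpow_neg_nhdsGT_zero (neg_lt_zero.2 hs)).comp h1).congr' ?_
    filter_upwards [hx0] with x hx
    exact (hVeq x hx.1.le hx.2).symm
  have key := tendsto_tsum_div_tsum_of_tendsto_div
    (unitDiscSummable_ordinaryHypergeometricCoefficient a b hc) hsv (fun n => (hv0 n).le)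
    (Eventually.of_forall fun n => (hv0 n).ne')
    (l := Complex.Gamma c * Complex.Gamma s / (Complex.Gamma a * Complex.Gamma b))
    ((tendsto_ascPochhammer_ratio ha hb hc hs' h).congr fun n => by
      rw [hvc]
      have h1 := ascPochhammer_eval_ne_zero hc n
      have h2 := ascPochhammer_eval_ne_zero hs' n
      have h3 : (n.factorial : ℂ) ≠ 0 := by exact_mod_cast n.factorial_ne_zero
      simp only [ordinaryHypergeometricCoefficient]
      field_simp) hV
  refine key.congr' ?_
  filter_upwards [hx0] with x hx
  rw [ordinaryHypergeometric_eq_tsum_mul, hVeq x hx.1.le hx.2,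
    Real.rpow_neg (by linarith [hx.2] : (0 : ℝ) ≤ 1 - x)]
  push_cast
  rw [div_inv_eq_mul]

/-- Behaviour of the Gauss hypergeometric function at `1` when `c = a + b = 1`. -/
theorem tendsto_ordinaryHypergeometric_div_log {a b : ℂ}
    (ha : ∀ k : ℕ, a ≠ -k) (hb : ∀ k : ℕ, b ≠ -k) (h : a + b = 1) :
    Tendsto (fun x : ℝ => ordinaryHypergeometric a b 1 (x : ℂ) / ((-Real.log (1 - x) : ℝ) : ℂ))
      (𝓝[<] 1) (𝓝 (1 / (Complex.Gamma a * Complex.Gamma b))) := by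
  have h1' : ∀ k : ℕ, (1 : ℂ) ≠ -k := by
    intro k hk
    have : (1 : ℝ) = -k := by exact_mod_cast hk
    have : (0 : ℝ) ≤ k := by positivity
    linarith
  have h2' : ∀ k : ℕ, (2 : ℂ) ≠ -k := by
    intro k hk
    have : (2 : ℝ) = -k := by exact_mod_cast hk
    have : (0 : ℝ) ≤ k := by positivity
    linarith
  -- As 0⁻¹ = 0, this is the coefficient sequence of -log(1-x), constant term included; hence the
  -- comparison coefficients are only eventually nonzero.
  set v : ℕ → ℝ := fun n => (n : ℝ)⁻¹
  have hsum : ∀ x : ℝ, 0 ≤ x → x < 1 → HasSum (fun n => v n * x ^ n) (-Real.log (1 - x)) := by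
    intro x hx0 hx1
    rw [← hasSum_nat_add_iff' 1]
    simp only [v, Finset.range_one, Finset.sum_singleton, Nat.cast_zero, inv_zero, zero_mul,
      sub_zero]
    refine (Real.hasSum_pow_div_log_of_abs_lt_one (by rwa [abs_of_nonneg hx0])).congr_fun
      fun n => ?_
    push_cast
    rw [div_eq_inv_mul]
  have hx0 : ∀ᶠ x : ℝ in 𝓝[<] 1, 0 < x ∧ x < 1 := by
    have : Set.Ioo (0 : ℝ) 1 ∈ 𝓝[<] (1 : ℝ) := Ioo_mem_nhdsLT one_pos
    exact this
  have hV : Tendsto (fun x : ℝ => ∑' n, v n * x ^ n) (𝓝[<] 1) atTop := by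
    have h1 : Tendsto (fun x : ℝ => 1 - x) (𝓝[<] 1) (𝓝[>] 0) := by
      refine tendsto_nhdsWithin_of_tendsto_nhds_of_eventually_within _ ?_ ?_
      · have : Tendsto (fun x : ℝ => 1 - x) (𝓝 1) (𝓝 (1 - 1)) := by
          exact (continuous_const.sub continuous_id).tendsto _
        rw [sub_self] at this
        exact this.mono_left nhdsWithin_le_nhds
      · filter_upwards [hx0] with x hx
        exact sub_pos.2 hx.2
    refine (tendsto_neg_atBot_atTop.comp (Real.tendsto_log_nhdsGT_zero.comp h1)).congr' ?_
    filter_upwards [hx0] with x hx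
    exact (hsum x hx.1.le hx.2).tsum_eq.symm
  have hlim : Tendsto (fun n : ℕ => ordinaryHypergeometricCoefficient a b 1 n / (v n : ℂ)) atTop
      (𝓝 (1 / (Complex.Gamma a * Complex.Gamma b))) := by
    rw [← tendsto_add_atTop_iff_nat 1]
    have e1 := (tendsto_natCast_div_add_atTop (𝕜 := ℂ) 1).div
      ((Complex.GammaSeq_tendsto_Gamma a).mul (Complex.GammaSeq_tendsto_Gamma b))
      (mul_ne_zero (Complex.Gamma_ne_zero ha) (Complex.Gamma_ne_zero hb))
    refine e1.congr' ?_
    filter_upwards [eventually_ne_atTop 0] with n hn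
    obtain ⟨a1, a2⟩ := ascPochhammer_eval_eq_div_GammaSeq ha hn
    obtain ⟨b1, b2⟩ := ascPochhammer_eval_eq_div_GammaSeq hb hn
    have hn' : (n : ℂ) ≠ 0 := by exact_mod_cast hn
    have hn1 : (n : ℂ) + 1 ≠ 0 := by exact_mod_cast n.succ_ne_zero
    have h2 : ((n.factorial : ℕ) : ℂ) ≠ 0 := by exact_mod_cast n.factorial_ne_zero
    have hp : (n : ℂ) ^ a * (n : ℂ) ^ b = n := by
      rw [← Complex.cpow_add _ _ hn', h, Complex.cpow_one]
    have h1 : (ascPochhammer ℂ (n + 1)).eval 1 = ((n + 1).factorial : ℂ) := by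
      rw [ascPochhammer_eval_one]
    simp only [ordinaryHypergeometricCoefficient, Pi.div_apply, v]
    rw [a1, b1, h1, Nat.factorial_succ]
    push_cast
    have e : (n + 1 : ℂ) * n.factorial ≠ 0 := mul_ne_zero hn1 h2
    nth_rw 1 [← hp]
    field_simp
  have key := tendsto_tsum_div_tsum_of_tendsto_div
    (unitDiscSummable_ordinaryHypergeometricCoefficient a b h1')
    (fun x h0 h1 => (hsum x h0 h1).summable) (fun n => by positivity)
    (by filter_upwards [eventually_ne_atTop 0] with n hn
        exact inv_ne_zero (by exact_mod_cast hn)) hlim hV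
  refine key.congr' ?_
  filter_upwards [hx0] with x hx
  rw [ordinaryHypergeometric_eq_tsum_mul, (hsum x hx.1.le hx.2).tsum_eq]

/-! ### The Laplacian in coordinates and its conformal covariance. -/

section Laplacian

variable {N : ℕ}

theorem differentiableAt_fderiv_apply_of_contDiffAt {E F : Type*} [NormedAddCommGroup E]
    [NormedSpace ℝ E] [NormedAddCommGroup F] [NormedSpace ℝ F] {f : E → F} {x : E}
    (hf : ContDiffAt ℝ 2 f x) (v : E) : DifferentiableAt ℝ (fun y => fderiv ℝ f y v) x :=
  ((hf.fderiv_right (m := 1) (by norm_num)).differentiableAt (by norm_num)).clm_apply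
    (differentiableAt_const v)

theorem laplacian_eq_sum_fderiv {f : EuclideanSpace ℝ (Fin N) → ℂ}
    {x : EuclideanSpace ℝ (Fin N)} (hf : ContDiffAt ℝ 2 f x) :
    Laplacian.laplacian f x = ∑ i, fderiv ℝ (fun y => fderiv ℝ f y (EuclideanSpace.single i 1)) x
      (EuclideanSpace.single i 1) := by
  rw [InnerProductSpace.laplacian_eq_iteratedFDeriv_orthonormalBasis f
    (EuclideanSpace.basisFun (Fin N) ℝ)]
  refine Finset.sum_congr rfl fun i _ => ?_
  have hd : DifferentiableAt ℝ (fderiv ℝ f) x :=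
    (hf.fderiv_right (m := 1) (by norm_num)).differentiableAt (by norm_num)
  rw [iteratedFDeriv_two_apply, fderiv_clm_apply hd (differentiableAt_const _)]
  simp

/-- For a C² function, first and second directional derivatives can be read off the restriction to a
line, so the explicit formulas below are one-variable calculus. -/
theorem fderiv_apply_eq_of_hasDerivAt_line {E : Type*} [NormedAddCommGroup E]
    [NormedSpace ℝ E] {f : E → ℂ} {x v : E} (hf : ContDiffAt ℝ 2 f x) {g : ℝ → ℂ} {d : ℂ}
    (h1 : ∀ᶠ t in 𝓝 (0 : ℝ), HasDerivAt (fun s : ℝ => f (x + s • v)) (g t) t)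
    (h2 : HasDerivAt g d 0) :
    fderiv ℝ f x v = g 0 ∧ fderiv ℝ (fun y => fderiv ℝ f y v) x v = d := by
  have hline : ∀ t : ℝ, HasDerivAt (fun s : ℝ => x + s • v) v t := fun t => by
    simpa using ((hasDerivAt_id t).smul_const v).const_add x
  have hcont : Tendsto (fun t : ℝ => x + t • v) (𝓝 0) (𝓝 x) := by
    have := (hline 0).continuousAt.tendsto
    simpa using this
  have hev : ∀ᶠ t in 𝓝 (0 : ℝ), DifferentiableAt ℝ f (x + t • v) := by
    refine hcont.eventually ?_
    filter_upwards [hf.eventually (by simp)] with y hy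
    exact hy.differentiableAt (by norm_num)
  have e1 : ∀ᶠ t in 𝓝 (0 : ℝ), fderiv ℝ f (x + t • v) v = g t := by
    filter_upwards [h1, hev] with t ht1 ht2
    exact (ht2.hasFDerivAt.comp_hasDerivAt t (hline t)).unique ht1
  have e2 : fderiv ℝ f x v = g 0 := by simpa using e1.self_of_nhds
  refine ⟨e2, ?_⟩
  have h3 : HasDerivAt (fun t : ℝ => fderiv ℝ f (x + t • v) v) d 0 :=
    h2.congr_of_eventuallyEq e1
  have h4 : DifferentiableAt ℝ (fun y => fderiv ℝ f y v) (x + (0 : ℝ) • v) := by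
    simpa using differentiableAt_fderiv_apply_of_contDiffAt hf v
  have h5 := h4.hasFDerivAt.comp_hasDerivAt (0 : ℝ) (hline 0)
  have := h5.unique h3
  simpa using this

theorem laplacian_mul {f g : EuclideanSpace ℝ (Fin N) → ℂ}
    {x : EuclideanSpace ℝ (Fin N)} (hf : ContDiffAt ℝ 2 f x) (hg : ContDiffAt ℝ 2 g x) :
    Laplacian.laplacian (fun y => f y * g y) x =
      f x * Laplacian.laplacian g x + g x * Laplacian.laplacian f x +
      2 * ∑ i, fderiv ℝ f x (EuclideanSpace.single i 1) *
        fderiv ℝ g x (EuclideanSpace.single i 1) := by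
  rw [laplacian_eq_sum_fderiv (hf.mul hg), laplacian_eq_sum_fderiv hf, laplacian_eq_sum_fderiv hg,
    Finset.mul_sum, Finset.mul_sum, Finset.mul_sum, ← Finset.sum_add_distrib,
    ← Finset.sum_add_distrib]
  refine Finset.sum_congr rfl fun i _ => ?_
  set v : EuclideanSpace ℝ (Fin N) := EuclideanSpace.single i 1
  have e1 : (fun y => fderiv ℝ (fun y => f y * g y) y v) =ᶠ[𝓝 x]
      fun y => f y * fderiv ℝ g y v + g y * fderiv ℝ f y v := by
    filter_upwards [hf.eventually (by simp), hg.eventually (by simp)] with y h1 h2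
    rw [fderiv_fun_mul (h1.differentiableAt (by norm_num)) (h2.differentiableAt (by norm_num))]
    simp
  rw [e1.fderiv_eq]
  have d1 := hf.differentiableAt (by norm_num)
  have d2 := hg.differentiableAt (by norm_num)
  have d3 := differentiableAt_fderiv_apply_of_contDiffAt hf v
  have d4 := differentiableAt_fderiv_apply_of_contDiffAt hg v
  rw [fderiv_fun_add (d1.fun_mul d4) (d2.fun_mul d3), fderiv_fun_mul d1 d4, fderiv_fun_mul d2 d3]
  simp
  ring

/-- Used for the conformally weighted zonal functions and, with W = 1, for the logarithmic cutoff.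
-/
theorem hasDerivAt_mul_comp {W W₁ X X₁ : ℝ → ℝ} {W₂ X₂ : ℝ} {p p₁ : ℝ → ℂ} {p₂ : ℂ}
    (hW : ∀ᶠ t in 𝓝 (0 : ℝ), HasDerivAt W (W₁ t) t) (hW₁ : HasDerivAt W₁ W₂ 0)
    (hX : ∀ᶠ t in 𝓝 (0 : ℝ), HasDerivAt X (X₁ t) t) (hX₁ : HasDerivAt X₁ X₂ 0)
    (hp : ∀ᶠ s in 𝓝 (X 0), HasDerivAt p (p₁ s) s) (hp₁ : HasDerivAt p₁ p₂ (X 0)) :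
    (∀ᶠ t in 𝓝 (0 : ℝ), HasDerivAt (fun t => (W t : ℂ) * p (X t))
      (W₁ t * p (X t) + W t * (X₁ t * p₁ (X t))) t) ∧
    HasDerivAt (fun t => (W₁ t * p (X t) + W t * (X₁ t * p₁ (X t)) : ℂ))
      (W₂ * p (X 0) + 2 * W₁ 0 * X₁ 0 * p₁ (X 0) +
        W 0 * (X₂ * p₁ (X 0) + X₁ 0 ^ 2 * p₂)) 0 := by
  have hX0 := hX.self_of_nhds
  have hcomp : ∀ᶠ t in 𝓝 (0 : ℝ), HasDerivAt (fun t => p (X t)) (X₁ t * p₁ (X t)) t := by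
    filter_upwards [hX, hX0.continuousAt.eventually hp] with t h1 h2
    have := h2.scomp t h1
    rwa [Complex.real_smul] at this
  have hcomp₁ : HasDerivAt (fun t => p₁ (X t)) (X₁ 0 * p₂) 0 := by
    have := hp₁.scomp (0 : ℝ) hX0
    rwa [Complex.real_smul] at this
  constructor
  · filter_upwards [hcomp, hW] with t h1 h2
    exact h2.ofReal_comp.mul h1
  · refine ((hW₁.ofReal_comp.mul hcomp.self_of_nhds).add
      (hW.self_of_nhds.ofReal_comp.mul (hX₁.ofReal_comp.mul hcomp₁))).congr_deriv ?_
    simp only [Pi.mul_apply]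
    ring

theorem norm_add_smul_single_sq (x : EuclideanSpace ℝ (Fin N)) (i : Fin N) (t : ℝ) :
    ‖x + t • EuclideanSpace.single i (1 : ℝ)‖ ^ 2 = ‖x‖ ^ 2 + 2 * t * x i + t ^ 2 := by
  rw [norm_add_sq_real, inner_smul_right, EuclideanSpace.inner_single_right, norm_smul,
    PiLp.norm_single]
  simp
  ring

/-- The conformal weight times a function of `-1 + κ |y - c|² / (|y|² + ρ²)`. -/
noncomputable def conformalZonal (ρ κ m : ℝ) (c : EuclideanSpace ℝ (Fin N)) (p : ℝ → ℂ)
    (y : EuclideanSpace ℝ (Fin N)) : ℂ :=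
  (((‖y‖ ^ 2 + ρ ^ 2) ^ m : ℝ) : ℂ) * p (-1 + κ * ‖y - c‖ ^ 2 / (‖y‖ ^ 2 + ρ ^ 2))

theorem contDiffAt_conformalZonal {ρ : ℝ} (hρ : 0 < ρ) (κ m : ℝ) (c : EuclideanSpace ℝ (Fin N))
    {p : ℝ → ℂ} {x : EuclideanSpace ℝ (Fin N)}
    (hp : ContDiffAt ℝ 2 p (-1 + κ * ‖x - c‖ ^ 2 / (‖x‖ ^ 2 + ρ ^ 2))) :
    ContDiffAt ℝ 2 (conformalZonal ρ κ m c p) x := by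
  have hA : ‖x‖ ^ 2 + ρ ^ 2 ≠ 0 := by positivity
  have h1 : ContDiffAt ℝ 2 (fun y : EuclideanSpace ℝ (Fin N) => ‖y‖ ^ 2 + ρ ^ 2) x :=
    (contDiff_norm_sq ℝ).contDiffAt.add contDiffAt_const
  have h2 : ContDiffAt ℝ 2 (fun y : EuclideanSpace ℝ (Fin N) => ‖y - c‖ ^ 2) x :=
    ((contDiff_id.sub contDiff_const).norm_sq ℝ).contDiffAt
  have h3 : ContDiffAt ℝ 2 (fun y : EuclideanSpace ℝ (Fin N) =>
      -1 + κ * ‖y - c‖ ^ 2 / (‖y‖ ^ 2 + ρ ^ 2)) x :=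
    contDiffAt_const.add ((contDiffAt_const.mul h2).div h1 hA)
  exact (Complex.ofRealCLM.contDiff.contDiffAt.comp x (h1.rpow_const_of_ne hA)).mul
    (hp.comp x h3)

/-- First and second derivatives of `conformalZonal` along a coordinate direction. -/
theorem fderiv_conformalZonal {ρ : ℝ} (hρ : 0 < ρ) (κ m : ℝ) (c : EuclideanSpace ℝ (Fin N))
    {p p₁ : ℝ → ℂ} {p₂ : ℂ} {x : EuclideanSpace ℝ (Fin N)} {A B ξ : ℝ}
    (hA : A = ‖x‖ ^ 2 + ρ ^ 2) (hB : B = ‖x - c‖ ^ 2) (hξ : ξ = -1 + κ * B / A)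
    (hpc : ContDiffAt ℝ 2 p ξ)
    (hp : ∀ᶠ s in 𝓝 ξ, HasDerivAt p (p₁ s) s) (hp₁ : HasDerivAt p₁ p₂ ξ) (i : Fin N) :
    fderiv ℝ (conformalZonal ρ κ m c p) x (EuclideanSpace.single i 1) =
      ((m * A ^ (m - 1) * (2 * x i) : ℝ) : ℂ) * p ξ +
        ((A ^ m : ℝ) : ℂ) *
          (((κ * (2 * (x - c) i * A - 2 * x i * B) / A ^ 2 : ℝ) : ℂ) * p₁ ξ) ∧
    fderiv ℝ (fun y => fderiv ℝ (conformalZonal ρ κ m c p) y (EuclideanSpace.single i 1)) x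
        (EuclideanSpace.single i 1) =
      ((m * (m - 1) * A ^ (m - 2) * (2 * x i) ^ 2 + 2 * m * A ^ (m - 1) : ℝ) : ℂ) * p ξ +
      2 * ((m * A ^ (m - 1) * (2 * x i) : ℝ) : ℂ) *
        ((κ * (2 * (x - c) i * A - 2 * x i * B) / A ^ 2 : ℝ) : ℂ) * p₁ ξ +
      ((A ^ m : ℝ) : ℂ) *
        (((κ * ((2 * A - 2 * B) / A ^ 2 -
            2 * (2 * x i) * (2 * (x - c) i * A - 2 * x i * B) / A ^ 3) : ℝ) : ℂ) * p₁ ξ +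
          ((κ * (2 * (x - c) i * A - 2 * x i * B) / A ^ 2 : ℝ) : ℂ) ^ 2 * p₂) := by
  have hApos : 0 < A := by rw [hA]; positivity
  set u := x i
  set v := (x - c) i
  -- Along a coordinate line both |y|² + ρ² and |y - c|² are quadratic polynomials in the parameter.
  let α : ℝ → ℝ := fun t => A + 2 * t * u + t ^ 2
  let β : ℝ → ℝ := fun t => B + 2 * t * v + t ^ 2
  have hα : ∀ t, HasDerivAt α (2 * u + 2 * t) t := fun t => by
    have := (((hasDerivAt_id t).const_mul 2).mul_const u).const_add A |>.add (hasDerivAt_pow 2 t)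
    refine this.congr_deriv ?_
    simp
  have hβ : ∀ t, HasDerivAt β (2 * v + 2 * t) t := fun t => by
    have := (((hasDerivAt_id t).const_mul 2).mul_const v).const_add B |>.add (hasDerivAt_pow 2 t)
    refine this.congr_deriv ?_
    simp
  have hα0 : α 0 = A := by simp [α]
  have hβ0 : β 0 = B := by simp [β]
  have hlin : ∀ w : ℝ, HasDerivAt (fun t : ℝ => 2 * w + 2 * t) 2 0 := fun w => by
    simpa using ((hasDerivAt_id (0 : ℝ)).const_mul 2).const_add (2 * w)
  have hαpos : ∀ᶠ t in 𝓝 (0 : ℝ), 0 < α t := by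
    refine (hα 0).continuousAt.eventually ?_
    rw [hα0]
    exact lt_mem_nhds hApos
  let W : ℝ → ℝ := fun t => α t ^ m
  let W₁ : ℝ → ℝ := fun t => m * α t ^ (m - 1) * (2 * u + 2 * t)
  let X : ℝ → ℝ := fun t => -1 + κ * β t / α t
  let X₁ : ℝ → ℝ := fun t => κ * ((2 * v + 2 * t) * α t - (2 * u + 2 * t) * β t) / α t ^ 2
  have hW : ∀ᶠ t in 𝓝 (0 : ℝ), HasDerivAt W (W₁ t) t := by
    filter_upwards [hαpos] with t ht
    refine ((hα t).rpow_const (Or.inl ht.ne')).congr_deriv ?_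
    simp only [W₁]; ring
  have hW₁ : HasDerivAt W₁ (m * (m - 1) * A ^ (m - 2) * (2 * u) ^ 2 + 2 * m * A ^ (m - 1)) 0 := by
    have := (((hα 0).rpow_const (p := m - 1) (Or.inl (hα0.symm ▸ hApos.ne'))).const_mul m).mul
      (hlin u)
    refine this.congr_deriv ?_
    rw [hα0, show m - 1 - 1 = m - 2 by ring]
    ring
  have hX : ∀ᶠ t in 𝓝 (0 : ℝ), HasDerivAt X (X₁ t) t := by
    filter_upwards [hαpos] with t ht
    refine ((((hβ t).const_mul κ).div (hα t) ht.ne').const_add (-1)).congr_deriv ?_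
    simp only [X₁]; ring
  have hX₁ : HasDerivAt X₁ (κ * ((2 * A - 2 * B) / A ^ 2 -
      2 * (2 * u) * (2 * v * A - 2 * u * B) / A ^ 3)) 0 := by
    have := ((((hlin v).mul (hα 0)).sub ((hlin u).mul (hβ 0))).const_mul κ).div
      ((hα 0).pow 2) (by rw [Pi.pow_apply, hα0]; positivity)
    refine this.congr_deriv ?_
    simp only [Pi.pow_apply, Pi.mul_apply, Pi.sub_apply]
    rw [hα0, hβ0]
    field_simp
    ring
  have hX0 : X 0 = ξ := by simp only [X]; rw [hα0, hβ0, hξ]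
  have key := hasDerivAt_mul_comp hW hW₁ hX hX₁ (hX0.symm ▸ hp) (hX0.symm ▸ hp₁)
  have hfun : (fun s : ℝ => conformalZonal ρ κ m c p (x + s • EuclideanSpace.single i (1 : ℝ))) =
      fun t => (W t : ℂ) * p (X t) := by
    funext t
    have e : x + t • EuclideanSpace.single i (1 : ℝ) - c =
      (x - c) + t • EuclideanSpace.single i (1 : ℝ) := by abel
    have e1 : ‖x‖ ^ 2 + 2 * t * x i + t ^ 2 + ρ ^ 2 = α t := by
      simp only [α, u]; rw [hA]; ring
    have e2 : ‖x - c‖ ^ 2 + 2 * t * (x - c) i + t ^ 2 = β t := by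
      simp only [β, v]; rw [hB]
    unfold conformalZonal
    rw [e, norm_add_smul_single_sq, norm_add_smul_single_sq, e1, e2]
  have hcd : ContDiffAt ℝ 2 (conformalZonal ρ κ m c p) x :=
    contDiffAt_conformalZonal hρ κ m c (by rwa [← hA, ← hB, ← hξ])
  obtain ⟨k1, k2⟩ := fderiv_apply_eq_of_hasDerivAt_line hcd
    (by rw [hfun]; exact key.1) key.2
  rw [k1, k2, hX0]
  have hW0 : W 0 = A ^ m := by simp only [W]; rw [hα0]
  have hW10 : W₁ 0 = m * A ^ (m - 1) * (2 * u) := by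
    simp only [W₁]; rw [hα0, mul_zero, add_zero]
  have hX10 : X₁ 0 = κ * (2 * v * A - 2 * u * B) / A ^ 2 := by
    simp only [X₁]; rw [hα0, hβ0, mul_zero, add_zero, add_zero]
  rw [hW0, hW10, hX10]
  exact ⟨rfl, rfl⟩

/-- Conformal covariance under stereographic projection. The exponent 1 - N/2 and this value of κ
make everything outside w·4ρ²/A² depend on x through ξ alone: the bracket is the zonal Laplacian of
the N-sphere minus the curvature term N(N-2)/4. The sum over coordinates involves only |x|², |x-c|²
and x·(x-c). -/
theorem laplacian_conformalZonal {ρ : ℝ} (hρ : 0 < ρ) (c : EuclideanSpace ℝ (Fin N))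
    {p p₁ : ℝ → ℂ} {p₂ : ℂ} {x : EuclideanSpace ℝ (Fin N)} {κ A ξ : ℝ}
    (hκ : κ = 2 * ρ ^ 2 / (‖c‖ ^ 2 + ρ ^ 2))
    (hA : A = ‖x‖ ^ 2 + ρ ^ 2) (hξ : ξ = -1 + κ * ‖x - c‖ ^ 2 / A)
    (hpc : ContDiffAt ℝ 2 p ξ)
    (hp : ∀ᶠ s in 𝓝 ξ, HasDerivAt p (p₁ s) s) (hp₁ : HasDerivAt p₁ p₂ ξ) :
    Laplacian.laplacian (conformalZonal ρ κ (1 - (N : ℝ) / 2) c p) x =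
      ((A ^ (1 - (N : ℝ) / 2) : ℝ) : ℂ) * (4 * ρ ^ 2 / A ^ 2) *
        ((1 - (ξ : ℂ) ^ 2) * p₂ - N * ξ * p₁ ξ - N * (N - 2) / 4 * p ξ) := by
  set m : ℝ := 1 - (N : ℝ) / 2 with hm
  have hApos : 0 < A := by rw [hA]; positivity
  set B : ℝ := ‖x - c‖ ^ 2 with hB
  rw [laplacian_eq_sum_fderiv (contDiffAt_conformalZonal hρ κ m c (by rwa [← hA, ← hB, ← hξ]))]
  rw [Finset.sum_congr rfl fun i _ =>
    (fderiv_conformalZonal hρ κ m c hA hB hξ hpc hp hp₁ i).2]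
  have s1 : ∑ i, x i ^ 2 = A - ρ ^ 2 := by
    rw [hA, EuclideanSpace.real_norm_sq_eq]; ring
  have s2 : ∑ i, (x - c) i ^ 2 = B := by rw [hB, EuclideanSpace.real_norm_sq_eq]
  -- Polarization: 2 x·(x-c) = |x|² + |x-c|² - |c|².
  have s3 : ∑ i, x i * (x - c) i = (A - ρ ^ 2 + B - ‖c‖ ^ 2) / 2 := by
    have e1 : ∑ i, c i ^ 2 = ‖c‖ ^ 2 := by rw [EuclideanSpace.real_norm_sq_eq]
    rw [← s1, ← s2, ← e1, ← Finset.sum_add_distrib, ← Finset.sum_sub_distrib, Finset.sum_div]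
    refine Finset.sum_congr rfl fun i _ => ?_
    simp only [PiLp.sub_apply]
    ring
  have r1 : A ^ (m - 1) = A ^ m / A := by rw [Real.rpow_sub_one hApos.ne']
  have r2 : A ^ (m - 2) = A ^ m / A ^ 2 := by
    rw [show m - 2 = m - (2 : ℕ) by norm_num, Real.rpow_sub_natCast hApos.ne']
  have hAc : (A : ℂ) ≠ 0 := by exact_mod_cast hApos.ne'
  rw [r1, r2]
  set w : ℝ := A ^ m
  have split : ∀ i : Fin N,
      ((m * (m - 1) * (w / A ^ 2) * (2 * x i) ^ 2 + 2 * m * (w / A) : ℝ) : ℂ) * p ξ +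
      2 * ((m * (w / A) * (2 * x i) : ℝ) : ℂ) *
        ((κ * (2 * (x - c) i * A - 2 * x i * B) / A ^ 2 : ℝ) : ℂ) * p₁ ξ +
      (w : ℂ) *
        (((κ * ((2 * A - 2 * B) / A ^ 2 -
            2 * (2 * x i) * (2 * (x - c) i * A - 2 * x i * B) / A ^ 3) : ℝ) : ℂ) * p₁ ξ +
          ((κ * (2 * (x - c) i * A - 2 * x i * B) / A ^ 2 : ℝ) : ℂ) ^ 2 * p₂) =
      (2 * m * w / A * p ξ + w * p₁ ξ * κ * (2 * A - 2 * B) / A ^ 2 : ℂ) +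
      (4 * m * (m - 1) * w / A ^ 2 * p ξ - 8 * m * κ * w * B / A ^ 3 * p₁ ξ +
        4 * w * κ ^ 2 * B ^ 2 / A ^ 4 * p₂ + 8 * w * κ * B / A ^ 3 * p₁ ξ : ℂ) *
        ((x i ^ 2 : ℝ) : ℂ) +
      (8 * m * κ * w / A ^ 2 * p₁ ξ - 8 * κ ^ 2 * B * w / A ^ 3 * p₂ -
        8 * w * κ / A ^ 2 * p₁ ξ : ℂ) * ((x i * (x - c) i : ℝ) : ℂ) +
      (4 * w * κ ^ 2 / A ^ 2 * p₂ : ℂ) * (((x - c) i ^ 2 : ℝ) : ℂ) := by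
    intro i
    push_cast
    field_simp
    ring
  rw [Finset.sum_congr rfl fun i _ => split i, Finset.sum_add_distrib, Finset.sum_add_distrib,
    Finset.sum_add_distrib, ← Finset.mul_sum, ← Finset.mul_sum, ← Finset.mul_sum,
    ← Complex.ofReal_sum, ← Complex.ofReal_sum, ← Complex.ofReal_sum, s1, s2, s3,
    Finset.sum_const, Finset.card_univ, Fintype.card_fin, nsmul_eq_mul]
  have hC : (‖c‖ ^ 2 + ρ ^ 2 : ℂ) ≠ 0 := by
    have : (0 : ℝ) < ‖c‖ ^ 2 + ρ ^ 2 := by positivity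
    exact_mod_cast this.ne'
  generalize p ξ = P0
  generalize p₁ ξ = P1
  rw [hξ, hm, hκ]
  push_cast
  field_simp
  ring

end Laplacian

/-! ### Green's second identity. -/

section IntegrationByParts

open MeasureTheory

variable {N : ℕ}

theorem integrable_mul_of_tsupport_subset {E : Type*} [NormedAddCommGroup E]
    [NormedSpace ℝ E] [FiniteDimensional ℝ E] [MeasureSpace E] [BorelSpace E]
    [IsFiniteMeasureOnCompacts (volume : Measure E)] {U : Set E} (hU : IsOpen U)
    {f k : E → ℂ} (hf : ContinuousOn f U) (hk : Continuous k) (hc : HasCompactSupport k)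
    (hs : tsupport k ⊆ U) : Integrable fun y => f y * k y := by
  have hcont : Continuous fun y => f y * k y :=
    (hf.mul hk.continuousOn).continuous_of_tsupport_subset hU
      ((tsupport_mul_subset_right (f := f) (g := k)).trans hs)
  exact hcont.integrable_of_hasCompactSupport (hc.mul_left (f := f))

/-- Green's second identity for a compactly supported function. -/
theorem integral_mul_laplacian_eq {U : Set (EuclideanSpace ℝ (Fin N))} (hU : IsOpen U)
    {h φ : EuclideanSpace ℝ (Fin N) → ℂ} (hh : ContDiffOn ℝ 2 h U) (hφ : ContDiff ℝ 2 φ)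
    (hc : HasCompactSupport φ) (hs : tsupport φ ⊆ U) :
    ∫ y, h y * Laplacian.laplacian φ y = ∫ y, Laplacian.laplacian h y * φ y := by
  let e : Fin N → EuclideanSpace ℝ (Fin N) := fun i => EuclideanSpace.single i 1
  let φ₁ : Fin N → EuclideanSpace ℝ (Fin N) → ℂ := fun i y => fderiv ℝ φ y (e i)
  let φ₂ : Fin N → EuclideanSpace ℝ (Fin N) → ℂ := fun i y => fderiv ℝ (φ₁ i) y (e i)
  let h₁ : Fin N → EuclideanSpace ℝ (Fin N) → ℂ := fun i y => fderiv ℝ h y (e i)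
  let h₂ : Fin N → EuclideanSpace ℝ (Fin N) → ℂ := fun i y => fderiv ℝ (h₁ i) y (e i)
  have cφ₁ : ∀ i, ContDiff ℝ 1 (φ₁ i) := fun i =>
    (hφ.fderiv_right (m := 1) (by norm_num)).clm_apply contDiff_const
  have cφ₂ : ∀ i, Continuous (φ₂ i) := fun i =>
    (((cφ₁ i).continuous_fderiv (by norm_num)).clm_apply continuous_const)
  have ch₁ : ∀ i, ContDiffOn ℝ 1 (h₁ i) U := fun i =>
    (hh.fderiv_of_isOpen hU (m := 1) (by norm_num)).clm_apply contDiffOn_const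
  have ch₂ : ∀ i, ContinuousOn (h₂ i) U := fun i =>
    ((ch₁ i).continuousOn_fderiv_of_isOpen hU (by norm_num)).clm_apply continuousOn_const
  have sφ₁ : ∀ i, tsupport (φ₁ i) ⊆ tsupport φ := fun i => tsupport_fderiv_apply_subset ℝ (e i)
  have sφ₂ : ∀ i, tsupport (φ₂ i) ⊆ tsupport φ := fun i =>
    (tsupport_fderiv_apply_subset ℝ (e i)).trans (sφ₁ i)
  have kφ₁ : ∀ i, HasCompactSupport (φ₁ i) := fun i => hc.fderiv_apply ℝ (e i)
  have kφ₂ : ∀ i, HasCompactSupport (φ₂ i) := fun i => (kφ₁ i).fderiv_apply ℝ (e i)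
  have i1 : ∀ i, Integrable fun y => h y * φ₂ i y := fun i =>
    integrable_mul_of_tsupport_subset hU hh.continuousOn (cφ₂ i) (kφ₂ i) ((sφ₂ i).trans hs)
  have i2 : ∀ i, Integrable fun y => h₁ i y * φ₁ i y := fun i =>
    integrable_mul_of_tsupport_subset hU (ch₁ i).continuousOn (cφ₁ i).continuous (kφ₁ i)
      ((sφ₁ i).trans hs)
  have i3 : ∀ i, Integrable fun y => h₂ i y * φ y := fun i =>
    integrable_mul_of_tsupport_subset hU (ch₂ i) hφ.continuous hc hs
  have i4 : ∀ i, Integrable fun y => h y * φ₁ i y := fun i =>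
    integrable_mul_of_tsupport_subset hU hh.continuousOn (cφ₁ i).continuous (kφ₁ i)
      ((sφ₁ i).trans hs)
  have i5 : ∀ i, Integrable fun y => h₁ i y * φ y := fun i =>
    integrable_mul_of_tsupport_subset hU (ch₁ i).continuousOn hφ.continuous hc hs
  have step : ∀ i, ∫ y, h y * φ₂ i y = ∫ y, h₂ i y * φ y := by
    intro i
    have a1 : ∫ y, h y * φ₂ i y = -∫ y, h₁ i y * φ₁ i y :=
      integral_mul_fderiv_eq_neg_fderiv_mul_of_integrable (i2 i) (i1 i) (i4 i)
        (fun x hx => (hh.contDiffAt (hU.mem_nhds (hs (sφ₁ i hx)))).differentiableAt (by norm_num))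
        (fun x _ => (cφ₁ i).differentiable (by norm_num) x)
    have a2 : ∫ y, h₁ i y * φ₁ i y = -∫ y, h₂ i y * φ y :=
      integral_mul_fderiv_eq_neg_fderiv_mul_of_integrable (i3 i) (i2 i) (i5 i)
        (fun x hx => ((ch₁ i).contDiffAt (hU.mem_nhds (hs hx))).differentiableAt (by norm_num))
        (fun x _ => hφ.differentiable (by norm_num) x)
    rw [a1, a2, neg_neg]
  have b1 : ∀ y, h y * Laplacian.laplacian φ y = ∑ i, h y * φ₂ i y := fun y => by
    rw [laplacian_eq_sum_fderiv hφ.contDiffAt, Finset.mul_sum]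
  have b2 : ∀ y, Laplacian.laplacian h y * φ y = ∑ i, h₂ i y * φ y := fun y => by
    by_cases hy : y ∈ tsupport φ
    · rw [laplacian_eq_sum_fderiv (hh.contDiffAt (hU.mem_nhds (hs hy))), Finset.sum_mul]
    · simp [image_eq_zero_of_notMem_tsupport hy]
  simp only [b1, b2]
  rw [integral_finsetSum _ fun i _ => i1 i, integral_finsetSum _ fun i _ => i3 i]
  exact Finset.sum_congr rfl fun i _ => step i

end IntegrationByParts

/-! ### The logarithmic cutoff. -/

section LogCutoff

variable {N : ℕ}

/-- A smooth bump on the line which is `1` on `[-1, 1]` and vanishes outside `(-2, 2)`. -/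
noncomputable def lineBump : ContDiffBump (0 : ℝ) := ⟨1, 2, one_pos, one_lt_two⟩

/-- A smooth function of `log ‖z‖ / L`, equal to `1` on `e^(-L) ≤ ‖z‖ ≤ e^L` and vanishing unless
`e^(-2L) < ‖z‖ < e^(2L)`. -/
noncomputable def logCutoff (L : ℝ) (z : EuclideanSpace ℝ (Fin N)) : ℂ :=
  if z = 0 then 0 else ((lineBump (Real.log ‖z‖ / L) : ℝ) : ℂ)

theorem norm_logCutoff_le_one (L : ℝ) (z : EuclideanSpace ℝ (Fin N)) : ‖logCutoff L z‖ ≤ 1 := by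
  unfold logCutoff
  split_ifs
  · simp
  · rw [Complex.norm_real, Real.norm_of_nonneg lineBump.nonneg]
    exact lineBump.le_one

theorem logCutoff_eq_one {L : ℝ} (hL : 0 < L) {z : EuclideanSpace ℝ (Fin N)} (hz : z ≠ 0)
    (h : |Real.log ‖z‖| ≤ L) : logCutoff L z = 1 := by
  rw [logCutoff, if_neg hz, lineBump.one_of_mem_closedBall, Complex.ofReal_one]
  rw [mem_closedBall_zero_iff, Real.norm_eq_abs, abs_div, abs_of_pos hL]
  exact (div_le_one hL).2 h

theorem logCutoff_eq_zero {L : ℝ} (hL : 0 < L) {z : EuclideanSpace ℝ (Fin N)}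
    (h : 2 * L ≤ |Real.log ‖z‖|) : logCutoff L z = 0 := by
  rw [logCutoff]
  split_ifs
  · rfl
  rw [lineBump.zero_of_le_dist, Complex.ofReal_zero]
  rw [dist_zero_right, Real.norm_eq_abs, abs_div, abs_of_pos hL]
  exact (le_div_iff₀ hL).2 h

theorem logCutoff_eventuallyEq_zero {L : ℝ} (hL : 0 < L) :
    logCutoff (N := N) L =ᶠ[𝓝 0] fun _ => 0 := by
  have h1 : ∀ᶠ z : EuclideanSpace ℝ (Fin N) in 𝓝 0, ‖z‖ < Real.exp (-(2 * L)) := by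
    filter_upwards [Metric.ball_mem_nhds (0 : EuclideanSpace ℝ (Fin N))
      (Real.exp_pos (-(2 * L)))] with z hz
    simpa using hz
  filter_upwards [h1] with z hz
  by_cases h0 : z = 0
  · simp [logCutoff, h0]
  · have hpos : 0 < ‖z‖ := norm_pos_iff.2 h0
    refine logCutoff_eq_zero hL ?_
    have := (Real.log_lt_iff_lt_exp hpos).2 hz
    rw [abs_of_neg (by linarith)]
    linarith

theorem contDiff_logCutoff {L : ℝ} (hL : 0 < L) : ContDiff ℝ 2 (logCutoff (N := N) L) := by
  rw [contDiff_iff_contDiffAt]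
  intro z
  by_cases h0 : z = 0
  · subst h0
    exact contDiffAt_const.congr_of_eventuallyEq (logCutoff_eventuallyEq_zero hL)
  · have h1 : ContDiffAt ℝ 2 (fun z : EuclideanSpace ℝ (Fin N) =>
        ((lineBump (Real.log ‖z‖ / L) : ℝ) : ℂ)) z := by
      refine Complex.ofRealCLM.contDiff.contDiffAt.comp z ?_
      exact lineBump.contDiff.contDiffAt.comp z
        (((contDiffAt_norm ℝ h0).log (norm_ne_zero_iff.2 h0)).div_const L)
    refine h1.congr_of_eventuallyEq ?_
    filter_upwards [isOpen_ne.mem_nhds h0] with y hy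
    exact if_neg hy

theorem support_logCutoff_subset {L : ℝ} (hL : 0 < L) :
    Function.support (logCutoff (N := N) L) ⊆
      {z | Real.exp (-(2 * L)) ≤ ‖z‖ ∧ ‖z‖ ≤ Real.exp (2 * L)} := by
  intro z hz
  have hz0 : z ≠ 0 := fun h => hz (by simp [logCutoff, h])
  have hpos : 0 < ‖z‖ := norm_pos_iff.2 hz0
  have h1 : |Real.log ‖z‖| < 2 * L := by
    by_contra h
    exact hz (logCutoff_eq_zero hL (not_lt.1 h))
  rw [abs_lt] at h1
  exact ⟨((Real.lt_log_iff_exp_lt hpos).1 h1.1).le, ((Real.log_lt_iff_lt_exp hpos).1 h1.2).le⟩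

/-- The bump is locally constant on |t| < 1 and on |t| > 2, so every derivative of the cutoff lives
on the two shells L ≤ |log s| ≤ 2L. -/
theorem exists_lineBump_deriv : ∃ p₁ p₂ : ℝ → ℂ, ∃ K : ℝ, 0 ≤ K ∧
    (∀ t, HasDerivAt (fun t => ((lineBump t : ℝ) : ℂ)) (p₁ t) t) ∧
    (∀ t, HasDerivAt p₁ (p₂ t) t) ∧ (∀ t, ‖p₁ t‖ ≤ K) ∧ (∀ t, ‖p₂ t‖ ≤ K) ∧
    (∀ t, |t| < 1 ∨ 2 < |t| → p₁ t = 0 ∧ p₂ t = 0) := by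
  have h0 : ContDiff ℝ 2 fun t => lineBump t := lineBump.contDiff
  have h1 : ContDiff ℝ 1 (deriv fun t => lineBump t) := h0.iterate_deriv' 1 1
  have h2 : Continuous (deriv (deriv fun t => lineBump t)) := h1.continuous_deriv (by norm_num)
  have c0 : HasCompactSupport fun t => lineBump t := lineBump.hasCompactSupport
  have c1 := c0.deriv
  have c2 := c1.deriv
  obtain ⟨K1, hK1⟩ := c1.exists_bound_of_continuous h1.continuous
  obtain ⟨K2, hK2⟩ := c2.exists_bound_of_continuous h2
  refine ⟨fun t => ((deriv (fun t => lineBump t) t : ℝ) : ℂ),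
    fun t => ((deriv (deriv fun t => lineBump t) t : ℝ) : ℂ), max K1 K2,
    (norm_nonneg _).trans ((hK1 0).trans (le_max_left _ _)), fun t => ?_, fun t => ?_,
    fun t => ?_, fun t => ?_, fun t ht => ?_⟩
  · exact (h0.differentiable (by norm_num) t).hasDerivAt.ofReal_comp
  · exact (h1.differentiable (by norm_num) t).hasDerivAt.ofReal_comp
  · rw [Complex.norm_real]; exact (hK1 t).trans (le_max_left _ _)
  · rw [Complex.norm_real]; exact (hK2 t).trans (le_max_right _ _)
  · have hconst : ∃ k : ℝ, (fun t => lineBump t) =ᶠ[𝓝 t] fun _ => k := by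
      rcases ht with ht | ht
      · refine ⟨1, ?_⟩
        filter_upwards [(isOpen_lt continuous_abs continuous_const).mem_nhds ht] with s hs
        exact lineBump.one_of_mem_closedBall (by
          rw [mem_closedBall_zero_iff]; exact le_of_lt hs)
      · refine ⟨0, ?_⟩
        filter_upwards [(isOpen_lt continuous_const continuous_abs).mem_nhds ht] with s hs
        exact lineBump.zero_of_le_dist (by rw [dist_zero_right]; exact le_of_lt hs)
    obtain ⟨k, hk⟩ := hconst
    have e1 := hk.deriv
    have e2 := e1.deriv
    constructor
    · beta_reduce; rw [e1.self_of_nhds]; simp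
    · beta_reduce; rw [e2.self_of_nhds]; simp

/-- Bounds for the derivatives of the logarithmic cutoff. -/
theorem exists_bound_logCutoff (N : ℕ) : ∃ K : ℝ, 0 ≤ K ∧ ∀ L : ℝ, 0 < L →
    ∀ z : EuclideanSpace ℝ (Fin N), z ≠ 0 →
    (∀ i, ‖fderiv ℝ (logCutoff L) z (EuclideanSpace.single i 1)‖ ≤ K / (L * ‖z‖)) ∧
    ‖Laplacian.laplacian (logCutoff L) z‖ ≤ K / (L * ‖z‖ ^ 2) * (1 / L + |(N : ℝ) - 2|) ∧
    (|Real.log ‖z‖| < L ∨ 2 * L < |Real.log ‖z‖| →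
      (∀ i, fderiv ℝ (logCutoff L) z (EuclideanSpace.single i 1) = 0) ∧
      Laplacian.laplacian (logCutoff L) z = 0) := by
  obtain ⟨p₁, p₂, K, hK0, hp, hp₁, hK₁, hK₂, hz0⟩ := exists_lineBump_deriv
  refine ⟨K, hK0, fun L hL z hz => ?_⟩
  have hs : 0 < ‖z‖ := norm_pos_iff.2 hz
  set s := ‖z‖
  set ξ := Real.log s / L with hξ
  have main : ∀ i, fderiv ℝ (logCutoff L) z (EuclideanSpace.single i 1) =
        ((z i / (L * s ^ 2) : ℝ) : ℂ) * p₁ ξ ∧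
      fderiv ℝ (fun y => fderiv ℝ (logCutoff L) y (EuclideanSpace.single i 1)) z
        (EuclideanSpace.single i 1) =
        (((s ^ 2 - 2 * z i ^ 2) / (L * s ^ 4) : ℝ) : ℂ) * p₁ ξ +
          ((z i / (L * s ^ 2) : ℝ) : ℂ) ^ 2 * p₂ ξ := by
    intro i
    let q : ℝ → ℝ := fun t => s ^ 2 + 2 * t * z i + t ^ 2
    have hq : ∀ t, HasDerivAt q (2 * z i + 2 * t) t := fun t => by
      have := (((hasDerivAt_id t).const_mul 2).mul_const (z i)).const_add (s ^ 2) |>.add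
        (hasDerivAt_pow 2 t)
      refine this.congr_deriv ?_
      simp
    have hq0 : q 0 = s ^ 2 := by simp [q]
    have hlin : HasDerivAt (fun t : ℝ => 2 * z i + 2 * t) 2 0 := by
      simpa using ((hasDerivAt_id (0 : ℝ)).const_mul 2).const_add (2 * z i)
    have hqpos : ∀ᶠ t in 𝓝 (0 : ℝ), 0 < q t := by
      refine (hq 0).continuousAt.eventually ?_
      rw [hq0]
      exact lt_mem_nhds (by positivity)
    -- The logarithm of the squared norm, divided by 2L, equals log of the norm over L and keeps the
    -- square root out of the calculus.
    let X : ℝ → ℝ := fun t => Real.log (q t) / (2 * L)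
    let X₁ : ℝ → ℝ := fun t => (2 * z i + 2 * t) / q t / (2 * L)
    have hX : ∀ᶠ t in 𝓝 (0 : ℝ), HasDerivAt X (X₁ t) t := by
      filter_upwards [hqpos] with t ht
      exact ((hq t).log ht.ne').div_const _
    have hX₁ : HasDerivAt X₁ ((s ^ 2 - 2 * z i ^ 2) / (L * s ^ 4)) 0 := by
      refine ((hlin.div (hq 0) (by rw [hq0]; positivity)).div_const (2 * L)).congr_deriv ?_
      rw [hq0]
      field_simp
      ring
    have hX0 : X 0 = ξ := by
      simp only [X]
      rw [hq0, hξ, Real.log_pow]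
      push_cast
      field_simp
    have hX10 : X₁ 0 = z i / (L * s ^ 2) := by
      simp only [X₁]
      rw [hq0]
      field_simp
      ring
    have key := hasDerivAt_mul_comp (W := fun _ => 1) (W₁ := fun _ => 0) (W₂ := 0)
      (Eventually.of_forall fun t => hasDerivAt_const t 1) (hasDerivAt_const 0 0) hX hX₁
      (Eventually.of_forall fun t => hp t) (hp₁ (X 0))
    have hfun : ∀ᶠ t in 𝓝 (0 : ℝ),
        logCutoff L (z + t • EuclideanSpace.single i (1 : ℝ)) =
        ((1 : ℝ) : ℂ) * ((lineBump (X t) : ℝ) : ℂ) := by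
      filter_upwards [hqpos] with t ht
      have e1 := norm_add_smul_single_sq z i t
      have e2 : z + t • EuclideanSpace.single i (1 : ℝ) ≠ 0 := by
        intro h
        rw [h, norm_zero] at e1
        have : q t = 0 := by simp only [q, s]; rw [← e1]; norm_num
        exact ht.ne' this
      rw [logCutoff, if_neg e2]
      have e3 : Real.log ‖z + t • EuclideanSpace.single i (1 : ℝ)‖ / L = X t := by
        simp only [X, q, s]
        rw [← e1, Real.log_pow]
        push_cast
        field_simp
      rw [e3]
      simp
    have k1 : ∀ᶠ t in 𝓝 (0 : ℝ),
        HasDerivAt (fun t : ℝ => logCutoff L (z + t • EuclideanSpace.single i (1 : ℝ)))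
        (((0 : ℝ) : ℂ) * ((lineBump (X t) : ℝ) : ℂ) +
          ((1 : ℝ) : ℂ) * ((X₁ t : ℂ) * p₁ (X t))) t := by
      filter_upwards [key.1, hfun.eventually_nhds] with t h1 h2
      exact h1.congr_of_eventuallyEq h2
    obtain ⟨a1, a2⟩ := fderiv_apply_eq_of_hasDerivAt_line
      (contDiff_logCutoff hL).contDiffAt k1 key.2
    rw [a1, a2, hX0, hX10]
    constructor <;> push_cast <;> ring
  have s1 : ∑ i, z i ^ 2 = s ^ 2 := by rw [EuclideanSpace.real_norm_sq_eq]
  -- The term with N - 2 appears because log s is harmonic only in dimension 2; for N ≥ 3 the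
  -- Laplacian gains just one power of 1/L.
  have lap : Laplacian.laplacian (logCutoff L) z =
      ((((N : ℝ) - 2) / (L * s ^ 2) : ℝ) : ℂ) * p₁ ξ + ((1 / (L ^ 2 * s ^ 2) : ℝ) : ℂ) * p₂ ξ := by
    rw [laplacian_eq_sum_fderiv (contDiff_logCutoff hL).contDiffAt,
      Finset.sum_congr rfl fun i _ => (main i).2, Finset.sum_add_distrib, ← Finset.sum_mul,
      ← Finset.sum_mul]
    simp only [← Complex.ofReal_pow]
    rw [← Complex.ofReal_sum, ← Complex.ofReal_sum]
    have t1 : ∑ i, (s ^ 2 - 2 * z i ^ 2) / (L * s ^ 4) = ((N : ℝ) - 2) / (L * s ^ 2) := by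
      rw [← Finset.sum_div, Finset.sum_sub_distrib, ← Finset.mul_sum, s1, Finset.sum_const,
        Finset.card_univ, Fintype.card_fin, nsmul_eq_mul]
      field_simp
    have t2 : ∑ i, (z i / (L * s ^ 2)) ^ 2 = 1 / (L ^ 2 * s ^ 2) := by
      simp only [div_pow]
      rw [← Finset.sum_div, s1]
      field_simp
    rw [t1, t2]
  refine ⟨fun i => ?_, ?_, fun h => ?_⟩
  · rw [(main i).1, norm_mul, Complex.norm_real, norm_div, Real.norm_eq_abs,
      Real.norm_of_nonneg (by positivity : 0 ≤ L * s ^ 2)]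
    have hzi : |z i| ≤ s := PiLp.norm_apply_le z i
    calc |z i| / (L * s ^ 2) * ‖p₁ ξ‖ ≤ s / (L * s ^ 2) * K := by
          gcongr
          exact hK₁ ξ
      _ = K / (L * s) := by field_simp
  · rw [lap]
    refine (norm_add_le _ _).trans ?_
    rw [norm_mul, norm_mul, Complex.norm_real, Complex.norm_real, norm_div, norm_div,
      Real.norm_of_nonneg (by positivity : 0 ≤ L * s ^ 2),
      Real.norm_of_nonneg (by positivity : 0 ≤ L ^ 2 * s ^ 2), norm_one, Real.norm_eq_abs]
    calc |(N : ℝ) - 2| / (L * s ^ 2) * ‖p₁ ξ‖ + 1 / (L ^ 2 * s ^ 2) * ‖p₂ ξ‖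
        ≤ |(N : ℝ) - 2| / (L * s ^ 2) * K + 1 / (L ^ 2 * s ^ 2) * K := by
          gcongr
          · exact hK₁ ξ
          · exact hK₂ ξ
      _ = K / (L * s ^ 2) * (1 / L + |(N : ℝ) - 2|) := by field_simp; ring
  · have hξ0 : |ξ| < 1 ∨ 2 < |ξ| := by
      rw [hξ, abs_div, abs_of_pos hL]
      rcases h with h | h
      · exact Or.inl ((div_lt_one hL).2 h)
      · exact Or.inr ((lt_div_iff₀ hL).2 h)
    obtain ⟨e1, e2⟩ := hz0 ξ hξ0
    refine ⟨fun i => ?_, ?_⟩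
    · rw [(main i).1, e1, mul_zero]
    · rw [lap, e1, e2, mul_zero, mul_zero, add_zero]

end LogCutoff

/-! ### Growth estimates and the cutoff error. -/

section Vanishing

open MeasureTheory

variable {N : ℕ}

/-- In polar coordinates s^(-N) becomes ds/s, whose integral over the annulus is 4L. Dividing by L
makes the total independent of L, so a bound by δ times this function is small uniformly in L. -/
theorem integrable_radial_annulus (hN : 2 ≤ N) {L : ℝ} (hL : 0 < L) :
    Integrable (fun z : EuclideanSpace ℝ (Fin N) =>
      (Set.Icc (Real.exp (-(2 * L))) (Real.exp (2 * L))).indicator (fun s => (s ^ N)⁻¹ / L) ‖z‖) ∧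
    ∫ z : EuclideanSpace ℝ (Fin N),
      (Set.Icc (Real.exp (-(2 * L))) (Real.exp (2 * L))).indicator (fun s => (s ^ N)⁻¹ / L) ‖z‖
      = N * volume.real (Metric.ball (0 : EuclideanSpace ℝ (Fin N)) 1) * 4 := by
  have : Nonempty (Fin N) := ⟨⟨0, by omega⟩⟩
  set S := Set.Icc (Real.exp (-(2 * L))) (Real.exp (2 * L)) with hS
  have hSpos : ∀ y ∈ S, 0 < y := fun y hy => (Real.exp_pos _).trans_le hy.1
  have hle : Real.exp (-(2 * L)) ≤ Real.exp (2 * L) := Real.exp_le_exp.2 (by linarith)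
  have e1 : (fun y : ℝ => y ^ (N - 1) • S.indicator (fun s => (s ^ N)⁻¹ / L) y) =
      S.indicator fun y => y⁻¹ * L⁻¹ := by
    funext y
    by_cases hy : y ∈ S
    · rw [Set.indicator_of_mem hy, Set.indicator_of_mem hy, smul_eq_mul]
      have := hSpos y hy
      obtain ⟨M, rfl⟩ : ∃ M, N = M + 1 := ⟨N - 1, by omega⟩
      rw [Nat.add_sub_cancel, pow_succ]
      field_simp
    · rw [Set.indicator_of_notMem hy, Set.indicator_of_notMem hy, smul_zero]
  have hint : IntervalIntegrable (fun y : ℝ => y⁻¹ * L⁻¹) volume (Real.exp (-(2 * L)))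
      (Real.exp (2 * L)) := by
    refine ContinuousOn.intervalIntegrable ?_
    rw [Set.uIcc_of_le hle]
    exact (continuousOn_id.inv₀ fun y hy => (hSpos y hy).ne').mul continuousOn_const
  have hSI : S ⊆ Set.Ioi 0 := fun y hy => hSpos y hy
  constructor
  · rw [integrable_fun_norm_addHaar volume (f := S.indicator fun s => (s ^ N)⁻¹ / L),
      finrank_euclideanSpace_fin, e1]
    refine Integrable.integrableOn ?_
    rw [integrable_indicator_iff measurableSet_Icc, integrableOn_Icc_iff_integrableOn_Ioc]
    exact (intervalIntegrable_iff_integrableOn_Ioc_of_le hle).1 hint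
  · rw [integral_fun_norm_addHaar volume (S.indicator fun s => (s ^ N)⁻¹ / L),
      finrank_euclideanSpace_fin, e1, setIntegral_indicator measurableSet_Icc,
      Set.inter_eq_right.2 hSI, integral_Icc_eq_integral_Ioc, ← intervalIntegral.integral_of_le hle,
      intervalIntegral.integral_mul_const, integral_inv_of_pos (Real.exp_pos _) (Real.exp_pos _),
      ← Real.exp_sub, Real.log_exp, nsmul_eq_mul, smul_eq_mul]
    field_simp
    ring

/-- A function with the growth of a difference of two fundamental solutions is integrable against
continuous functions of sufficient decay. -/
theorem integrable_mul_of_growth (hN : 2 ≤ N) {c : EuclideanSpace ℝ (Fin N)}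
    {h g : EuclideanSpace ℝ (Fin N) → ℂ} (hh : ContinuousOn h {c}ᶜ) (hg : Continuous g)
    (hin : ∀ᶠ r in 𝓝[≠] c, ‖h r‖ ≤ (‖r - c‖ ^ (N - 2))⁻¹ *
      (if N = 2 then |Real.log ‖r - c‖| else 1))
    {K₀ : ℝ} (hout : ∀ᶠ r in Bornology.cobounded (EuclideanSpace ℝ (Fin N)),
      ‖h r‖ ≤ K₀ * (‖r - c‖ ^ (N - 2))⁻¹)
    {K : ℝ} (hgK : ∀ r, ‖g r‖ ≤ K * ((1 + ‖r - c‖) ^ 3)⁻¹) :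
    Integrable fun r => h r * g r := by
  have : Nonempty (Fin N) := ⟨⟨0, by omega⟩⟩
  have hscale : ∀ s : ℝ, 0 < s → (s ^ (N - 2))⁻¹ = (s ^ (N - 1))⁻¹ * s := by
    intro s hs
    obtain ⟨M, rfl⟩ : ∃ M, N = M + 2 := ⟨N - 2, by omega⟩
    rw [show M + 2 - 2 = M by omega, show M + 2 - 1 = M + 1 by omega, pow_succ]
    field_simp
  obtain ⟨ε', hε', hin⟩ := Metric.mem_nhdsWithin_iff.1 hin
  set ε := min ε' 1
  have hε : 0 < ε := lt_min hε' one_pos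
  obtain ⟨R, -, hR⟩ := (Metric.hasBasis_cobounded_compl_closedBall c).eventually_iff.1 hout
  have hK : IsCompact (Metric.closedBall c R \ Metric.ball c ε) :=
    (isCompact_closedBall c R).diff Metric.isOpen_ball
  obtain ⟨M₁, hM₁⟩ := hK.exists_bound_of_continuousOn (hh.mono (by
    rintro r ⟨-, hr⟩ rfl
    exact hr (Metric.mem_ball_self hε)))
  -- A single majorant s^(1-N)(1+s) serves near c, on a compact shell and near infinity.
  have hb : ∀ r, r ≠ c → ‖h r‖ ≤ (1 + |K₀| + |M₁| * |R| ^ (N - 1)) *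
      ((‖r - c‖ ^ (N - 1))⁻¹ * (1 + ‖r - c‖)) := by
    intro r hr
    have hs : 0 < ‖r - c‖ := norm_pos_iff.2 (sub_ne_zero.2 hr)
    set s := ‖r - c‖ with hsdef
    have hH : 0 ≤ (s ^ (N - 1))⁻¹ * (1 + s) := by positivity
    have hR0 : 0 ≤ |M₁| * |R| ^ (N - 1) := by positivity
    by_cases h1 : s < ε
    · have h2 : ‖h r‖ ≤ (s ^ (N - 2))⁻¹ * (if N = 2 then |Real.log s| else 1) :=
        hin ⟨by rw [Metric.mem_ball, dist_eq_norm]; exact h1.trans_le (min_le_left _ _), hr⟩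
      have h3 : s * (if N = 2 then |Real.log s| else 1) ≤ 1 + s := by
        split_ifs
        · have := Real.abs_log_mul_self_lt s hs (h1.le.trans (min_le_right _ _))
          rw [abs_mul, abs_of_pos hs] at this
          linarith
        · linarith
      calc ‖h r‖ ≤ (s ^ (N - 1))⁻¹ * (s * (if N = 2 then |Real.log s| else 1)) := by
            rw [← mul_assoc, ← hscale s hs]; exact h2
        _ ≤ (s ^ (N - 1))⁻¹ * (1 + s) := by gcongr
        _ ≤ _ := le_mul_of_one_le_left hH (by linarith [abs_nonneg K₀])
    · by_cases h2 : s ≤ R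
      · have h3 : ‖h r‖ ≤ M₁ := hM₁ r ⟨by rwa [Metric.mem_closedBall, dist_eq_norm], by
          rw [Metric.mem_ball, dist_eq_norm]; exact h1⟩
        calc ‖h r‖ ≤ |M₁| := h3.trans (le_abs_self _)
          _ = |M₁| * s ^ (N - 1) * (s ^ (N - 1))⁻¹ := by field_simp
          _ ≤ |M₁| * |R| ^ (N - 1) * ((s ^ (N - 1))⁻¹ * (1 + s)) := by
              have : s ≤ |R| := h2.trans (le_abs_self _)
              have h4 : (s ^ (N - 1))⁻¹ ≤ (s ^ (N - 1))⁻¹ * (1 + s) :=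
                le_mul_of_one_le_right (by positivity) (by linarith)
              gcongr
          _ ≤ _ := by
              refine mul_le_mul_of_nonneg_right ?_ hH
              linarith [abs_nonneg K₀]
      · have h3 := hR (x := r) (by
          rw [Set.mem_compl_iff, Metric.mem_closedBall, dist_eq_norm]; exact h2)
        calc ‖h r‖ ≤ |K₀| * (s ^ (N - 2))⁻¹ :=
              h3.trans (mul_le_mul_of_nonneg_right (le_abs_self _) (by positivity))
          _ ≤ |K₀| * ((s ^ (N - 1))⁻¹ * (1 + s)) := by
              rw [hscale s hs]; gcongr; linarith
          _ ≤ _ := by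
              refine mul_le_mul_of_nonneg_right ?_ hH
              linarith
  set M := 1 + |K₀| + |M₁| * |R| ^ (N - 1)
  have hM0 : 0 ≤ M := by positivity
  have hK0 : 0 ≤ K := by
    have := (norm_nonneg _).trans (hgK c)
    simpa using this
  -- Cubic decay of g leaves s^(1-N)/(1+s²); the polar Jacobian s^(N-1) reduces this to 1/(1+s²).
  have hrad : Integrable fun z : EuclideanSpace ℝ (Fin N) =>
      (fun s : ℝ => M * K * ((s ^ (N - 1))⁻¹ * (1 + s ^ 2)⁻¹)) ‖z‖ := by
    rw [integrable_fun_norm_addHaar volume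
      (f := fun s : ℝ => M * K * ((s ^ (N - 1))⁻¹ * (1 + s ^ 2)⁻¹)), finrank_euclideanSpace_fin]
    refine ((integrable_inv_one_add_sq.const_mul (M * K)).integrableOn).congr_fun ?_
      measurableSet_Ioi
    intro y hy
    have hy : 0 < y := hy
    simp only [smul_eq_mul]
    field_simp
  have hmeas : AEStronglyMeasurable h := by
    have := hh.aestronglyMeasurable (μ := volume) (measurableSet_singleton c).compl
    rwa [restrict_compl_singleton] at this
  refine (hrad.comp_sub_right c).mono' (hmeas.mul hg.aestronglyMeasurable) ?_
  have hae : ∀ᵐ r : EuclideanSpace ℝ (Fin N), r ≠ c := by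
    simp [ae_iff, measure_singleton]
  filter_upwards [hae] with r hr
  have hs : 0 < ‖r - c‖ := norm_pos_iff.2 (sub_ne_zero.2 hr)
  rw [norm_mul]
  set s := ‖r - c‖
  calc ‖h r‖ * ‖g r‖ ≤ M * ((s ^ (N - 1))⁻¹ * (1 + s)) * (K * ((1 + s) ^ 3)⁻¹) :=
        mul_le_mul (hb r hr) (hgK r) (norm_nonneg _) (by positivity)
    _ = M * K * ((s ^ (N - 1))⁻¹ * ((1 + s) ^ 2)⁻¹) := by field_simp
    _ ≤ M * K * ((s ^ (N - 1))⁻¹ * (1 + s ^ 2)⁻¹) := by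
        gcongr
        nlinarith

theorem fderiv_comp_sub_apply (f : EuclideanSpace ℝ (Fin N) → ℂ) (c r v : EuclideanSpace ℝ (Fin N)) :
    fderiv ℝ (fun y => f (y - c)) r v = fderiv ℝ f (r - c) v := by
  rw [fderiv_comp_sub]

theorem laplacian_comp_sub {f : EuclideanSpace ℝ (Fin N) → ℂ} (hf : ContDiff ℝ 2 f)
    (c r : EuclideanSpace ℝ (Fin N)) :
    Laplacian.laplacian (fun y => f (y - c)) r = Laplacian.laplacian f (r - c) := by
  have h1 : ContDiff ℝ 2 fun y => f (y - c) := hf.comp (contDiff_id.sub contDiff_const)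
  rw [laplacian_eq_sum_fderiv h1.contDiffAt, laplacian_eq_sum_fderiv hf.contDiffAt]
  refine Finset.sum_congr rfl fun i _ => ?_
  simp only [fderiv_comp_sub_apply]
  exact fderiv_comp_sub_apply (fun y => fderiv ℝ f y (EuclideanSpace.single i 1)) c r _

set_option maxHeartbeats 1000000 in
/-- The commutator of the Laplacian with a logarithmic cutoff, tested against a function with the
growth of a difference of two fundamental solutions. -/
theorem eventually_norm_mul_cutoff_error_le (hN : 2 ≤ N) {c : EuclideanSpace ℝ (Fin N)}
    {h ψ : EuclideanSpace ℝ (Fin N) → ℂ}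
    (hin : ∀ δ : ℝ, 0 < δ → ∀ᶠ r in 𝓝[≠] c, ‖h r‖ ≤ δ * ((‖r - c‖ ^ (N - 2))⁻¹ *
      (if N = 2 then |Real.log ‖r - c‖| else 1)))
    {K₀ : ℝ} (hout : ∀ᶠ r in Bornology.cobounded (EuclideanSpace ℝ (Fin N)),
      ‖h r‖ ≤ K₀ * (‖r - c‖ ^ (N - 2))⁻¹)
    {K : ℝ} (hψ0 : ∀ r, ‖ψ r‖ ≤ K * ((1 + ‖r - c‖) ^ (N - 2))⁻¹)
    (hψ1 : ∀ r i, ‖fderiv ℝ ψ r (EuclideanSpace.single i 1)‖ ≤ K * ((1 + ‖r - c‖) ^ 2)⁻¹)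
    {δ : ℝ} (hδ : 0 < δ) :
    ∀ᶠ L : ℝ in atTop, ∀ r, r ≠ c →
      ‖h r * (ψ r * Laplacian.laplacian (logCutoff L) (r - c) +
        2 * ∑ i, fderiv ℝ (logCutoff L) (r - c) (EuclideanSpace.single i 1) *
          fderiv ℝ ψ r (EuclideanSpace.single i 1))‖ ≤
      δ * (Set.Icc (Real.exp (-(2 * L))) (Real.exp (2 * L))).indicator
        (fun s => (s ^ N)⁻¹ / L) ‖r - c‖ := by
  obtain ⟨T, hT0, hT⟩ := exists_bound_logCutoff N
  have hK0 : 0 ≤ K := by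
    have := (norm_nonneg _).trans (hψ0 c)
    simpa using this
  -- 3N + 2 bounds the bracket in `hE`, weighted by the growth of h on the inner shell and up to a
  -- factor 1/L on the outer; the added 1 keeps D positive.
  set D := T * K * (3 * N + 2) + 1 with hD
  have hD0 : 0 < D := by positivity
  obtain ⟨ε, hε, hin⟩ := Metric.mem_nhdsWithin_iff.1 (hin (δ / D) (by positivity))
  obtain ⟨R, -, hR⟩ := (Metric.hasBasis_cobounded_compl_closedBall c).eventually_iff.1 hout
  have hNr : (2 : ℝ) ≤ N := by exact_mod_cast hN
  filter_upwards [eventually_ge_atTop (1 : ℝ), eventually_gt_atTop (-Real.log ε),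
    eventually_gt_atTop R, eventually_ge_atTop (|K₀| * D / δ)] with L hL1 hLε hLR hLδ
  have hL0 : 0 < L := by linarith
  intro r hr
  have hz : r - c ≠ 0 := sub_ne_zero.2 hr
  have hs : 0 < ‖r - c‖ := norm_pos_iff.2 hz
  obtain ⟨t1, t2, t3⟩ := hT L hL0 (r - c) hz
  set s := ‖r - c‖ with hsdef
  have hrhs : 0 ≤ (Set.Icc (Real.exp (-(2 * L))) (Real.exp (2 * L))).indicator
      (fun s => (s ^ N)⁻¹ / L) s :=
    Set.indicator_apply_nonneg fun _ => by positivity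
  by_cases hann : |Real.log s| < L ∨ 2 * L < |Real.log s|
  · obtain ⟨z1, z2⟩ := t3 hann
    simp only [z1, z2]
    simp only [mul_zero, zero_mul, Finset.sum_const_zero, add_zero, norm_zero]
    positivity
  rw [not_or, not_lt, not_lt] at hann
  have hmem : s ∈ Set.Icc (Real.exp (-(2 * L))) (Real.exp (2 * L)) := by
    have := abs_le.1 hann.2
    exact ⟨(Real.le_log_iff_exp_le hs).1 this.1, (Real.log_le_iff_le_exp hs).1 this.2⟩
  rw [Set.indicator_of_mem hmem, norm_mul]
  have hE : ‖ψ r * Laplacian.laplacian (logCutoff L) (r - c) +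
        2 * ∑ i, fderiv ℝ (logCutoff L) (r - c) (EuclideanSpace.single i 1) *
          fderiv ℝ ψ r (EuclideanSpace.single i 1)‖ ≤
      T * K / (L * s ^ 2) * (((1 + s) ^ (N - 2))⁻¹ * (1 / L + (N - 2)) +
        2 * N * (s * ((1 + s) ^ 2)⁻¹)) := by
    refine (norm_add_le _ _).trans ?_
    have u1 : ‖ψ r * Laplacian.laplacian (logCutoff L) (r - c)‖ ≤
        K * ((1 + s) ^ (N - 2))⁻¹ * (T / (L * s ^ 2) * (1 / L + (N - 2))) := by
      rw [norm_mul]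
      rw [abs_of_nonneg (by linarith : (0 : ℝ) ≤ (N : ℝ) - 2)] at t2
      exact mul_le_mul (hψ0 r) t2 (norm_nonneg _) (by positivity)
    have u2 : ‖2 * ∑ i, fderiv ℝ (logCutoff L) (r - c) (EuclideanSpace.single i 1) *
          fderiv ℝ ψ r (EuclideanSpace.single i 1)‖ ≤
        2 * (N * (T / (L * s) * (K * ((1 + s) ^ 2)⁻¹))) := by
      rw [norm_mul]
      simp only [Complex.norm_ofNat]
      refine mul_le_mul_of_nonneg_left ?_ (by norm_num)
      refine (norm_sum_le _ _).trans ?_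
      refine (Finset.sum_le_card_nsmul _ _ (T / (L * s) * (K * ((1 + s) ^ 2)⁻¹)) fun i _ => ?_).trans
        (by rw [Finset.card_univ, Fintype.card_fin, nsmul_eq_mul])
      rw [norm_mul]
      exact mul_le_mul (t1 i) (hψ1 r i) (norm_nonneg _) (by positivity)
    refine (add_le_add u1 u2).trans (le_of_eq ?_)
    field_simp
  generalize ψ r * Laplacian.laplacian (logCutoff L) (r - c) +
        2 * ∑ i, fderiv ℝ (logCutoff L) (r - c) (EuclideanSpace.single i 1) *
          fderiv ℝ ψ r (EuclideanSpace.single i 1) = e at hE ⊢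
  clear t1 t2 t3 hψ0 hψ1 hT
  have hP : (s ^ N)⁻¹ = (s ^ (N - 2))⁻¹ / s ^ 2 := by
    obtain ⟨M, rfl⟩ : ∃ M, N = M + 2 := ⟨N - 2, by omega⟩
    rw [show M + 2 - 2 = M by omega, pow_add]
    field_simp
  rw [hP]
  set P := (s ^ (N - 2))⁻¹ with hPdef
  have hP0 : 0 < P := by positivity
  have hb2 : s * ((1 + s) ^ 2)⁻¹ ≤ s ∧ s * ((1 + s) ^ 2)⁻¹ ≤ 1 / s := by
    constructor
    · refine mul_le_of_le_one_right hs.le (inv_le_one_of_one_le₀ ?_)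
      nlinarith
    · rw [← div_eq_mul_inv, div_le_div_iff₀ (by positivity) hs]
      nlinarith
  have hb1 : ((1 + s) ^ (N - 2))⁻¹ ≤ 1 := inv_le_one_of_one_le₀ (one_le_pow₀ (by linarith))
  have h1L : 1 / L ≤ 1 := (div_le_one hL0).2 hL1
  have hN2 : (0 : ℝ) ≤ N - 2 := by linarith
  -- On the inner shell smallness comes from h being of smaller order than the fundamental solution.
  -- On the outer shell h is only O(s^(2-N)), and the decay of ψ and its gradient supplies an extra
  -- 1/L, because s ≥ e^L > L.
  rcases le_or_gt (Real.log s) 0 with hlog | hlog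
  · have habs : |Real.log s| = -Real.log s := abs_of_nonpos hlog
    have hs1 : s ≤ 1 := (Real.log_nonpos_iff hs.le).1 hlog
    have hsε : s < ε := by
      rw [← Real.log_lt_log_iff hs hε]
      linarith [hann.1]
    have hh : ‖h r‖ ≤ δ / D * (P * (if N = 2 then |Real.log s| else 1)) :=
      hin ⟨by rw [Metric.mem_ball, dist_eq_norm]; exact hsε, hr⟩
    set l : ℝ := if N = 2 then |Real.log s| else 1 with hl
    have hl0 : 0 ≤ l := by rw [hl]; split_ifs <;> positivity
    have hlb : l * (((1 + s) ^ (N - 2))⁻¹ * (1 / L + (N - 2)) +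
        2 * N * (s * ((1 + s) ^ 2)⁻¹)) ≤ 3 * N + 2 := by
      have k1 : l * (((1 + s) ^ (N - 2))⁻¹ * (1 / L + (N - 2)) +
          2 * N * (s * ((1 + s) ^ 2)⁻¹)) ≤ l * (1 * (1 / L + (N - 2)) + 2 * N * s) := by
        gcongr
        exact hb2.1
      refine k1.trans ?_
      rw [hl]
      split_ifs with h2
      · have h2' : (N : ℝ) = 2 := by exact_mod_cast h2
        -- For N = 2 the logarithmic growth, at most 2L here, is compensated by the factor 1/L in
        -- the Laplacian of the cutoff.
        have m1 : |Real.log s| * (1 / L) ≤ 2 := by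
          rw [mul_one_div, div_le_iff₀ hL0]; exact hann.2
        have m2 : |Real.log s| * s ≤ 1 := by
          have := Real.abs_log_mul_self_lt s hs hs1
          rw [abs_mul, abs_of_pos hs] at this
          exact this.le
        rw [h2']
        nlinarith
      · nlinarith
    calc ‖h r‖ * ‖e‖ ≤ δ / D * (P * l) * (T * K / (L * s ^ 2) *
          (((1 + s) ^ (N - 2))⁻¹ * (1 / L + (N - 2)) + 2 * N * (s * ((1 + s) ^ 2)⁻¹))) :=
          mul_le_mul hh hE (norm_nonneg _) (by positivity)
      _ = δ / D * (P / s ^ 2 / L) * (T * K) * (l * (((1 + s) ^ (N - 2))⁻¹ * (1 / L + (N - 2)) +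
          2 * N * (s * ((1 + s) ^ 2)⁻¹))) := by field_simp
      _ ≤ δ / D * (P / s ^ 2 / L) * (T * K) * (3 * N + 2) := by gcongr
      _ = δ / D * (P / s ^ 2 / L) * (D - 1) := by rw [hD]; ring
      _ ≤ δ / D * (P / s ^ 2 / L) * D := by gcongr; linarith
      _ = δ * (P / s ^ 2 / L) := by field_simp
  · have habs : |Real.log s| = Real.log s := abs_of_pos hlog
    have hsL : L < s := by
      have h1 : Real.exp L ≤ s := (Real.le_log_iff_exp_le hs).1 (by linarith [hann.1])
      linarith [Real.add_one_le_exp L]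
    have hs1 : 1 ≤ s := by linarith
    have hh : ‖h r‖ ≤ K₀ * P := hR (x := r) (by
      rw [Set.mem_compl_iff, Metric.mem_closedBall, dist_eq_norm, not_le]
      linarith)
    have hh' : ‖h r‖ ≤ |K₀| * P := hh.trans (mul_le_mul_of_nonneg_right (le_abs_self _) hP0.le)
    have hlb : ((1 + s) ^ (N - 2))⁻¹ * (1 / L + (N - 2)) +
        2 * N * (s * ((1 + s) ^ 2)⁻¹) ≤ (3 * N + 2) / L := by
      have hsL' : 1 / s ≤ 1 / L := one_div_le_one_div_of_le hL0 hsL.le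
      -- For N = 2 the term is absent; otherwise (1+s)^(N-2) ≥ 1+s > L provides the gain.
      have k1 : ((1 + s) ^ (N - 2))⁻¹ * ((N : ℝ) - 2) ≤ (N - 2) * (1 / L) := by
        rcases hN.eq_or_lt with h2 | h2
        · rw [← h2]; norm_num
        · have : (1 + s) ≤ (1 + s) ^ (N - 2) := le_self_pow₀ (by linarith) (by omega)
          have : ((1 + s) ^ (N - 2))⁻¹ ≤ 1 / L := by
            rw [one_div]
            exact inv_anti₀ hL0 (by linarith)
          rw [mul_comm]
          gcongr
      have k2 : ((1 + s) ^ (N - 2))⁻¹ * (1 / L) ≤ 1 / L :=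
        mul_le_of_le_one_left (by positivity) hb1
      have k3 : 2 * (N : ℝ) * (s * ((1 + s) ^ 2)⁻¹) ≤ 2 * N * (1 / L) := by
        gcongr
        exact hb2.2.trans hsL'
      have k4 : (3 * (N : ℝ) + 2) / L = (3 * N + 2) * (1 / L) := by ring
      rw [k4, mul_add]
      have : 0 < 1 / L := by positivity
      linarith
    calc ‖h r‖ * ‖e‖ ≤ |K₀| * P * (T * K / (L * s ^ 2) *
          (((1 + s) ^ (N - 2))⁻¹ * (1 / L + (N - 2)) + 2 * N * (s * ((1 + s) ^ 2)⁻¹))) :=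
          mul_le_mul hh' hE (norm_nonneg _) (by positivity)
      _ ≤ |K₀| * P * (T * K / (L * s ^ 2) * ((3 * N + 2) / L)) := by gcongr
      _ = |K₀| * (D - 1) / L * (P / s ^ 2 / L) := by rw [hD]; field_simp; ring
      _ ≤ δ * (P / s ^ 2 / L) := by
          gcongr
          rw [div_le_iff₀ hL0]
          rw [div_le_iff₀ hδ] at hLδ
          nlinarith [abs_nonneg K₀]

end Vanishing

/-! ### Orthogonality to the image of the operator. -/

section Vanishing

open MeasureTheory

variable {N : ℕ}

theorem eventually_logCutoff_natCast_eq_one {z : EuclideanSpace ℝ (Fin N)} (hz : z ≠ 0) :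
    ∀ᶠ n : ℕ in atTop, logCutoff (n : ℝ) z = 1 := by
  filter_upwards [tendsto_natCast_atTop_atTop.eventually_ge_atTop |Real.log ‖z‖|,
    eventually_gt_atTop 0] with n h1 h2
  exact logCutoff_eq_one (by exact_mod_cast h2) hz h1

/-- A solution of `Δh + V h = 0` off a point, with the growth of a difference of two fundamental
solutions, is orthogonal to `Δψ + V ψ` for every admissible test function `ψ`. -/
theorem integral_mul_laplacian_add_eq_zero (hN : 2 ≤ N) {c : EuclideanSpace ℝ (Fin N)}
    {h ψ V : EuclideanSpace ℝ (Fin N) → ℂ} (hV : Continuous V)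
    (hh : ContDiffOn ℝ 2 h {c}ᶜ) (heq : ∀ r, r ≠ c → Laplacian.laplacian h r + V r * h r = 0)
    (hin : ∀ δ : ℝ, 0 < δ → ∀ᶠ r in 𝓝[≠] c, ‖h r‖ ≤ δ * ((‖r - c‖ ^ (N - 2))⁻¹ *
      (if N = 2 then |Real.log ‖r - c‖| else 1)))
    {K₀ : ℝ} (hout : ∀ᶠ r in Bornology.cobounded (EuclideanSpace ℝ (Fin N)),
      ‖h r‖ ≤ K₀ * (‖r - c‖ ^ (N - 2))⁻¹)
    (hψ : ContDiff ℝ 2 ψ) {K : ℝ} (hψ0 : ∀ r, ‖ψ r‖ ≤ K * ((1 + ‖r - c‖) ^ (N - 2))⁻¹)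
    (hψ1 : ∀ r i, ‖fderiv ℝ ψ r (EuclideanSpace.single i 1)‖ ≤ K * ((1 + ‖r - c‖) ^ 2)⁻¹)
    (hψ2 : ∀ r, ‖Laplacian.laplacian ψ r + V r * ψ r‖ ≤ K * ((1 + ‖r - c‖) ^ 3)⁻¹) :
    ∫ r, h r * (Laplacian.laplacian ψ r + V r * ψ r) = 0 := by
  have : Nonempty (Fin N) := ⟨⟨0, by omega⟩⟩
  have hU : IsOpen ({c}ᶜ : Set (EuclideanSpace ℝ (Fin N))) := isOpen_compl_singleton
  set g : EuclideanSpace ℝ (Fin N) → ℂ := fun r => Laplacian.laplacian ψ r + V r * ψ r with hg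
  have hgc : Continuous g := by
    have : Continuous (Laplacian.laplacian ψ) := by
      have e : Laplacian.laplacian ψ = fun x => ∑ i, fderiv ℝ
          (fun y => fderiv ℝ ψ y (EuclideanSpace.single i 1)) x (EuclideanSpace.single i 1) :=
        funext fun x => laplacian_eq_sum_fderiv hψ.contDiffAt
      rw [e]
      refine continuous_finsetSum _ fun i _ => ?_
      have : ContDiff ℝ 1 fun y => fderiv ℝ ψ y (EuclideanSpace.single i (1 : ℝ)) :=
        (hψ.fderiv_right (m := 1) (by norm_num)).clm_apply contDiff_const
      exact (this.continuous_fderiv (by norm_num)).clm_apply continuous_const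
    exact this.add (hV.mul hψ.continuous)
  have hint : Integrable fun r => h r * g r :=
    integrable_mul_of_growth hN hh.continuousOn hgc
      ((hin 1 one_pos).mono fun r hr => by rwa [one_mul] at hr) hout hψ2
  have hae : ∀ᵐ r : EuclideanSpace ℝ (Fin N), r ≠ c := by
    simp [ae_iff, measure_singleton]
  let θ : ℝ → EuclideanSpace ℝ (Fin N) → ℂ := fun L r => logCutoff L (r - c)
  let err : ℝ → EuclideanSpace ℝ (Fin N) → ℂ := fun L r =>
    ψ r * Laplacian.laplacian (logCutoff L) (r - c) +
        2 * ∑ i, fderiv ℝ (logCutoff L) (r - c) (EuclideanSpace.single i 1) *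
          fderiv ℝ ψ r (EuclideanSpace.single i 1)
  have hθc : ∀ L : ℝ, 0 < L → ContDiff ℝ 2 (θ L) := fun L hL =>
    (contDiff_logCutoff hL).comp (contDiff_id.sub contDiff_const)
  have hθint : ∀ L : ℝ, 0 < L → Integrable fun r => θ L r * (h r * g r) := fun L hL =>
    hint.bdd_mul (c := 1) (hθc L hL).continuous.aestronglyMeasurable
      (Eventually.of_forall fun r => norm_logCutoff_le_one L (r - c))
  -- Green's identity for θψ, whose support avoids c and is compact: since h solves the equation,
  -- only the commutator of the Laplacian with θ survives.
  have hident : ∀ L : ℝ, 0 < L → ∫ r, θ L r * (h r * g r) = -∫ r, h r * err L r := by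
    intro L hL
    set φ : EuclideanSpace ℝ (Fin N) → ℂ := fun r => θ L r * ψ r with hφ
    have hφc : ContDiff ℝ 2 φ := (hθc L hL).mul hψ
    have hts : tsupport (θ L) ⊆ {c}ᶜ ∧ HasCompactSupport (θ L) := by
      have hS : Function.support (θ L) ⊆
          {r | Real.exp (-(2 * L)) ≤ ‖r - c‖ ∧ ‖r - c‖ ≤ Real.exp (2 * L)} := fun r hr =>
        support_logCutoff_subset hL hr
      constructor
      · have hn : Continuous fun r : EuclideanSpace ℝ (Fin N) => ‖r - c‖ := by fun_prop
        refine (closure_minimal hS ((isClosed_le continuous_const hn).inter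
          (isClosed_le hn continuous_const))).trans ?_
        rintro r ⟨hr, -⟩ rfl
        have := Real.exp_pos (-(2 * L))
        rw [sub_self, norm_zero] at hr
        linarith
      · refine HasCompactSupport.of_support_subset_isCompact
          (isCompact_closedBall c (Real.exp (2 * L))) fun r hr => ?_
        rw [Metric.mem_closedBall, dist_eq_norm]
        exact (hS hr).2
    have hφs : tsupport φ ⊆ {c}ᶜ := (tsupport_mul_subset_left (f := θ L) (g := ψ)).trans hts.1
    have hφk : HasCompactSupport φ := hts.2.mul_right (f' := ψ)
    have hlap : ∀ r, Laplacian.laplacian φ r + V r * φ r = θ L r * g r + err L r := by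
      intro r
      rw [hφ, laplacian_mul (hθc L hL).contDiffAt hψ.contDiffAt,
        laplacian_comp_sub (contDiff_logCutoff hL)]
      simp only [θ, err, hg, fderiv_comp_sub_apply]
      ring
    have i1 : Integrable fun r => h r * Laplacian.laplacian φ r := by
      have e : Laplacian.laplacian φ = fun x => ∑ i, fderiv ℝ
          (fun y => fderiv ℝ φ y (EuclideanSpace.single i 1)) x (EuclideanSpace.single i 1) :=
        funext fun x => laplacian_eq_sum_fderiv hφc.contDiffAt
      simp only [e, Finset.mul_sum]
      refine integrable_finsetSum _ fun i _ => ?_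
      have c1 : ContDiff ℝ 1 fun y => fderiv ℝ φ y (EuclideanSpace.single i (1 : ℝ)) :=
        (hφc.fderiv_right (m := 1) (by norm_num)).clm_apply contDiff_const
      refine integrable_mul_of_tsupport_subset hU hh.continuousOn
        ((c1.continuous_fderiv (by norm_num)).clm_apply continuous_const)
        ((hφk.fderiv_apply ℝ _).fderiv_apply ℝ _) ?_
      exact ((tsupport_fderiv_apply_subset ℝ _).trans (tsupport_fderiv_apply_subset ℝ _)).trans hφs
    have i2 : Integrable fun r => h r * (V r * φ r) :=
      integrable_mul_of_tsupport_subset hU hh.continuousOn (hV.mul hφc.continuous)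
        (hφk.mul_left (f := V)) ((tsupport_mul_subset_right (f := V) (g := φ)).trans hφs)
    have z : ∫ r, h r * (Laplacian.laplacian φ r + V r * φ r) = 0 := by
      have z1 := integral_mul_laplacian_eq hU hh hφc hφk hφs
      have z2 : ∫ r, Laplacian.laplacian h r * φ r = -∫ r, h r * (V r * φ r) := by
        rw [← integral_neg]
        refine integral_congr_ae ?_
        filter_upwards [hae] with r hr
        linear_combination (φ r) * heq r hr
      simp only [mul_add]
      rw [integral_add i1 i2, z1, z2]
      ring
    have i3 : Integrable fun r => h r * err L r := by
      refine ((i1.add i2).sub (hθint L hL)).congr (Eventually.of_forall fun r => ?_)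
      have := hlap r
      simp only [Pi.add_apply, Pi.sub_apply]
      linear_combination (h r) * this
    have e : ∀ r, h r * (Laplacian.laplacian φ r + V r * φ r) =
        θ L r * (h r * g r) + h r * err L r := fun r => by
      rw [hlap]; ring
    simp only [e] at z
    rw [integral_add (hθint L hL) i3] at z
    exact eq_neg_of_add_eq_zero_left z
  have lim1 : Tendsto (fun n : ℕ => ∫ r, θ n r * (h r * g r)) atTop (𝓝 (∫ r, h r * g r)) := by
    refine tendsto_integral_of_dominated_convergence (fun r => ‖h r * g r‖)
      (fun n => ?_) hint.norm (fun n => Eventually.of_forall fun r => ?_) ?_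
    · have hm : Measurable (θ n) := by
        refine Measurable.comp (g := logCutoff (n : ℝ)) ?_ (measurable_id.sub_const c)
        unfold logCutoff
        refine Measurable.ite (measurableSet_singleton 0) measurable_const ?_
        exact Complex.measurable_ofReal.comp (lineBump.continuous.measurable.comp
          ((Real.measurable_log.comp measurable_norm).div_const _))
      exact hm.aestronglyMeasurable.mul hint.aestronglyMeasurable
    · rw [norm_mul]
      exact mul_le_of_le_one_left (norm_nonneg _) (norm_logCutoff_le_one _ _)
    · filter_upwards [hae] with r hr
      refine tendsto_const_nhds.congr' ?_
      filter_upwards [eventually_logCutoff_natCast_eq_one (sub_ne_zero.2 hr)] with n hn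
      simp only [θ, hn, one_mul]
  have lim2 : Tendsto (fun n : ℕ => ∫ r, θ n r * (h r * g r)) atTop (𝓝 0) := by
    rw [Metric.tendsto_nhds]
    intro ε hε
    set W : ℝ := N * volume.real (Metric.ball (0 : EuclideanSpace ℝ (Fin N)) 1) * 4 with hW
    have hW0 : 0 ≤ W := by positivity
    have hδ : 0 < ε / (W + 1) := by positivity
    filter_upwards [tendsto_natCast_atTop_atTop.eventually
      (eventually_norm_mul_cutoff_error_le hN hin hout hψ0 hψ1 hδ), eventually_gt_atTop 0]
      with n hn hn0
    have hn0' : (0 : ℝ) < n := by exact_mod_cast hn0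
    rw [dist_zero_right, hident n hn0', norm_neg]
    obtain ⟨b1, b2⟩ := integrable_radial_annulus hN hn0'
    refine (norm_integral_le_of_norm_le ((b1.comp_sub_right c).const_mul (ε / (W + 1)))
      (hae.mono fun r hr => hn r hr)).trans_lt ?_
    rw [integral_const_mul, integral_sub_right_eq_self (fun z : EuclideanSpace ℝ (Fin N) =>
      (Set.Icc (Real.exp (-(2 * (n : ℝ)))) (Real.exp (2 * (n : ℝ)))).indicator
      (fun s => (s ^ N)⁻¹ / (n : ℝ)) ‖z‖) c, b2, ← hW, div_mul_eq_mul_div,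
      div_lt_iff₀ (by positivity)]
    nlinarith
  exact tendsto_nhds_unique lim1 lim2

end Vanishing

/-! ### Decay of the zonal test functions. -/

section Zonal

open MeasureTheory

variable {N : ℕ}

/-- `-1 + 2ρ²|r-e|² / ((r²+ρ²)(e²+ρ²))` lies in `[-1, 1]`. -/
theorem zonalArg_mem_Icc {ρ : ℝ} (hρ : 0 < ρ) (e r : EuclideanSpace ℝ (Fin N)) :
    -1 + 2 * ρ ^ 2 / (‖e‖ ^ 2 + ρ ^ 2) * ‖r - e‖ ^ 2 / (‖r‖ ^ 2 + ρ ^ 2) ∈ Set.Icc (-1 : ℝ) 1 := by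
  have h1 : 0 < ‖e‖ ^ 2 + ρ ^ 2 := by positivity
  have h2 : 0 < ‖r‖ ^ 2 + ρ ^ 2 := by positivity
  constructor
  · have : 0 ≤ 2 * ρ ^ 2 / (‖e‖ ^ 2 + ρ ^ 2) * ‖r - e‖ ^ 2 / (‖r‖ ^ 2 + ρ ^ 2) := by positivity
    linarith
  · have h3 : 2 * ρ ^ 2 / (‖e‖ ^ 2 + ρ ^ 2) * ‖r - e‖ ^ 2 / (‖r‖ ^ 2 + ρ ^ 2) ≤ 2 := by
      rw [div_mul_eq_mul_div, div_div, div_le_iff₀ (by positivity)]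
      have h4 := norm_sub_sq_real r e
      have h5 := abs_real_inner_le_norm r e
      have h6 := (abs_le.1 h5).1
      -- The claim amounts to (|r||e| - ρ²)² + 2ρ²(|r||e| + r·e) ≥ 0.
      nlinarith [sq_nonneg (‖r‖ * ‖e‖ - ρ ^ 2), mul_pos hρ hρ]
    linarith

theorem exists_one_add_norm_sub_sq_le {ρ : ℝ} (hρ : 0 < ρ) (c : EuclideanSpace ℝ (Fin N)) :
    ∃ C : ℝ, 0 < C ∧ ∀ r, (1 + ‖r - c‖) ^ 2 ≤ C * (‖r‖ ^ 2 + ρ ^ 2) := by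
  refine ⟨2 + 2 * (1 + ‖c‖) ^ 2 / ρ ^ 2, by positivity, fun r => ?_⟩
  have h1 : ‖r - c‖ ≤ ‖r‖ + ‖c‖ := norm_sub_le r c
  have h2 : (1 + ‖r - c‖) ^ 2 ≤ (‖r‖ + (1 + ‖c‖)) ^ 2 := by
    have := norm_nonneg (r - c)
    gcongr ?_ ^ 2
    linarith
  have h3 : 2 * (1 + ‖c‖) ^ 2 / ρ ^ 2 * (‖r‖ ^ 2 + ρ ^ 2) =
      2 * (1 + ‖c‖) ^ 2 / ρ ^ 2 * ‖r‖ ^ 2 + 2 * (1 + ‖c‖) ^ 2 := by field_simp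
  have h4 : 0 ≤ 2 * (1 + ‖c‖) ^ 2 / ρ ^ 2 * ‖r‖ ^ 2 := by positivity
  rw [add_mul, h3]
  nlinarith [sq_nonneg (‖r‖ - (1 + ‖c‖)), mul_pos hρ hρ]

/-- The four estimates share one constant for later use. The factor |1 - N/2| in the last is
essential: for N = 2 the power A^(-1/2) is not O(1/A), but the weight is then constant and the term
drops out. -/
theorem exists_weight_le (hN : 2 ≤ N) {ρ : ℝ} (hρ : 0 < ρ) (c : EuclideanSpace ℝ (Fin N)) :
    ∃ C : ℝ, 0 < C ∧ ∀ r : EuclideanSpace ℝ (Fin N),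
      (‖r‖ ^ 2 + ρ ^ 2) ^ (1 - (N : ℝ) / 2) ≤ C * ((1 + ‖r - c‖) ^ (N - 2))⁻¹ ∧
      (‖r‖ ^ 2 + ρ ^ 2) ^ (1 - (N : ℝ) / 2) ≤ C ∧
      (‖r‖ ^ 2 + ρ ^ 2)⁻¹ ≤ C * ((1 + ‖r - c‖) ^ 2)⁻¹ ∧
      |1 - (N : ℝ) / 2| * (‖r‖ ^ 2 + ρ ^ 2) ^ (1 - (N : ℝ) / 2 - 1 / 2) ≤
        C * (‖r‖ ^ 2 + ρ ^ 2)⁻¹ := by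
  obtain ⟨C, hC0, hC⟩ := exists_one_add_norm_sub_sq_le hρ c
  have hN2 : (2 : ℝ) ≤ N := by exact_mod_cast hN
  set l : ℝ := (N : ℝ) / 2 - 1 with hl
  have hl0 : 0 ≤ l := by rw [hl]; linarith
  have hρ2 : 0 < ρ ^ 2 := by positivity
  refine ⟨C ^ l + (ρ ^ 2) ^ (-l) + C + |l| * (ρ ^ 2) ^ (-l + 1 / 2), by positivity, fun r => ?_⟩
  set A := ‖r‖ ^ 2 + ρ ^ 2 with hA
  have hA0 : 0 < A := by positivity
  have hρA : ρ ^ 2 ≤ A := by rw [hA]; nlinarith [sq_nonneg ‖r‖]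
  have p1 : 0 < C ^ l := by positivity
  have p2 : 0 < (ρ ^ 2) ^ (-l) := by positivity
  have p3 : 0 ≤ |l| * (ρ ^ 2) ^ (-l + 1 / 2) := by positivity
  rw [show 1 - (N : ℝ) / 2 = -l by rw [hl]; ring]
  have hs : 0 < 1 + ‖r - c‖ := by positivity
  have b1 : A ^ (-l) ≤ C ^ l * ((1 + ‖r - c‖) ^ (N - 2))⁻¹ := by
    have e1 : (1 + ‖r - c‖) ^ (N - 2) = ((1 + ‖r - c‖) ^ 2) ^ l := by
      rw [← Real.rpow_natCast, ← Real.rpow_natCast, ← Real.rpow_mul hs.le,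
        Nat.cast_sub hN, hl]
      congr 1
      push_cast
      ring
    have e2 : ((1 + ‖r - c‖) ^ 2) ^ l ≤ C ^ l * A ^ l := by
      rw [← Real.mul_rpow hC0.le hA0.le]
      exact Real.rpow_le_rpow (by positivity) (hC r) hl0
    have e3 : 0 < ((1 + ‖r - c‖) ^ 2) ^ l := by positivity
    have e4 : 0 < A ^ l := by positivity
    rw [e1, Real.rpow_neg hA0.le, ← div_eq_mul_inv, inv_eq_one_div, div_le_div_iff₀ e4 e3]
    linarith
  refine ⟨b1.trans ?_, ?_, ?_, ?_⟩
  · gcongr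
    linarith
  · have := Real.rpow_le_rpow_of_nonpos hρ2 hρA (neg_nonpos.2 hl0)
    linarith
  · have e1 : A⁻¹ ≤ C * ((1 + ‖r - c‖) ^ 2)⁻¹ := by
      rw [← div_eq_mul_inv, inv_eq_one_div, div_le_div_iff₀ hA0 (by positivity)]
      linarith [hC r]
    refine e1.trans ?_
    gcongr
    linarith
  · rw [abs_neg]
    have e1 : |l| * A ^ (-l - 1 / 2) ≤ |l| * (ρ ^ 2) ^ (-l + 1 / 2) * A⁻¹ := by
      rcases hN.eq_or_lt with h | h
      · have : l = 0 := by rw [hl, ← h]; norm_num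
        rw [this]; simp
      · have h3 : (3 : ℝ) ≤ N := by exact_mod_cast h
        have e2 : A ^ (-l - 1 / 2) = A ^ (-l + 1 / 2) * A⁻¹ := by
          rw [← Real.rpow_neg_one A, ← Real.rpow_add hA0]
          congr 1
          ring
        have e3 : A ^ (-l + 1 / 2) ≤ (ρ ^ 2) ^ (-l + 1 / 2) :=
          Real.rpow_le_rpow_of_nonpos hρ2 hρA (by rw [hl]; linarith)
        rw [e2, ← mul_assoc]
        gcongr
    refine e1.trans ?_
    gcongr
    linarith

/-- Zonal functions qualify as test functions for the orthogonality relation. The gradient of the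
zonal argument is O(1/A) by a cancellation in its numerator, and the gradient of the weight is
O(1/A) as well. -/
theorem exists_bound_conformalZonal (hN : 2 ≤ N) {ρ : ℝ} (hρ : 0 < ρ)
    (c e : EuclideanSpace ℝ (Fin N)) {κ : ℝ} (hκ : κ = 2 * ρ ^ 2 / (‖e‖ ^ 2 + ρ ^ 2))
    {p p₁ p₂ : ℝ → ℂ} (hpc : ContDiff ℝ 2 p) (hp : ∀ t, HasDerivAt p (p₁ t) t)
    (hp₁ : ∀ t, HasDerivAt p₁ (p₂ t) t) {M : ℝ} (hM : ∀ t ∈ Set.Icc (-1 : ℝ) 1, ‖p t‖ ≤ M)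
    (hM₁ : ∀ t ∈ Set.Icc (-1 : ℝ) 1, ‖p₁ t‖ ≤ M) :
    ∃ K : ℝ, 0 ≤ K ∧ ∀ r,
      ‖conformalZonal ρ κ (1 - (N : ℝ) / 2) e p r‖ ≤ K * ((1 + ‖r - c‖) ^ (N - 2))⁻¹ ∧
      ∀ i, ‖fderiv ℝ (conformalZonal ρ κ (1 - (N : ℝ) / 2) e p) r (EuclideanSpace.single i 1)‖ ≤
        K * ((1 + ‖r - c‖) ^ 2)⁻¹ := by
  obtain ⟨C, hC0, hC⟩ := exists_weight_le hN hρ c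
  have hM0 : 0 ≤ M := (norm_nonneg _).trans (hM 0 (by norm_num))
  set m : ℝ := 1 - (N : ℝ) / 2
  have hκ0 : 0 ≤ κ := by rw [hκ]; positivity
  set T : ℝ := ρ + 2 * ‖e‖ + ‖e‖ ^ 2 / ρ + ‖e‖
  have hT0 : 0 ≤ T := by positivity
  refine ⟨C * M + (2 * C * M + C * (κ * (2 * T) * M)) * C, by positivity, fun r => ?_⟩
  obtain ⟨c1, c2, c3, c4⟩ := hC r
  have hξ := zonalArg_mem_Icc hρ e r
  rw [← hκ] at hξ
  set A := ‖r‖ ^ 2 + ρ ^ 2 with hA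
  have hA0 : 0 < A := by positivity
  set B := ‖r - e‖ ^ 2 with hB
  set ξ := -1 + κ * B / A with hξdef
  have hw0 : 0 < A ^ m := by positivity
  constructor
  · unfold conformalZonal
    rw [norm_mul, Complex.norm_real, Real.norm_of_nonneg hw0.le]
    calc A ^ m * ‖p ξ‖ ≤ C * ((1 + ‖r - c‖) ^ (N - 2))⁻¹ * M :=
          mul_le_mul c1 (hM ξ hξ) (norm_nonneg _) (by positivity)
      _ = C * M * ((1 + ‖r - c‖) ^ (N - 2))⁻¹ := by ring
      _ ≤ _ := by
          gcongr
          have : 0 ≤ (2 * C * M + C * (κ * (2 * T) * M)) * C := by positivity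
          linarith
  · intro i
    rw [(fderiv_conformalZonal hρ κ m e hA hB hξdef hpc.contDiffAt
      (Eventually.of_forall hp) (hp₁ ξ) i).1]
    set a := √A
    have ha0 : 0 < a := Real.sqrt_pos.2 hA0
    have haA : a ^ 2 = A := Real.sq_sqrt hA0.le
    have hra : ‖r‖ ≤ a := Real.le_sqrt_of_sq_le (by rw [hA]; nlinarith)
    have hρa : ρ ≤ a := Real.le_sqrt_of_sq_le (by rw [hA]; nlinarith [sq_nonneg ‖r‖])
    have hri : |r i| ≤ a := (PiLp.norm_apply_le r i).trans hra
    have hei : |e i| ≤ ‖e‖ := PiLp.norm_apply_le e i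
    -- The quadratic parts of A and B cancel, so A - B grows only like √A; hence r i · (A - B) is
    -- O(A) instead of O(A^(3/2)).
    have hAB : |A - B| ≤ (ρ + 2 * ‖e‖ + ‖e‖ ^ 2 / ρ) * a := by
      have h1 : A - B = ρ ^ 2 + 2 * inner ℝ r e - ‖e‖ ^ 2 := by
        rw [hA, hB, norm_sub_sq_real]; ring
      have h2 : |inner ℝ r e| ≤ a * ‖e‖ :=
        (abs_real_inner_le_norm r e).trans (by gcongr)
      have h3 : ‖e‖ ^ 2 ≤ ‖e‖ ^ 2 / ρ * a := by
        rw [div_mul_eq_mul_div, le_div_iff₀ hρ]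
        gcongr
      have h4 : ρ ^ 2 ≤ ρ * a := by rw [sq]; gcongr
      rw [h1, abs_le]
      rw [abs_le] at h2
      constructor <;> nlinarith [sq_nonneg ‖e‖, mul_pos hρ ha0]
    have hnum : |2 * (r - e) i * A - 2 * r i * B| ≤ 2 * T * A := by
      have h1 : 2 * (r - e) i * A - 2 * r i * B = 2 * (r i * (A - B) - e i * A) := by
        simp only [PiLp.sub_apply]; ring
      rw [h1, abs_mul, abs_two, mul_assoc]
      refine mul_le_mul_of_nonneg_left ?_ (by norm_num)
      refine (abs_sub _ _).trans ?_
      rw [abs_mul, abs_mul, abs_of_pos hA0]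
      have h2 : |r i| * |A - B| ≤ a * ((ρ + 2 * ‖e‖ + ‖e‖ ^ 2 / ρ) * a) :=
        mul_le_mul hri hAB (abs_nonneg _) ha0.le
      have h3 : |e i| * A ≤ ‖e‖ * A := by gcongr
      calc |r i| * |A - B| + |e i| * A
          ≤ a * ((ρ + 2 * ‖e‖ + ‖e‖ ^ 2 / ρ) * a) + ‖e‖ * A := add_le_add h2 h3
        _ = (ρ + 2 * ‖e‖ + ‖e‖ ^ 2 / ρ) * a ^ 2 + ‖e‖ * A := by ring
        _ = T * A := by rw [haA]; ring
    have t1 : ‖((m * A ^ (m - 1) * (2 * r i) : ℝ) : ℂ) * p ξ‖ ≤ 2 * (C * A⁻¹) * M := by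
      rw [norm_mul, Complex.norm_real, Real.norm_eq_abs]
      refine mul_le_mul ?_ (hM ξ hξ) (norm_nonneg _) (by positivity)
      rw [abs_mul, abs_mul, abs_mul, abs_two, abs_of_pos (by positivity : 0 < A ^ (m - 1))]
      calc |m| * A ^ (m - 1) * (2 * |r i|) ≤ |m| * A ^ (m - 1) * (2 * a) := by gcongr
        _ = 2 * (|m| * A ^ (m - 1 / 2)) := by
            have : A ^ (m - 1 / 2) = A ^ (m - 1) * a := by
              simp only [a]
              rw [Real.sqrt_eq_rpow, ← Real.rpow_add hA0]
              congr 1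
              ring
            rw [this]; ring
        _ ≤ 2 * (C * A⁻¹) := by gcongr
    have t2 : ‖((A ^ m : ℝ) : ℂ) *
        (((κ * (2 * (r - e) i * A - 2 * r i * B) / A ^ 2 : ℝ) : ℂ) * p₁ ξ)‖ ≤
        C * (κ * (2 * T) * A⁻¹ * M) := by
      rw [norm_mul, norm_mul, Complex.norm_real, Complex.norm_real,
        Real.norm_of_nonneg hw0.le, Real.norm_eq_abs]
      refine mul_le_mul c2 (mul_le_mul ?_ (hM₁ ξ hξ) (norm_nonneg _) (by positivity))
        (by positivity) hC0.le
      rw [abs_div, abs_mul, abs_of_nonneg hκ0, abs_of_pos (by positivity : 0 < A ^ 2)]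
      calc κ * |2 * (r - e) i * A - 2 * r i * B| / A ^ 2 ≤ κ * (2 * T * A) / A ^ 2 := by gcongr
        _ = κ * (2 * T) * A⁻¹ := by field_simp
    refine (norm_add_le _ _).trans ((add_le_add t1 t2).trans ?_)
    calc 2 * (C * A⁻¹) * M + C * (κ * (2 * T) * A⁻¹ * M)
        = (2 * C * M + C * (κ * (2 * T) * M)) * A⁻¹ := by ring
      _ ≤ (2 * C * M + C * (κ * (2 * T) * M)) * (C * ((1 + ‖r - c‖) ^ 2)⁻¹) := by gcongr
      _ = (2 * C * M + C * (κ * (2 * T) * M)) * C * ((1 + ‖r - c‖) ^ 2)⁻¹ := by ring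
      _ ≤ _ := by
          gcongr
          have : 0 ≤ C * M := by positivity
          linarith

end Zonal

/-! ### Vanishing moments and vanishing of the difference. -/

section Uniqueness

open MeasureTheory

variable {N : ℕ}

/-- The weight of the measure for which the operators `w⁻¹ (Δ + V) w` are symmetric. -/
noncomputable def zonalWeight (N : ℕ) (ρ : ℝ) (r : EuclideanSpace ℝ (Fin N)) : ℝ :=
  (‖r‖ ^ 2 + ρ ^ 2) ^ (1 - (N : ℝ) / 2) * (4 * ρ ^ 2 / (‖r‖ ^ 2 + ρ ^ 2) ^ 2)

theorem zonalWeight_pos {ρ : ℝ} (hρ : 0 < ρ) (r : EuclideanSpace ℝ (Fin N)) :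
    0 < zonalWeight N ρ r := by
  unfold zonalWeight
  have : 0 < ‖r‖ ^ 2 + ρ ^ 2 := by positivity
  positivity

theorem continuous_zonalWeight {ρ : ℝ} (hρ : 0 < ρ) : Continuous (zonalWeight N ρ) := by
  have h : ∀ r : EuclideanSpace ℝ (Fin N), ‖r‖ ^ 2 + ρ ^ 2 ≠ 0 := fun r => by positivity
  have hA : Continuous fun r : EuclideanSpace ℝ (Fin N) => ‖r‖ ^ 2 + ρ ^ 2 := by fun_prop
  exact (hA.rpow_const fun r => Or.inl (h r)).mul
    (continuous_const.div (hA.pow 2) fun r => pow_ne_zero 2 (h r))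

theorem exists_zonalWeight_le (hN : 2 ≤ N) {ρ : ℝ} (hρ : 0 < ρ) (c : EuclideanSpace ℝ (Fin N)) :
    ∃ K : ℝ, 0 ≤ K ∧ ∀ r, zonalWeight N ρ r ≤ K * ((1 + ‖r - c‖) ^ 3)⁻¹ := by
  obtain ⟨C, hC0, hC⟩ := exists_weight_le hN hρ c
  refine ⟨C * (4 * ρ ^ 2 * C ^ 2), by positivity, fun r => ?_⟩
  obtain ⟨-, c2, c3, -⟩ := hC r
  unfold zonalWeight
  set A := ‖r‖ ^ 2 + ρ ^ 2 with hA
  have hA0 : 0 < A := by positivity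
  have hs : 1 ≤ 1 + ‖r - c‖ := by linarith [norm_nonneg (r - c)]
  set s := 1 + ‖r - c‖
  calc A ^ (1 - (N : ℝ) / 2) * (4 * ρ ^ 2 / A ^ 2)
      = A ^ (1 - (N : ℝ) / 2) * (4 * ρ ^ 2 * A⁻¹ ^ 2) := by field_simp
    _ ≤ C * (4 * ρ ^ 2 * (C * (s ^ 2)⁻¹) ^ 2) := by gcongr
    _ = C * (4 * ρ ^ 2 * C ^ 2) * (s ^ 4)⁻¹ := by field_simp
    _ ≤ C * (4 * ρ ^ 2 * C ^ 2) * (s ^ 3)⁻¹ := by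
        gcongr
        norm_num

/-- `-1 + 2ρ²|r-e|² / ((r²+ρ²)(e²+ρ²))` as a function of `r`. -/
noncomputable def zonalArg (ρ : ℝ) (e r : EuclideanSpace ℝ (Fin N)) : ℝ :=
  -1 + 2 * ρ ^ 2 / (‖e‖ ^ 2 + ρ ^ 2) * ‖r - e‖ ^ 2 / (‖r‖ ^ 2 + ρ ^ 2)

theorem continuous_zonalArg {ρ : ℝ} (hρ : 0 < ρ) (e : EuclideanSpace ℝ (Fin N)) :
    Continuous (zonalArg ρ e) := by
  have h : ∀ r : EuclideanSpace ℝ (Fin N), ‖r‖ ^ 2 + ρ ^ 2 ≠ 0 := fun r => by positivity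
  have h1 : Continuous fun r : EuclideanSpace ℝ (Fin N) =>
    2 * ρ ^ 2 / (‖e‖ ^ 2 + ρ ^ 2) * ‖r - e‖ ^ 2 := by fun_prop
  have h2 : Continuous fun r : EuclideanSpace ℝ (Fin N) => ‖r‖ ^ 2 + ρ ^ 2 := by fun_prop
  exact continuous_const.add (h1.div h2 h)

theorem zonalArg_mem {ρ : ℝ} (hρ : 0 < ρ) (e r : EuclideanSpace ℝ (Fin N)) :
    zonalArg ρ e r ∈ Set.Icc (-1 : ℝ) 1 := zonalArg_mem_Icc hρ e r

variable {c : EuclideanSpace ℝ (Fin N)} {h : EuclideanSpace ℝ (Fin N) → ℂ} {ρ K₀ : ℝ} {lam : ℂ}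

theorem integrable_mul_zonal (hN : 2 ≤ N) (hρ : 0 < ρ)
    (hh : ContinuousOn h {c}ᶜ)
    (hin : ∀ δ : ℝ, 0 < δ → ∀ᶠ r in 𝓝[≠] c, ‖h r‖ ≤ δ * ((‖r - c‖ ^ (N - 2))⁻¹ *
      (if N = 2 then |Real.log ‖r - c‖| else 1)))
    (hout : ∀ᶠ r in Bornology.cobounded (EuclideanSpace ℝ (Fin N)),
      ‖h r‖ ≤ K₀ * (‖r - c‖ ^ (N - 2))⁻¹) (e : EuclideanSpace ℝ (Fin N)) {f : ℝ → ℂ}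
    (hf : Continuous f) : Integrable fun r => h r * ((zonalWeight N ρ r : ℂ) * f (zonalArg ρ e r)) := by
  obtain ⟨K, hK0, hK⟩ := exists_zonalWeight_le hN hρ c
  obtain ⟨M, hM⟩ := isCompact_Icc.exists_bound_of_continuousOn (s := Set.Icc (-1 : ℝ) 1)
    hf.continuousOn
  have hM0 : 0 ≤ M := (norm_nonneg _).trans (hM 0 (by norm_num))
  refine integrable_mul_of_growth (K := K * M) hN hh
    ((Complex.continuous_ofReal.comp (continuous_zonalWeight hρ)).mul
      (hf.comp (continuous_zonalArg hρ e)))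
    ((hin 1 one_pos).mono fun r hr => by rwa [one_mul] at hr) hout fun r => ?_
  rw [norm_mul, Complex.norm_real, Real.norm_of_nonneg (zonalWeight_pos hρ r).le]
  calc zonalWeight N ρ r * ‖f (zonalArg ρ e r)‖ ≤ K * ((1 + ‖r - c‖) ^ 3)⁻¹ * M :=
        mul_le_mul (hK r) (hM _ (zonalArg_mem hρ e r)) (norm_nonneg _) (by positivity)
    _ = K * M * ((1 + ‖r - c‖) ^ 3)⁻¹ := by ring

/-- All the moments `∫ h W x^d` vanish when `lam` avoids the spectrum. -/
theorem integral_mul_zonal_pow_eq_zero (hN : 2 ≤ N) (hρ : 0 < ρ)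
    (hlam : ∀ d : ℕ, lam - N * (N - 2) / 4 ≠ d * (d + N - 1))
    (hh : ContDiffOn ℝ 2 h {c}ᶜ)
    (heq : ∀ r, r ≠ c → Laplacian.laplacian h r +
      4 * lam * ρ ^ 2 / (((‖r‖ ^ 2 + ρ ^ 2) ^ 2 : ℝ) : ℂ) * h r = 0)
    (hin : ∀ δ : ℝ, 0 < δ → ∀ᶠ r in 𝓝[≠] c, ‖h r‖ ≤ δ * ((‖r - c‖ ^ (N - 2))⁻¹ *
      (if N = 2 then |Real.log ‖r - c‖| else 1)))
    (hout : ∀ᶠ r in Bornology.cobounded (EuclideanSpace ℝ (Fin N)),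
      ‖h r‖ ≤ K₀ * (‖r - c‖ ^ (N - 2))⁻¹) (e : EuclideanSpace ℝ (Fin N)) (d : ℕ) :
    ∫ r, h r * ((zonalWeight N ρ r : ℂ) * (zonalArg ρ e r : ℂ) ^ d) = 0 := by
  have hi : ∀ k : ℕ, Integrable fun r =>
      h r * ((zonalWeight N ρ r : ℂ) * (zonalArg ρ e r : ℂ) ^ k) := fun k =>
    integrable_mul_zonal hN hρ hh.continuousOn hin hout e
      (f := fun t => (t : ℂ) ^ k) (by fun_prop)
  induction d using Nat.strong_induction_on with
  | _ d ih =>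
  set κ := 2 * ρ ^ 2 / (‖e‖ ^ 2 + ρ ^ 2) with hκ
  let p : ℝ → ℂ := fun t => (t : ℂ) ^ d
  let p₁ : ℝ → ℂ := fun t => d * (t : ℂ) ^ (d - 1)
  let p₂ : ℝ → ℂ := fun t => d * ((d - 1 : ℕ) * (t : ℂ) ^ (d - 1 - 1))
  have hpow : ∀ (k : ℕ) (t : ℝ), HasDerivAt (fun t : ℝ => (t : ℂ) ^ k) (k * (t : ℂ) ^ (k - 1)) t :=
    fun k t => (hasDerivAt_pow k (t : ℂ)).comp_ofReal
  have hpc : ContDiff ℝ 2 p := Complex.ofRealCLM.contDiff.pow d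
  have hp : ∀ t, HasDerivAt p (p₁ t) t := hpow d
  have hp₁ : ∀ t, HasDerivAt p₁ (p₂ t) t := fun t => (hpow (d - 1) t).const_mul (d : ℂ)
  have habs : ∀ t ∈ Set.Icc (-1 : ℝ) 1, ∀ k : ℕ, ‖(t : ℂ) ^ k‖ ≤ 1 := fun t ht k => by
    rw [norm_pow, Complex.norm_real]
    exact pow_le_one₀ (norm_nonneg _) (abs_le.2 ht)
  obtain ⟨K, hK0, hK⟩ := exists_bound_conformalZonal hN hρ c e hκ hpc hp hp₁ (M := 1 + d)
    (fun t ht => (habs t ht d).trans (by simp))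
    (fun t ht => by
      rw [norm_mul, Complex.norm_natCast]
      calc (d : ℝ) * ‖(t : ℂ) ^ (d - 1)‖ ≤ d * 1 := by gcongr; exact habs t ht _
        _ ≤ 1 + d := by linarith)
  set ψ := conformalZonal ρ κ (1 - (N : ℝ) / 2) e p
  set μ : ℂ := lam - N * (N - 2) / 4 with hμ
  have hA0 : ∀ r : EuclideanSpace ℝ (Fin N), (0 : ℝ) < ‖r‖ ^ 2 + ρ ^ 2 := fun r => by positivity
  -- The operator is triangular: degree d couples only to d - 2, with diagonal entry μ - d(d+N-1).
  -- For d = 0, 1 the truncated exponent d - 2 is multiplied by zero.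
  have hLψ : ∀ r, Laplacian.laplacian ψ r +
      4 * lam * ρ ^ 2 / (((‖r‖ ^ 2 + ρ ^ 2) ^ 2 : ℝ) : ℂ) * ψ r =
      (zonalWeight N ρ r : ℂ) * ((d * (d - 1 : ℕ) : ℂ) * (zonalArg ρ e r : ℂ) ^ (d - 2) +
        (μ - d * (d + N - 1)) * (zonalArg ρ e r : ℂ) ^ d) := by
    intro r
    have e1 := laplacian_conformalZonal hρ e hκ rfl rfl (hpc.contDiffAt (x := zonalArg ρ e r))
      (Eventually.of_forall hp) (hp₁ (zonalArg ρ e r))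
    rw [e1]
    change _ + _ * ((((‖r‖ ^ 2 + ρ ^ 2) ^ (1 - (N : ℝ) / 2) : ℝ) : ℂ) * p (zonalArg ρ e r)) = _
    change _ * _ * ((1 - (zonalArg ρ e r : ℂ) ^ 2) * p₂ (zonalArg ρ e r) -
      N * (zonalArg ρ e r : ℂ) * p₁ (zonalArg ρ e r) -
      N * (N - 2) / 4 * p (zonalArg ρ e r)) + _ = _
    have hne : ((‖r‖ ^ 2 + ρ ^ 2 : ℝ) : ℂ) ≠ 0 := by exact_mod_cast (hA0 r).ne'
    simp only [p, p₁, p₂, zonalWeight, hμ]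
    generalize zonalArg ρ e r = t
    push_cast at hne ⊢
    generalize (((‖r‖ ^ 2 + ρ ^ 2) ^ (1 - (N : ℝ) / 2) : ℝ) : ℂ) = w
    rcases d with _ | _ | d
    · simp
      field_simp
      ring
    · simp
      field_simp
      ring
    · simp only [Nat.add_sub_cancel, show d + 1 + 1 - 2 = d by omega]
      push_cast
      field_simp
      ring
  obtain ⟨Kw, hKw0, hKw⟩ := exists_zonalWeight_le hN hρ c
  set K₂ : ℝ := d * d + ‖μ - d * (d + N - 1)‖ with hK₂
  have key := integral_mul_laplacian_add_eq_zero (K := K + Kw * K₂) (ψ := ψ) hN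
    (V := fun r => 4 * lam * ρ ^ 2 / (((‖r‖ ^ 2 + ρ ^ 2) ^ 2 : ℝ) : ℂ))
    (by
      refine continuous_const.div (Complex.continuous_ofReal.comp (by fun_prop)) fun r => ?_
      have := hA0 r
      exact_mod_cast (by positivity : (‖r‖ ^ 2 + ρ ^ 2) ^ 2 ≠ 0))
    hh heq hin hout
    (contDiff_iff_contDiffAt.2 fun r => contDiffAt_conformalZonal hρ κ _ e hpc.contDiffAt)
    (fun r => ((hK r).1).trans (by
      gcongr
      have : 0 ≤ Kw * K₂ := by positivity
      linarith))
    (fun r i => ((hK r).2 i).trans (by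
      gcongr
      have : 0 ≤ Kw * K₂ := by positivity
      linarith))
    (fun r => by
      rw [hLψ r, norm_mul, Complex.norm_real, Real.norm_of_nonneg (zonalWeight_pos hρ r).le]
      have hb : ‖(d * (d - 1 : ℕ) : ℂ) * (zonalArg ρ e r : ℂ) ^ (d - 2) +
        (μ - d * (d + N - 1)) * (zonalArg ρ e r : ℂ) ^ d‖ ≤ K₂ := by
        refine (norm_add_le _ _).trans ?_
        rw [norm_mul, norm_mul, norm_mul, Complex.norm_natCast, Complex.norm_natCast, hK₂]
        have hd : ((d - 1 : ℕ) : ℝ) ≤ d := by exact_mod_cast Nat.sub_le d 1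
        have a1 := habs _ (zonalArg_mem hρ e r) (d - 2)
        have a2 := habs _ (zonalArg_mem hρ e r) d
        refine add_le_add ?_ (mul_le_of_le_one_right (norm_nonneg _) a2)
        calc (d : ℝ) * ((d - 1 : ℕ) : ℝ) * ‖(zonalArg ρ e r : ℂ) ^ (d - 2)‖ ≤ d * d * 1 := by gcongr
          _ = d * d := mul_one _
      calc zonalWeight N ρ r * _ ≤ Kw * ((1 + ‖r - c‖) ^ 3)⁻¹ * K₂ :=
            mul_le_mul (hKw r) hb (norm_nonneg _) (by positivity)
        _ = Kw * K₂ * ((1 + ‖r - c‖) ^ 3)⁻¹ := by ring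
        _ ≤ _ := by gcongr; linarith)
  have hsplit : ∀ r, h r * (Laplacian.laplacian ψ r +
      4 * lam * ρ ^ 2 / (((‖r‖ ^ 2 + ρ ^ 2) ^ 2 : ℝ) : ℂ) * ψ r) =
      (d * (d - 1 : ℕ) : ℂ) * (h r * ((zonalWeight N ρ r : ℂ) * (zonalArg ρ e r : ℂ) ^ (d - 2))) +
      (μ - d * (d + N - 1)) * (h r * ((zonalWeight N ρ r : ℂ) * (zonalArg ρ e r : ℂ) ^ d)) := by
    intro r
    rw [hLψ r]
    ring
  simp only [hsplit] at key
  rw [integral_add ((hi (d - 2)).const_mul _) ((hi d).const_mul _), integral_const_mul,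
    integral_const_mul] at key
  have hlow : (d * (d - 1 : ℕ) : ℂ) *
      ∫ r, h r * ((zonalWeight N ρ r : ℂ) * (zonalArg ρ e r : ℂ) ^ (d - 2)) = 0 := by
    rcases d with _ | _ | d
    · simp
    · simp
    · rw [ih (d + 1 + 1 - 2) (by omega), mul_zero]
  rw [hlow, zero_add] at key
  exact (mul_eq_zero.1 key).resolve_left (sub_ne_zero.2 (hlam d))

/-- Weierstrass approximation: the zonal argument stays in [-1, 1] and h times the weight is
integrable, so uniform approximation of f by polynomials passes to the integral. -/
theorem integral_mul_zonal_eq_zero (hN : 2 ≤ N) (hρ : 0 < ρ)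
    (hlam : ∀ d : ℕ, lam - N * (N - 2) / 4 ≠ d * (d + N - 1))
    (hh : ContDiffOn ℝ 2 h {c}ᶜ)
    (heq : ∀ r, r ≠ c → Laplacian.laplacian h r +
      4 * lam * ρ ^ 2 / (((‖r‖ ^ 2 + ρ ^ 2) ^ 2 : ℝ) : ℂ) * h r = 0)
    (hin : ∀ δ : ℝ, 0 < δ → ∀ᶠ r in 𝓝[≠] c, ‖h r‖ ≤ δ * ((‖r - c‖ ^ (N - 2))⁻¹ *
      (if N = 2 then |Real.log ‖r - c‖| else 1)))
    (hout : ∀ᶠ r in Bornology.cobounded (EuclideanSpace ℝ (Fin N)),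
      ‖h r‖ ≤ K₀ * (‖r - c‖ ^ (N - 2))⁻¹) (e : EuclideanSpace ℝ (Fin N))
    {f : ℝ → ℝ} (hf : Continuous f) :
    ∫ r, h r * ((zonalWeight N ρ r : ℂ) * ((f (zonalArg ρ e r) : ℝ) : ℂ)) = 0 := by
  have hi : ∀ g : ℝ → ℝ, Continuous g → Integrable fun r =>
      h r * ((zonalWeight N ρ r : ℂ) * ((g (zonalArg ρ e r) : ℝ) : ℂ)) := fun g hg =>
    integrable_mul_zonal hN hρ hh.continuousOn hin hout e
      (f := fun t => ((g t : ℝ) : ℂ)) (Complex.continuous_ofReal.comp hg)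
  have hpoly : ∀ p : Polynomial ℝ,
      ∫ r, h r * ((zonalWeight N ρ r : ℂ) * ((p.eval (zonalArg ρ e r) : ℝ) : ℂ)) = 0 := by
    intro p
    have h1 : ∀ r, h r * ((zonalWeight N ρ r : ℂ) * ((p.eval (zonalArg ρ e r) : ℝ) : ℂ)) =
        ∑ i ∈ Finset.range (p.natDegree + 1), (p.coeff i : ℂ) *
          (h r * ((zonalWeight N ρ r : ℂ) * (zonalArg ρ e r : ℂ) ^ i)) := by
      intro r
      rw [Polynomial.eval_eq_sum_range]
      push_cast
      rw [Finset.mul_sum, Finset.mul_sum]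
      exact Finset.sum_congr rfl fun i _ => by ring
    simp only [h1]
    rw [integral_finsetSum]
    · refine Finset.sum_eq_zero fun i _ => ?_
      rw [integral_const_mul,
        integral_mul_zonal_pow_eq_zero hN hρ hlam hh heq hin hout e i, mul_zero]
    · intro i _
      refine Integrable.const_mul ?_ _
      have := hi (fun t => t ^ i) (by fun_prop)
      simpa using this
  have hI1 := hi (fun _ => 1) continuous_const
  set I := ∫ r, ‖h r * ((zonalWeight N ρ r : ℂ) * (((1 : ℝ)) : ℂ))‖ with hI
  have hI0 : 0 ≤ I := integral_nonneg fun r => norm_nonneg _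
  refine norm_eq_zero.1 (le_antisymm (le_of_forall_pos_le_add fun ε hε => ?_) (norm_nonneg _))
  obtain ⟨p, hp⟩ := exists_polynomial_near_of_continuousOn (-1) 1 f hf.continuousOn
    (ε / (I + 1)) (by positivity)
  have hdiff : ∫ r, h r * ((zonalWeight N ρ r : ℂ) * ((f (zonalArg ρ e r) : ℝ) : ℂ)) =
      ∫ r, h r * ((zonalWeight N ρ r : ℂ) *
        ((f (zonalArg ρ e r) - p.eval (zonalArg ρ e r) : ℝ) : ℂ)) := by
    rw [← sub_zero (∫ r, h r * ((zonalWeight N ρ r : ℂ) * ((f (zonalArg ρ e r) : ℝ) : ℂ))),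
      ← hpoly p, ← integral_sub (hi f hf) (hi _ p.continuous)]
    refine integral_congr_ae (Eventually.of_forall fun r => ?_)
    push_cast
    ring
  rw [hdiff, zero_add]
  refine (norm_integral_le_of_norm_le (hI1.norm.const_mul (ε / (I + 1)))
    (Eventually.of_forall fun r => ?_)).trans ?_
  · rw [norm_mul, norm_mul, norm_mul, norm_mul, Complex.norm_real, Complex.norm_real,
      Complex.norm_real, norm_one, mul_one]
    have h1 := (hp _ (zonalArg_mem hρ e r)).le
    rw [abs_sub_comm, ← Real.norm_eq_abs] at h1
    calc ‖h r‖ * (‖zonalWeight N ρ r‖ * ‖f (zonalArg ρ e r) - p.eval (zonalArg ρ e r)‖)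
        ≤ ‖h r‖ * (‖zonalWeight N ρ r‖ * (ε / (I + 1))) := by gcongr
      _ = _ := by ring
  · rw [integral_const_mul, ← hI, div_mul_eq_mul_div, div_le_iff₀ (by positivity)]
    nlinarith

/-- Uniqueness: a solution off a point with the growth of a difference of two Green's functions
vanishes. -/
theorem eq_zero_of_growth (hN : 2 ≤ N) (hρ : 0 < ρ)
    (hlam : ∀ d : ℕ, lam - N * (N - 2) / 4 ≠ d * (d + N - 1))
    (hh : ContDiffOn ℝ 2 h {c}ᶜ)
    (heq : ∀ r, r ≠ c → Laplacian.laplacian h r +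
      4 * lam * ρ ^ 2 / (((‖r‖ ^ 2 + ρ ^ 2) ^ 2 : ℝ) : ℂ) * h r = 0)
    (hin : ∀ δ : ℝ, 0 < δ → ∀ᶠ r in 𝓝[≠] c, ‖h r‖ ≤ δ * ((‖r - c‖ ^ (N - 2))⁻¹ *
      (if N = 2 then |Real.log ‖r - c‖| else 1)))
    (hout : ∀ᶠ r in Bornology.cobounded (EuclideanSpace ℝ (Fin N)),
      ‖h r‖ ≤ K₀ * (‖r - c‖ ^ (N - 2))⁻¹) {e : EuclideanSpace ℝ (Fin N)} (he : e ≠ c) :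
    h e = 0 := by
  by_contra hne
  have hcont : ContinuousAt h e :=
    hh.continuousOn.continuousAt (isOpen_compl_singleton.mem_nhds he)
  have hpos : ∀ᶠ r in 𝓝 e, 0 < (starRingEnd ℂ (h e) * h r).re := by
    have h1 : ContinuousAt (fun r => (starRingEnd ℂ (h e) * h r).re) e :=
      Complex.continuous_re.continuousAt.comp (continuousAt_const.mul hcont)
    refine h1.eventually (lt_mem_nhds ?_)
    beta_reduce
    rw [mul_comm, Complex.mul_conj]
    simpa using Complex.normSq_pos.2 hne
  obtain ⟨δ, hδ, hball⟩ := Metric.eventually_nhds_iff_ball.1 hpos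
  set κ := 2 * ρ ^ 2 / (‖e‖ ^ 2 + ρ ^ 2) with hκ
  have hκ0 : 0 < κ := by positivity
  -- If |r-e| ≥ δ then |r|² + ρ² ≤ 2|r-e|² + 2|e|² + ρ² ≤ T|r-e|². So the zonal argument stays at
  -- least κ/T above -1 outside the ball, uniformly up to infinity.
  set T := 2 + (2 * ‖e‖ ^ 2 + ρ ^ 2) / δ ^ 2 with hT
  have hT0 : 0 < T := by positivity
  set η := κ / T with hη
  have hη0 : 0 < η := by positivity
  have hclose : ∀ r, 1 + zonalArg ρ e r < η → r ∈ Metric.ball e δ := by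
    intro r hr
    rw [Metric.mem_ball, dist_eq_norm]
    by_contra hge
    rw [not_lt] at hge
    have hA0 : 0 < ‖r‖ ^ 2 + ρ ^ 2 := by positivity
    have hq : δ ^ 2 ≤ ‖r - e‖ ^ 2 := by gcongr
    have hq0 : 0 < ‖r - e‖ ^ 2 := lt_of_lt_of_le (by positivity) hq
    have h1 : ‖r‖ ^ 2 + ρ ^ 2 ≤ T * ‖r - e‖ ^ 2 := by
      have h2 : ‖r‖ ≤ ‖r - e‖ + ‖e‖ := by
        simpa using norm_add_le (r - e) e
      have h3 : ‖r‖ ^ 2 ≤ (‖r - e‖ + ‖e‖) ^ 2 := by gcongr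
      have h4 : (2 * ‖e‖ ^ 2 + ρ ^ 2) ≤ (2 * ‖e‖ ^ 2 + ρ ^ 2) / δ ^ 2 * ‖r - e‖ ^ 2 := by
        rw [div_mul_eq_mul_div, le_div_iff₀ (by positivity)]
        gcongr
      rw [hT, add_mul]
      nlinarith [sq_nonneg (‖r - e‖ - ‖e‖)]
    have h5 : η ≤ κ * ‖r - e‖ ^ 2 / (‖r‖ ^ 2 + ρ ^ 2) := by
      rw [hη, div_le_div_iff₀ hT0 hA0]
      calc κ * (‖r‖ ^ 2 + ρ ^ 2) ≤ κ * (T * ‖r - e‖ ^ 2) := by gcongr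
        _ = κ * ‖r - e‖ ^ 2 * T := by ring
    have h6 : 1 + zonalArg ρ e r = κ * ‖r - e‖ ^ 2 / (‖r‖ ^ 2 + ρ ^ 2) := by
      rw [zonalArg, ← hκ]; ring
    linarith
  -- Positive exactly for 1 + t < η, hence supported where h has positive component along h(e); the
  -- vanishing integral then contradicts positivity.
  let f : ℝ → ℝ := fun t => max 0 (η - (1 + t))
  have hf : Continuous f := by fun_prop
  have hzero := integral_mul_zonal_eq_zero hN hρ hlam hh heq hin hout e hf
  have hint : Integrable fun r =>
      h r * ((zonalWeight N ρ r : ℂ) * ((f (zonalArg ρ e r) : ℝ) : ℂ)) :=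
    integrable_mul_zonal hN hρ hh.continuousOn hin hout e
      (f := fun t => ((f t : ℝ) : ℂ)) (Complex.continuous_ofReal.comp hf)
  have hint2 := hint.const_mul (starRingEnd ℂ (h e))
  set g : EuclideanSpace ℝ (Fin N) → ℝ := fun r =>
    (starRingEnd ℂ (h e) * h r).re * (zonalWeight N ρ r * f (zonalArg ρ e r)) with hg
  have hgre : ∀ r, RCLike.re (starRingEnd ℂ (h e) *
      (h r * ((zonalWeight N ρ r : ℂ) * ((f (zonalArg ρ e r) : ℝ) : ℂ)))) = g r := by
    intro r
    rw [← mul_assoc, ← Complex.ofReal_mul]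
    exact Complex.re_mul_ofReal _ _
  have hgi : Integrable g := hint2.re.congr (Eventually.of_forall hgre)
  have hg0 : ∫ r, g r = 0 := by
    have h1 := integral_re hint2
    rw [integral_const_mul, hzero, mul_zero] at h1
    simpa only [hgre, map_zero] using h1
  have hfpos : ∀ r, 1 + zonalArg ρ e r < η → 0 < f (zonalArg ρ e r) := fun r hr =>
    lt_max_of_lt_right (by linarith)
  have hgnn : ∀ r, 0 ≤ g r := by
    intro r
    by_cases hr : 1 + zonalArg ρ e r < η
    · exact mul_nonneg (hball r (hclose r hr)).le
        (mul_nonneg (zonalWeight_pos hρ r).le (hfpos r hr).le)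
    · have : f (zonalArg ρ e r) = 0 := max_eq_left (by linarith)
      simp [hg, this]
  have hae := (integral_eq_zero_iff_of_nonneg hgnn hgi).1 hg0
  have hopen : IsOpen {r | 1 + zonalArg ρ e r < η} :=
    isOpen_lt (continuous_const.add (continuous_zonalArg hρ e)) continuous_const
  have hmem : e ∈ {r | 1 + zonalArg ρ e r < η} := by
    simpa [zonalArg] using hη0
  have hmeas := hopen.measure_pos volume ⟨e, hmem⟩
  refine hmeas.ne' (measure_mono_null (fun r hr => ?_) (ae_iff.1 hae))
  have : 0 < g r := mul_pos (hball r (hclose r hr)) (mul_pos (zonalWeight_pos hρ r) (hfpos r hr))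
  exact this.ne'

end Uniqueness

/-! ### The explicit solution and its Euler transform. -/

section Closed

variable {N : ℕ}

/-- The closed form of the Green's function, written with the conformal weight. -/
noncomputable def fishEyeGreen (ρ : ℝ) (ν : ℂ) (r r' : EuclideanSpace ℝ (Fin N)) : ℂ :=
  greenPrefactor N ν / Complex.Gamma ((N : ℂ) / 2) *
    ((ρ ^ (N - 2) * (‖r'‖ ^ 2 + ρ ^ 2) ^ (1 - (N : ℝ) / 2) : ℝ) : ℂ) *
    conformalZonal ρ (2 * ρ ^ 2 / (‖r'‖ ^ 2 + ρ ^ 2)) (1 - (N : ℝ) / 2) r'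
      (fun t => ordinaryHypergeometric ((N : ℂ) / 2 - 1 - ν) ((N : ℂ) / 2 + ν) ((N : ℂ) / 2)
        ((1 - (t : ℂ)) / 2)) r

theorem half_dim_ne_neg_nat (hN : 2 ≤ N) (k : ℕ) : (N : ℂ) / 2 ≠ -k := by
  intro h
  have h1 : (N : ℝ) / 2 = -(k : ℝ) := Complex.ofReal_injective (by push_cast; exact h)
  have h2 : (2 : ℝ) ≤ N := by exact_mod_cast hN
  have h3 : (0 : ℝ) ≤ k := k.cast_nonneg
  linarith

theorem fishEyeArg_eq_zonalArg {ρ : ℝ} (hρ : 0 < ρ) (r r' : EuclideanSpace ℝ (Fin N)) :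
    fishEyeArg ρ r r' = zonalArg ρ r' r := by
  have h1 : ‖r‖ ^ 2 + ρ ^ 2 ≠ 0 := by positivity
  have h2 : ‖r'‖ ^ 2 + ρ ^ 2 ≠ 0 := by positivity
  unfold fishEyeArg zonalArg
  field_simp

theorem fishEyeArg_comm (ρ : ℝ) (r r' : EuclideanSpace ℝ (Fin N)) :
    fishEyeArg ρ r r' = fishEyeArg ρ r' r := by
  unfold fishEyeArg
  rw [norm_sub_rev, mul_comm (‖r‖ ^ 2 + ρ ^ 2)]

theorem one_sub_half_one_sub_fishEyeArg (ρ : ℝ) (r r' : EuclideanSpace ℝ (Fin N)) :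
    1 - (1 - fishEyeArg ρ r r') / 2 =
      ρ ^ 2 * ‖r - r'‖ ^ 2 / ((‖r‖ ^ 2 + ρ ^ 2) * (‖r'‖ ^ 2 + ρ ^ 2)) := by
  unfold fishEyeArg
  ring

theorem half_one_sub_fishEyeArg {ρ : ℝ} (hρ : 0 < ρ) (r r' : EuclideanSpace ℝ (Fin N)) :
    (1 - fishEyeArg ρ r r') / 2 =
      (‖r‖ ^ 2 * ‖r'‖ ^ 2 + 2 * ρ ^ 2 * inner ℝ r r' + ρ ^ 4) /
        ((‖r‖ ^ 2 + ρ ^ 2) * (‖r'‖ ^ 2 + ρ ^ 2)) := by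
  have h1 : ‖r‖ ^ 2 + ρ ^ 2 ≠ 0 := by positivity
  have h2 : ‖r'‖ ^ 2 + ρ ^ 2 ≠ 0 := by positivity
  unfold fishEyeArg
  rw [norm_sub_sq_real]
  field_simp
  ring

theorem half_one_sub_fishEyeArg_mem {ρ : ℝ} (hρ : 0 < ρ) {r r' : EuclideanSpace ℝ (Fin N)}
    (hr : r ≠ r') : 0 ≤ (1 - fishEyeArg ρ r r') / 2 ∧ (1 - fishEyeArg ρ r r') / 2 < 1 := by
  have h := (zonalArg_mem hρ r' r).2
  rw [← fishEyeArg_eq_zonalArg hρ] at h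
  have h1 := one_sub_half_one_sub_fishEyeArg ρ r r'
  have hs : 0 < ‖r - r'‖ := norm_pos_iff.2 (sub_ne_zero.2 hr)
  have h2 : 0 < ρ ^ 2 * ‖r - r'‖ ^ 2 / ((‖r‖ ^ 2 + ρ ^ 2) * (‖r'‖ ^ 2 + ρ ^ 2)) := by positivity
  constructor <;> linarith

/-- With z = (1-x)/2, the power (1-z)^(N/2-1) carries exactly both conformal weights and
|r-r'|^(N-2); this lets the weights be exchanged for the distance to the source. -/
theorem rpow_one_sub_half_one_sub_fishEyeArg (hN : 2 ≤ N) {ρ : ℝ} (hρ : 0 < ρ)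
    (r r' : EuclideanSpace ℝ (Fin N)) :
    (1 - (1 - fishEyeArg ρ r r') / 2) ^ ((N : ℝ) / 2 - 1) =
      ρ ^ (N - 2) * (‖r'‖ ^ 2 + ρ ^ 2) ^ (1 - (N : ℝ) / 2) *
        (‖r‖ ^ 2 + ρ ^ 2) ^ (1 - (N : ℝ) / 2) * ‖r - r'‖ ^ (N - 2) := by
  have h1 : 0 < ‖r‖ ^ 2 + ρ ^ 2 := by positivity
  have h2 : 0 < ‖r'‖ ^ 2 + ρ ^ 2 := by positivity
  have hp : ∀ x : ℝ, 0 ≤ x → (x ^ 2) ^ ((N : ℝ) / 2 - 1) = x ^ (N - 2) := by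
    intro x hx
    rw [← Real.rpow_natCast, ← Real.rpow_mul hx, ← Real.rpow_natCast, Nat.cast_sub hN]
    congr 1
    push_cast
    ring
  rw [one_sub_half_one_sub_fishEyeArg, Real.div_rpow (by positivity) (by positivity),
    Real.mul_rpow (by positivity) (by positivity), Real.mul_rpow h1.le h2.le, hp _ hρ.le,
    hp _ (norm_nonneg _), show 1 - (N : ℝ) / 2 = -((N : ℝ) / 2 - 1) by ring,
    Real.rpow_neg h1.le, Real.rpow_neg h2.le]
  field_simp

theorem fishEyeGreen_eq {ρ : ℝ} (hρ : 0 < ρ) (ν : ℂ) (r r' : EuclideanSpace ℝ (Fin N)) :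
    fishEyeGreen ρ ν r r' = greenPrefactor N ν / Complex.Gamma ((N : ℂ) / 2) *
      ((ρ ^ (N - 2) * (‖r'‖ ^ 2 + ρ ^ 2) ^ (1 - (N : ℝ) / 2) *
        (‖r‖ ^ 2 + ρ ^ 2) ^ (1 - (N : ℝ) / 2) : ℝ) : ℂ) *
      ordinaryHypergeometric ((N : ℂ) / 2 - 1 - ν) ((N : ℂ) / 2 + ν) ((N : ℂ) / 2)
        ((((1 - fishEyeArg ρ r r') / 2 : ℝ)) : ℂ) := by
  have h := fishEyeArg_eq_zonalArg hρ r r'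
  rw [zonalArg] at h
  unfold fishEyeGreen conformalZonal
  rw [← h]
  push_cast
  ring

theorem fishEyeGreen_eq_mul_div {ρ : ℝ} (hN : 2 ≤ N) (hρ : 0 < ρ) (ν : ℂ)
    {r r' : EuclideanSpace ℝ (Fin N)} (hr : r ≠ r') :
    fishEyeGreen ρ ν r r' = greenPrefactor N ν / Complex.Gamma ((N : ℂ) / 2) *
      (ordinaryHypergeometric ((N : ℂ) / 2 - 1 - ν) ((N : ℂ) / 2 + ν) ((N : ℂ) / 2)
        ((((1 - fishEyeArg ρ r r') / 2 : ℝ)) : ℂ) *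
        (((1 - (1 - fishEyeArg ρ r r') / 2) ^ ((N : ℝ) / 2 - 1) : ℝ) : ℂ)) /
        ((‖r - r'‖ ^ (N - 2) : ℝ) : ℂ) := by
  have hs : (‖r - r'‖ : ℂ) ≠ 0 := by
    exact_mod_cast norm_ne_zero_iff.2 (sub_ne_zero.2 hr)
  rw [fishEyeGreen_eq hρ, rpow_one_sub_half_one_sub_fishEyeArg hN hρ]
  push_cast
  field_simp

/-- Euler's transformation with c - a - b = 1 - N/2. The result is visibly symmetric and suited to
the limit at infinity. -/
theorem fishEyeGreen_eq_div {ρ : ℝ} (hN : 2 ≤ N) (hρ : 0 < ρ) (ν : ℂ)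
    {r r' : EuclideanSpace ℝ (Fin N)} (hr : r ≠ r') :
    fishEyeGreen ρ ν r r' = greenPrefactor N ν / Complex.Gamma ((N : ℂ) / 2) *
      ordinaryHypergeometric (-ν) (ν + 1) ((N : ℂ) / 2)
        ((((1 - fishEyeArg ρ r r') / 2 : ℝ)) : ℂ) / ((‖r - r'‖ ^ (N - 2) : ℝ) : ℂ) := by
  obtain ⟨hz0, hz1⟩ := half_one_sub_fishEyeArg_mem hρ hr
  rw [fishEyeGreen_eq_mul_div hN hρ ν hr]
  congr 2
  rw [ordinaryHypergeometric_ofReal_eq_rpow_mul (half_dim_ne_neg_nat hN)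
    (t := -((N : ℝ) / 2 - 1)) (by push_cast; ring) hz0 hz1,
    show (N : ℂ) / 2 - ((N : ℂ) / 2 - 1 - ν) = ν + 1 by ring,
    show (N : ℂ) / 2 - ((N : ℂ) / 2 + ν) = -ν by ring, Real.rpow_neg (by linarith)]
  have hne : (((1 - (1 - fishEyeArg ρ r r') / 2) ^ ((N : ℝ) / 2 - 1) : ℝ) : ℂ) ≠ 0 := by
    have : 0 < 1 - (1 - fishEyeArg ρ r r') / 2 := by linarith
    exact_mod_cast (Real.rpow_pos_of_pos this _).ne'
  have hsymm : ∀ z : ℂ, ordinaryHypergeometric (ν + 1) (-ν) ((N : ℂ) / 2) z =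
      ordinaryHypergeometric (-ν) (ν + 1) ((N : ℂ) / 2) z := fun z => by
    unfold ordinaryHypergeometric
    rw [ordinaryHypergeometricSeries_symm]
  rw [hsymm, Complex.ofReal_inv, mul_right_comm, inv_mul_cancel₀ hne, one_mul]

end Closed

/-! ### The explicit solution satisfies the equation. -/

section Existence

variable {N : ℕ}

theorem fishEyeIndex_mul {n₀ k : ℂ} {ρ : ℝ} {ν : ℂ} (hν : IsFishEyeIndex n₀ k ρ ν) :
    n₀ ^ 2 * k ^ 2 * (ρ : ℂ) ^ 2 = ν * (ν + 1) := by
  obtain ⟨s, hs, rfl⟩ := hν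
  linear_combination (-1 / 4) * hs

/-- Under z = (1-x)/2 the zonal equation becomes Gauss's equation, because a + b + 1 = N, c = N/2
and ab = N(N-2)/4 - ν(ν+1). Away from the source z < 1, so the function is analytic there, the
antipode z = 0 included. -/
theorem contDiffAt_fishEyeGreen (hN : 2 ≤ N) {ρ : ℝ} (hρ : 0 < ρ) (ν : ℂ)
    {r r' : EuclideanSpace ℝ (Fin N)} (hr : r ≠ r') {n₀ k : ℂ} (hν : IsFishEyeIndex n₀ k ρ ν) :
    ContDiffAt ℝ 2 (fun r => fishEyeGreen ρ ν r r') r ∧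
    Laplacian.laplacian (fun r => fishEyeGreen ρ ν r r') r +
      4 * n₀ ^ 2 * k ^ 2 * (ρ : ℂ) ^ 4 / (((‖r‖ ^ 2 + ρ ^ 2) ^ 2 : ℝ) : ℂ) *
        fishEyeGreen ρ ν r r' = 0 := by
  set a := (N : ℂ) / 2 - 1 - ν with ha
  set b := (N : ℂ) / 2 + ν with hb
  obtain ⟨F₁, F₂, hF⟩ :=
    exists_hasDerivAt_ordinaryHypergeometric a b (half_dim_ne_neg_nat hN)
  set F : ℂ → ℂ := ordinaryHypergeometric a b ((N : ℂ) / 2)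
  obtain ⟨hz0, hz1⟩ := half_one_sub_fishEyeArg_mem hρ hr
  set ξ := zonalArg ρ r' r with hξ
  rw [fishEyeArg_eq_zonalArg hρ, ← hξ] at hz0 hz1
  have hball : ‖(1 - (ξ : ℂ)) / 2‖ < 1 := by
    have : (1 - (ξ : ℂ)) / 2 = (((1 - ξ) / 2 : ℝ) : ℂ) := by push_cast; ring
    rw [this, Complex.norm_real, Real.norm_of_nonneg hz0]
    exact hz1
  have hev : ∀ᶠ t : ℝ in 𝓝 ξ, ‖(1 - (t : ℂ)) / 2‖ < 1 := by
    have hc : Continuous fun t : ℝ => ‖(1 - (t : ℂ)) / 2‖ := by fun_prop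
    exact hc.continuousAt.eventually (gt_mem_nhds hball)
  have hlin : ∀ t : ℂ, HasDerivAt (fun t : ℂ => (1 - t) / 2) (-1 / 2) t := fun t =>
    ((hasDerivAt_id t).const_sub 1).div_const 2
  let p : ℝ → ℂ := fun t => F ((1 - (t : ℂ)) / 2)
  let p₁ : ℝ → ℂ := fun t => F₁ ((1 - (t : ℂ)) / 2) * (-1 / 2)
  have hp : ∀ᶠ t in 𝓝 ξ, HasDerivAt p (p₁ t) t := by
    filter_upwards [hev] with t ht
    exact ((hF _ ht).1.comp (t : ℂ) (hlin t)).comp_ofReal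
  have hp₁ : HasDerivAt p₁ (F₂ ((1 - (ξ : ℂ)) / 2) * (-1 / 2) * (-1 / 2)) ξ :=
    (((hF _ hball).2.1.comp (ξ : ℂ) (hlin ξ)).mul_const (-1 / 2)).comp_ofReal
  have hpc : ContDiffAt ℝ 2 p ξ := by
    have hd : DifferentiableOn ℂ F (Metric.ball 0 1) := fun z hz =>
      (hF z (by simpa using hz)).1.differentiableAt.differentiableWithinAt
    have han : AnalyticAt ℂ F ((1 - (ξ : ℂ)) / 2) :=
      hd.analyticAt (Metric.isOpen_ball.mem_nhds (by simpa using hball))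
    have h1 : ContDiffAt ℝ 2 F ((1 - (ξ : ℂ)) / 2) := (han.contDiffAt (n := 2)).restrict_scalars ℝ
    have h2 : ContDiffAt ℝ 2 (fun t : ℝ => (1 - (t : ℂ)) / 2) ξ :=
      (contDiffAt_const.sub Complex.ofRealCLM.contDiff.contDiffAt).div_const 2
    exact h1.comp ξ h2
  set C : ℂ := greenPrefactor N ν / Complex.Gamma ((N : ℂ) / 2) *
    ((ρ ^ (N - 2) * (‖r'‖ ^ 2 + ρ ^ 2) ^ (1 - (N : ℝ) / 2) : ℝ) : ℂ)
  set Z := conformalZonal ρ (2 * ρ ^ 2 / (‖r'‖ ^ 2 + ρ ^ 2)) (1 - (N : ℝ) / 2) r' p with hZ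
  have hG : (fun r => fishEyeGreen ρ ν r r') = C • Z := rfl
  have hZc : ContDiffAt ℝ 2 Z r := contDiffAt_conformalZonal hρ _ _ r' hpc
  refine ⟨by rw [hG]; exact contDiffAt_const.mul hZc, ?_⟩
  have hlap : Laplacian.laplacian (C • Z) r = C * Laplacian.laplacian Z r := by
    rw [show C • Z = fun y => (fun _ => C) y * Z y from rfl, laplacian_mul contDiffAt_const hZc]
    simp
  have hlapZ := laplacian_conformalZonal hρ r' rfl rfl hξ hpc hp hp₁
  have hGr : fishEyeGreen ρ ν r r' = C * Z r := rfl
  have hZr : Z r = (((‖r‖ ^ 2 + ρ ^ 2) ^ (1 - (N : ℝ) / 2) : ℝ) : ℂ) * p ξ := rfl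
  rw [hG, hlap, hGr, hlapZ, hZr]
  have hode := (hF _ hball).2.2
  have hidx := fishEyeIndex_mul hν
  have hA : ((‖r‖ ^ 2 + ρ ^ 2 : ℝ) : ℂ) ≠ 0 := by
    have : 0 < ‖r‖ ^ 2 + ρ ^ 2 := by positivity
    exact_mod_cast this.ne'
  simp only [p, p₁]
  have h4 : 4 * n₀ ^ 2 * k ^ 2 * (ρ : ℂ) ^ 4 = 4 * (ν * (ν + 1)) * (ρ : ℂ) ^ 2 := by
    rw [← hidx]; ring
  rw [h4]
  set f0 := F ((1 - (ξ : ℂ)) / 2)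
  generalize F₁ ((1 - (ξ : ℂ)) / 2) = f1 at hode ⊢
  generalize F₂ ((1 - (ξ : ℂ)) / 2) = f2 at hode ⊢
  generalize (((‖r‖ ^ 2 + ρ ^ 2) ^ (1 - (N : ℝ) / 2) : ℝ) : ℂ) = w
  rw [Complex.ofReal_pow]
  generalize ((‖r‖ ^ 2 + ρ ^ 2 : ℝ) : ℂ) = A at hA ⊢
  rw [ha, hb] at hode
  field_simp
  linear_combination (4 : ℂ) * C * w * ρ ^ 2 * 4 * hode

end Existence

/-! ### Singularity at the source and limit at infinity. -/

section Existence

variable {N : ℕ}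

/-- Exceptional indices are at once the poles of the two Gamma factors and the resonances, through
the factorization (ν - (d+N/2-1))(ν + d + N/2). -/
theorem exceptional_ne {N : ℕ} {ν : ℂ} (hex : ¬ IsExceptionalIndex N ν) :
    (∀ k : ℕ, (N : ℂ) / 2 - 1 - ν ≠ -k) ∧ (∀ k : ℕ, (N : ℂ) / 2 + ν ≠ -k) ∧
    ∀ d : ℕ, ν * (ν + 1) - N * (N - 2) / 4 ≠ d * (d + N - 1) := by
  unfold IsExceptionalIndex at hex
  push Not at hex
  refine ⟨fun k h => (hex k).1 (by linear_combination -h),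
    fun k h => (hex k).2 (by linear_combination h), fun d h => ?_⟩
  have : (ν - (d + N / 2 - 1)) * (ν - (-d - N / 2)) = 0 := by linear_combination h
  rcases mul_eq_zero.1 this with h | h
  · exact (hex d).1 (sub_eq_zero.1 h)
  · exact (hex d).2 (sub_eq_zero.1 h)

theorem continuous_fishEyeArg {ρ : ℝ} (hρ : 0 < ρ) (r' : EuclideanSpace ℝ (Fin N)) :
    Continuous fun r => fishEyeArg ρ r r' := by
  simp only [fishEyeArg_eq_zonalArg hρ]
  exact continuous_zonalArg hρ r'

theorem tendsto_half_one_sub_fishEyeArg {ρ : ℝ} (hρ : 0 < ρ) (r' : EuclideanSpace ℝ (Fin N)) :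
    Tendsto (fun r => (1 - fishEyeArg ρ r r') / 2) (𝓝[≠] r') (𝓝[<] 1) := by
  refine tendsto_nhdsWithin_of_tendsto_nhds_of_eventually_within _ ?_ ?_
  · have h1 : Continuous fun r => (1 - fishEyeArg ρ r r') / 2 :=
      (continuous_const.sub (continuous_fishEyeArg hρ r')).div_const 2
    have h2 := h1.tendsto r'
    have h3 : (1 - fishEyeArg ρ r' r') / 2 = 1 := by simp [fishEyeArg]
    rw [h3] at h2
    exact h2.mono_left nhdsWithin_le_nhds
  · filter_upwards [self_mem_nhdsWithin] with r hr
    exact (half_one_sub_fishEyeArg_mem hρ hr).2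

theorem unitSphereArea_pos (hN : 0 < N) : 0 < unitSphereArea N := by
  have := Real.Gamma_pos_of_pos (by positivity : 0 < (N : ℝ) / 2)
  unfold unitSphereArea
  positivity

/-- The connection constant Γ(c)Γ(c')/(Γ(a)Γ(b)), c' = N/2 - 1, cancels the Gamma factors of the
prefactor, leaving -Γ(N/2-1)/(4π^(N/2)) = -1/((N-2) S). -/
theorem fishEyeGreen_isEquivalent_of_three_le (hN : 3 ≤ N) {ρ : ℝ} (hρ : 0 < ρ) {ν : ℂ}
    (hex : ¬ IsExceptionalIndex N ν) (r' : EuclideanSpace ℝ (Fin N)) :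
    (fun r => fishEyeGreen ρ ν r r') ~[𝓝[≠] r'] fun r =>
      ((-(1 / (((N : ℝ) - 2) * unitSphereArea N * ‖r - r'‖ ^ (N - 2))) : ℝ) : ℂ) := by
  have hN2 : 2 ≤ N := by omega
  have hN3 : (3 : ℝ) ≤ N := by exact_mod_cast hN
  obtain ⟨ha, hb, -⟩ := exceptional_ne hex
  have hc := half_dim_ne_neg_nat hN2
  set s : ℝ := (N : ℝ) / 2 - 1 with hs
  have hs0 : 0 < s := by rw [hs]; linarith
  have lim := (tendsto_ordinaryHypergeometric_mul_rpow hs0 ha hb hc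
    (by rw [hs]; push_cast; ring)).comp (tendsto_half_one_sub_fishEyeArg hρ r')
  have hΓa := Complex.Gamma_ne_zero ha
  have hΓb := Complex.Gamma_ne_zero hb
  have hΓc := Complex.Gamma_ne_zero hc
  have hSpos := unitSphereArea_pos (by omega : 0 < N)
  have hconst : greenPrefactor N ν / Complex.Gamma ((N : ℂ) / 2) *
      (Complex.Gamma ((N : ℂ) / 2) * Complex.Gamma (s : ℂ) /
        (Complex.Gamma ((N : ℂ) / 2 - 1 - ν) * Complex.Gamma ((N : ℂ) / 2 + ν))) =
      ((-(1 / (((N : ℝ) - 2) * unitSphereArea N)) : ℝ) : ℂ) := by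
    have e1 : Real.Gamma ((N : ℝ) / 2) = s * Real.Gamma s := by
      rw [← Real.Gamma_add_one hs0.ne', hs]; congr 1; ring
    have e2 : Complex.Gamma (s : ℂ) = ((Real.Gamma s : ℝ) : ℂ) := Complex.Gamma_ofReal s
    have e3 : (N : ℂ) / 2 - ν - 1 = (N : ℂ) / 2 - 1 - ν := by ring
    have e4 : -(1 / (((N : ℝ) - 2) * unitSphereArea N)) =
        -(Real.Gamma s / (4 * Real.pi ^ ((N : ℝ) / 2))) := by
      unfold unitSphereArea
      rw [e1, show (N : ℝ) - 2 = 2 * s by rw [hs]; ring]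
      have := Real.Gamma_pos_of_pos hs0
      have := Real.rpow_pos_of_pos Real.pi_pos ((N : ℝ) / 2)
      field_simp
      norm_num
    rw [e4, e2]
    unfold greenPrefactor
    rw [e3]
    generalize Complex.Gamma ((N : ℂ) / 2 - 1 - ν) = Ga at hΓa ⊢
    generalize Complex.Gamma ((N : ℂ) / 2 + ν) = Gb at hΓb ⊢
    generalize Complex.Gamma ((N : ℂ) / 2) = Gc at hΓc ⊢
    push_cast
    field_simp
  rw [isEquivalent_iff_tendsto_one]
  · have lim2 := (lim.const_mul (greenPrefactor N ν / Complex.Gamma ((N : ℂ) / 2))).div_const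
      ((-(1 / (((N : ℝ) - 2) * unitSphereArea N)) : ℝ) : ℂ)
    have hne : ((-(1 / (((N : ℝ) - 2) * unitSphereArea N)) : ℝ) : ℂ) ≠ 0 := by
      have : 0 < ((N : ℝ) - 2) * unitSphereArea N := mul_pos (by linarith) hSpos
      exact_mod_cast (neg_ne_zero.2 (one_div_pos.2 this).ne')
    rw [hconst, div_self hne] at lim2
    refine lim2.congr' ?_
    filter_upwards [self_mem_nhdsWithin] with r hr
    have hr : r ≠ r' := hr
    have hp : ((‖r - r'‖ ^ (N - 2) : ℝ) : ℂ) ≠ 0 := by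
      have := norm_pos_iff.2 (sub_ne_zero.2 hr)
      exact_mod_cast (by positivity : ‖r - r'‖ ^ (N - 2) ≠ 0)
    have e : ((-(1 / (((N : ℝ) - 2) * unitSphereArea N * ‖r - r'‖ ^ (N - 2))) : ℝ) : ℂ) =
        ((-(1 / (((N : ℝ) - 2) * unitSphereArea N)) : ℝ) : ℂ) /
          ((‖r - r'‖ ^ (N - 2) : ℝ) : ℂ) := by
      rw [← Complex.ofReal_div, neg_div, div_div]
    simp only [Pi.div_apply]
    rw [e, fishEyeGreen_eq_mul_div hN2 hρ ν hr, div_div_div_cancel_right₀ hp]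
    rfl
  · filter_upwards [self_mem_nhdsWithin] with r hr
    have := norm_pos_iff.2 (sub_ne_zero.2 (hr : r ≠ r'))
    have : 0 < ((N : ℝ) - 2) * unitSphereArea N * ‖r - r'‖ ^ (N - 2) :=
      mul_pos (mul_pos (by linarith) hSpos) (by positivity)
    exact_mod_cast (neg_ne_zero.2 (one_div_pos.2 this).ne')

theorem eventually_log_norm_sub_neg (r' : EuclideanSpace ℝ (Fin N)) :
    ∀ᶠ r in 𝓝[≠] r', Real.log ‖r - r'‖ < 0 := by
  have h1 : ∀ᶠ r in 𝓝 r', ‖r - r'‖ < 1 := by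
    filter_upwards [Metric.ball_mem_nhds r' one_pos] with r hr
    rwa [Metric.mem_ball, dist_eq_norm] at hr
  filter_upwards [h1.filter_mono nhdsWithin_le_nhds, self_mem_nhdsWithin] with r h1 h2
  exact Real.log_neg (norm_pos_iff.2 (sub_ne_zero.2 h2)) h1

theorem tendsto_log_norm_sub (r' : EuclideanSpace ℝ (Fin N)) :
    Tendsto (fun r => Real.log ‖r - r'‖) (𝓝[≠] r') atBot := by
  refine Real.tendsto_log_nhdsGT_zero.comp ?_
  exact tendsto_norm_sub_self_nhdsNE r'

/-- 1 - z is |r-r'|² times a factor with positive limit, so log(1-z)/log|r-r'| tends to 2; this 2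
and the prefactor give 1/(2π). -/
theorem fishEyeGreen_isEquivalent_of_eq_two (hN : N = 2) {ρ : ℝ} (hρ : 0 < ρ) {ν : ℂ}
    (hex : ¬ IsExceptionalIndex N ν) (r' : EuclideanSpace ℝ (Fin N)) :
    (fun r => fishEyeGreen ρ ν r r') ~[𝓝[≠] r'] fun r =>
      ((1 / (2 * Real.pi) * Real.log ‖r - r'‖ : ℝ) : ℂ) := by
  obtain ⟨ha, hb, -⟩ := exceptional_ne hex
  have hN2 : (N : ℂ) / 2 = 1 := by rw [hN]; norm_num
  have hΓa := Complex.Gamma_ne_zero ha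
  have hΓb := Complex.Gamma_ne_zero hb
  rw [hN2] at ha hb hΓa hΓb
  have lim := (tendsto_ordinaryHypergeometric_div_log ha hb (by ring)).comp
    (tendsto_half_one_sub_fishEyeArg hρ r')
  have hA' : (0 : ℝ) < ‖r'‖ ^ 2 + ρ ^ 2 := by positivity
  have lim2 : Tendsto (fun r => Real.log (1 - (1 - fishEyeArg ρ r r') / 2) /
      Real.log ‖r - r'‖) (𝓝[≠] r') (𝓝 2) := by
    have h1 : Tendsto (fun r => Real.log (ρ ^ 2 / ((‖r‖ ^ 2 + ρ ^ 2) * (‖r'‖ ^ 2 + ρ ^ 2))))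
        (𝓝[≠] r') (𝓝 (Real.log (ρ ^ 2 / ((‖r'‖ ^ 2 + ρ ^ 2) * (‖r'‖ ^ 2 + ρ ^ 2))))) := by
      have hc : Continuous fun r : EuclideanSpace ℝ (Fin N) =>
          Real.log (ρ ^ 2 / ((‖r‖ ^ 2 + ρ ^ 2) * (‖r'‖ ^ 2 + ρ ^ 2))) := by
        refine Continuous.log (continuous_const.div (by fun_prop) fun r => ?_) fun r => ?_
        · positivity
        · positivity
      exact (hc.tendsto r').mono_left nhdsWithin_le_nhds
    have h2 := (h1.div_atBot (tendsto_log_norm_sub r')).add_const 2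
    rw [zero_add] at h2
    refine h2.congr' ?_
    filter_upwards [self_mem_nhdsWithin, eventually_log_norm_sub_neg r'] with r hr hl
    have hs := norm_pos_iff.2 (sub_ne_zero.2 (hr : r ≠ r'))
    have hA : (0 : ℝ) < ‖r‖ ^ 2 + ρ ^ 2 := by positivity
    have e : 1 - (1 - fishEyeArg ρ r r') / 2 =
        ρ ^ 2 / ((‖r‖ ^ 2 + ρ ^ 2) * (‖r'‖ ^ 2 + ρ ^ 2)) * ‖r - r'‖ ^ 2 := by
      rw [one_sub_half_one_sub_fishEyeArg]; ring
    rw [e, Real.log_mul (by positivity) (by positivity), Real.log_pow, add_div]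
    congr 1
    push_cast
    field_simp [hl.ne]
  have lim2c : Tendsto (fun r => ((Real.log (1 - (1 - fishEyeArg ρ r r') / 2) /
      Real.log ‖r - r'‖ : ℝ) : ℂ)) (𝓝[≠] r') (𝓝 ((2 : ℝ) : ℂ)) :=
    (Complex.continuous_ofReal.tendsto _).comp lim2
  rw [isEquivalent_iff_tendsto_one]
  · have lim3 := (lim.mul lim2c).const_mul (-(greenPrefactor N ν * (2 * Real.pi)))
    have hconst : -(greenPrefactor N ν * (2 * Real.pi)) *
        (1 / (Complex.Gamma (1 - 1 - ν) * Complex.Gamma (1 + ν)) * ((2 : ℝ) : ℂ)) = 1 := by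
      have e4 : (Real.pi : ℝ) ^ ((N : ℝ) / 2) = Real.pi := by
        rw [hN]; norm_num
      unfold greenPrefactor
      rw [e4, hN2, show (1 : ℂ) - ν - 1 = 1 - 1 - ν by ring]
      have hpi : (Real.pi : ℂ) ≠ 0 := by exact_mod_cast Real.pi_ne_zero
      push_cast
      field_simp
      norm_num
    rw [hconst] at lim3
    refine lim3.congr' ?_
    have hpos := ((tendsto_half_one_sub_fishEyeArg hρ r').mono_right
      nhdsWithin_le_nhds).eventually (lt_mem_nhds one_pos)
    filter_upwards [self_mem_nhdsWithin, eventually_log_norm_sub_neg r', hpos] with r hr hl hz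
    have hr : r ≠ r' := hr
    obtain ⟨-, hz1⟩ := half_one_sub_fishEyeArg_mem hρ hr
    have hG : fishEyeGreen ρ ν r r' = greenPrefactor N ν *
        ordinaryHypergeometric (1 - 1 - ν) (1 + ν) 1 ((((1 - fishEyeArg ρ r r') / 2 : ℝ)) : ℂ) := by
      rw [fishEyeGreen_eq hρ, hN2, show N - 2 = 0 by omega,
        show 1 - (N : ℝ) / 2 = 0 by rw [hN]; norm_num]
      simp
    simp only [Pi.div_apply, Function.comp_apply]
    rw [hG]
    have hl2 : Real.log (1 - (1 - fishEyeArg ρ r r') / 2) ≠ 0 :=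
      (Real.log_neg (by linarith) (by linarith)).ne
    have l1 : ((Real.log (1 - (1 - fishEyeArg ρ r r') / 2) : ℝ) : ℂ) ≠ 0 := by exact_mod_cast hl2
    have l2 : ((Real.log ‖r - r'‖ : ℝ) : ℂ) ≠ 0 := by exact_mod_cast hl.ne
    have hpi : (Real.pi : ℂ) ≠ 0 := by exact_mod_cast Real.pi_ne_zero
    generalize Real.log (1 - (1 - fishEyeArg ρ r r') / 2) = L1 at l1 ⊢
    generalize Real.log ‖r - r'‖ = L2 at l2 ⊢
    push_cast
    field_simp
  · filter_upwards [eventually_log_norm_sub_neg r'] with r hr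
    have : 1 / (2 * Real.pi) * Real.log ‖r - r'‖ ≠ 0 :=
      mul_ne_zero (by have := Real.pi_pos; positivity) hr.ne
    exact_mod_cast this

/-- The limit of `|r|^(N-2) G(r, r')` at infinity. -/
theorem tendsto_norm_pow_mul_fishEyeGreen (hN : 2 ≤ N) {ρ : ℝ} (hρ : 0 < ρ) (ν : ℂ)
    (r' : EuclideanSpace ℝ (Fin N)) :
    Tendsto (fun r => ((‖r‖ ^ (N - 2) : ℝ) : ℂ) * fishEyeGreen ρ ν r r')
      (Bornology.cobounded (EuclideanSpace ℝ (Fin N)))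
      (𝓝 (greenPrefactor N ν / Complex.Gamma ((N : ℂ) / 2) *
        ordinaryHypergeometric (-ν) (ν + 1) ((N : ℂ) / 2)
          (((‖r'‖ ^ 2 / (‖r'‖ ^ 2 + ρ ^ 2) : ℝ)) : ℂ))) := by
  have hn : Tendsto (fun r : EuclideanSpace ℝ (Fin N) => ‖r‖)
    (Bornology.cobounded (EuclideanSpace ℝ (Fin N))) atTop := tendsto_norm_cobounded_atTop
  have hinv := tendsto_inv_atTop_zero.comp hn
  have hA' : (0 : ℝ) < ‖r'‖ ^ 2 + ρ ^ 2 := by positivity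
  have hratio : Tendsto (fun r : EuclideanSpace ℝ (Fin N) => ‖r - r'‖ / ‖r‖)
      (Bornology.cobounded (EuclideanSpace ℝ (Fin N))) (𝓝 1) := by
    have h0 : Tendsto (fun r : EuclideanSpace ℝ (Fin N) => ‖r'‖ * ‖r‖⁻¹)
        (Bornology.cobounded (EuclideanSpace ℝ (Fin N))) (𝓝 0) := by
      simpa using hinv.const_mul ‖r'‖
    rw [tendsto_iff_norm_sub_tendsto_zero]
    refine squeeze_zero' (Eventually.of_forall fun r => norm_nonneg _) ?_ h0
    filter_upwards [hn.eventually_gt_atTop 0] with r hr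
    have e : ‖r - r'‖ / ‖r‖ - 1 = (‖r - r'‖ - ‖r‖) / ‖r‖ := by field_simp
    rw [e, norm_div, norm_norm, ← div_eq_mul_inv]
    gcongr
    have := abs_norm_sub_norm_le (r - r') r
    simpa using this
  have hA : Tendsto (fun r : EuclideanSpace ℝ (Fin N) => (‖r‖ ^ 2 + ρ ^ 2) / ‖r‖ ^ 2)
      (Bornology.cobounded (EuclideanSpace ℝ (Fin N))) (𝓝 1) := by
    have h1 := ((hinv.pow 2).const_mul (ρ ^ 2)).const_add 1
    simp only [ne_eq, OfNat.ofNat_ne_zero, not_false_eq_true, zero_pow, mul_zero, add_zero] at h1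
    refine h1.congr' ?_
    filter_upwards [hn.eventually_gt_atTop 0] with r hr
    simp only [Function.comp_apply]
    field_simp
  have hz : Tendsto (fun r => (1 - fishEyeArg ρ r r') / 2)
      (Bornology.cobounded (EuclideanSpace ℝ (Fin N))) (𝓝 (‖r'‖ ^ 2 / (‖r'‖ ^ 2 + ρ ^ 2))) := by
    have h1 := (((hratio.pow 2).div hA one_ne_zero).const_mul (ρ ^ 2 / (‖r'‖ ^ 2 + ρ ^ 2))).const_sub 1
    have e : 1 - ρ ^ 2 / (‖r'‖ ^ 2 + ρ ^ 2) * (1 ^ 2 / 1) = ‖r'‖ ^ 2 / (‖r'‖ ^ 2 + ρ ^ 2) := by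
      field_simp; ring
    rw [e] at h1
    refine h1.congr' ?_
    filter_upwards [hn.eventually_gt_atTop 0] with r hr
    have h2 := one_sub_half_one_sub_fishEyeArg ρ r r'
    have hAr : (0 : ℝ) < ‖r‖ ^ 2 + ρ ^ 2 := by positivity
    simp only [Pi.div_apply]
    have h3 : ρ ^ 2 / (‖r'‖ ^ 2 + ρ ^ 2) * ((‖r - r'‖ / ‖r‖) ^ 2 /
        ((‖r‖ ^ 2 + ρ ^ 2) / ‖r‖ ^ 2)) =
        ρ ^ 2 * ‖r - r'‖ ^ 2 / ((‖r‖ ^ 2 + ρ ^ 2) * (‖r'‖ ^ 2 + ρ ^ 2)) := by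
      field_simp
    rw [h3]
    linarith
  have hF : ContinuousAt (ordinaryHypergeometric (-ν) (ν + 1) ((N : ℂ) / 2))
      (((‖r'‖ ^ 2 / (‖r'‖ ^ 2 + ρ ^ 2) : ℝ)) : ℂ) := by
    obtain ⟨F₁, F₂, hF⟩ :=
      exists_hasDerivAt_ordinaryHypergeometric (-ν) (ν + 1) (half_dim_ne_neg_nat hN)
    refine (hF _ ?_).1.continuousAt
    rw [Complex.norm_real, Real.norm_of_nonneg (by positivity), div_lt_one hA']
    have : 0 < ρ ^ 2 := by positivity
    linarith
  have hFz := hF.tendsto.comp ((Complex.continuous_ofReal.tendsto _).comp hz)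
  have hpow : Tendsto (fun r : EuclideanSpace ℝ (Fin N) =>
      (((‖r - r'‖ / ‖r‖) ^ (N - 2) : ℝ) : ℂ))
      (Bornology.cobounded (EuclideanSpace ℝ (Fin N))) (𝓝 1) := by
    have := (Complex.continuous_ofReal.tendsto _).comp (hratio.pow (N - 2))
    simpa only [Function.comp_def, one_pow, Complex.ofReal_one] using this
  have key := (hFz.const_mul (greenPrefactor N ν / Complex.Gamma ((N : ℂ) / 2))).div hpow
    one_ne_zero
  rw [div_one] at key
  refine key.congr' ?_
  filter_upwards [hn.eventually_gt_atTop ‖r'‖] with r hr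
  have hne : r ≠ r' := by rintro rfl; exact lt_irrefl _ hr
  have hr0 : 0 < ‖r‖ := (norm_nonneg _).trans_lt hr
  have hs := norm_pos_iff.2 (sub_ne_zero.2 hne)
  rw [fishEyeGreen_eq_div hN hρ ν hne]
  have c1 : ((‖r‖ : ℝ) : ℂ) ≠ 0 := by exact_mod_cast hr0.ne'
  have c2 : ((‖r - r'‖ : ℝ) : ℂ) ≠ 0 := by exact_mod_cast hs.ne'
  simp only [Pi.div_apply, Function.comp_apply, div_pow]
  push_cast
  field_simp

theorem isFishEyeGreen_fishEyeGreen (hN : 2 ≤ N) {ρ : ℝ} (hρ : 0 < ρ) {n₀ k ν : ℂ}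
    (hν : IsFishEyeIndex n₀ k ρ ν) (hex : ¬ IsExceptionalIndex N ν)
    (r' : EuclideanSpace ℝ (Fin N)) :
    IsFishEyeGreen N ρ n₀ k r' fun r => fishEyeGreen ρ ν r r' where
  contDiffOn := fun _ hr => (contDiffAt_fishEyeGreen hN hρ ν hr hν).1.contDiffWithinAt
  equation := fun _ hr => (contDiffAt_fishEyeGreen hN hρ ν hr hν).2
  singularity_two := fun h => fishEyeGreen_isEquivalent_of_eq_two h hρ hex r'
  singularity_ge_three := fun h => fishEyeGreen_isEquivalent_of_three_le h hρ hex r'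
  decay := ⟨_, tendsto_norm_pow_mul_fishEyeGreen hN hρ ν r'⟩

end Existence

/-! ### Uniqueness of the Green's function. -/

section Uniqueness

variable {N : ℕ}

/-- Equal leading singularities make the difference of smaller order at the source, and the two
limits at infinity make it O(r^(2-N)). -/
theorem IsFishEyeGreen.eq_of_ne (hN : 2 ≤ N) {ρ : ℝ} (hρ : 0 < ρ) {n₀ k ν : ℂ}
    (hν : IsFishEyeIndex n₀ k ρ ν) (hex : ¬ IsExceptionalIndex N ν)
    {c : EuclideanSpace ℝ (Fin N)} {g₁ g₂ : EuclideanSpace ℝ (Fin N) → ℂ}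
    (h₁ : IsFishEyeGreen N ρ n₀ k c g₁) (h₂ : IsFishEyeGreen N ρ n₀ k c g₂)
    {r : EuclideanSpace ℝ (Fin N)} (hr : r ≠ c) : g₁ r = g₂ r := by
  have hlittle : ∃ v : EuclideanSpace ℝ (Fin N) → ℂ, ∃ C : ℝ, 0 < C ∧
      (g₁ - g₂) =o[𝓝[≠] c] v ∧ ∀ r, ‖v r‖ =
        C * ((‖r - c‖ ^ (N - 2))⁻¹ * (if N = 2 then |Real.log ‖r - c‖| else 1)) := by
    rcases hN.eq_or_lt with h | h
    · refine ⟨_, 1 / (2 * Real.pi), by positivity,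
        (h₁.singularity_two h.symm).isLittleO.sub (h₂.singularity_two h.symm).isLittleO |>.congr_left
          fun r => by simp, fun r => ?_⟩
      rw [Complex.norm_real, norm_mul, Real.norm_of_nonneg (by positivity), if_pos h.symm,
        show N - 2 = 0 by omega, Real.norm_eq_abs]
      simp
    · have hS := unitSphereArea_pos (by omega : 0 < N)
      have h3 : (3 : ℝ) ≤ N := by exact_mod_cast h
      have h4 : 0 < (N : ℝ) - 2 := by linarith
      refine ⟨_, 1 / (((N : ℝ) - 2) * unitSphereArea N), by positivity,
        (h₁.singularity_ge_three h).isLittleO.sub (h₂.singularity_ge_three h).isLittleO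
          |>.congr_left fun r => by simp, fun r => ?_⟩
      rw [Complex.norm_real, norm_neg, Real.norm_of_nonneg (by positivity), if_neg (by omega)]
      rw [mul_one, ← one_div, one_div_mul_one_div]
  obtain ⟨v, C, hC, hv, hvn⟩ := hlittle
  obtain ⟨C₁, hC₁⟩ := h₁.decay
  obtain ⟨C₂, hC₂⟩ := h₂.decay
  have hbd : ∀ᶠ r in Bornology.cobounded (EuclideanSpace ℝ (Fin N)),
      ‖((‖r‖ ^ (N - 2) : ℝ) : ℂ) * g₁ r - ((‖r‖ ^ (N - 2) : ℝ) : ℂ) * g₂ r‖ < ‖C₁ - C₂‖ + 1 :=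
    (hC₁.sub hC₂).norm.eventually (gt_mem_nhds (lt_add_one _))
  -- 2^(N-2) converts decay in |y| to decay in |y-c|, as |y-c| ≤ 2|y| once |y| > |c|.
  have key := eq_zero_of_growth (c := c) (h := g₁ - g₂) (K₀ := 2 ^ (N - 2) * (‖C₁ - C₂‖ + 1))
    hN hρ (exceptional_ne hex).2.2 (h₁.contDiffOn.sub h₂.contDiffOn) ?_ ?_ ?_ hr
  · exact sub_eq_zero.1 key
  · intro y hy
    have hnh : ({c}ᶜ : Set (EuclideanSpace ℝ (Fin N))) ∈ 𝓝 y := isOpen_compl_singleton.mem_nhds hy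
    rw [(h₁.contDiffOn.contDiffAt hnh).laplacian_sub (h₂.contDiffOn.contDiffAt hnh)]
    have e : 4 * (ν * (ν + 1)) * (ρ : ℂ) ^ 2 = 4 * n₀ ^ 2 * k ^ 2 * (ρ : ℂ) ^ 4 := by
      rw [← fishEyeIndex_mul hν]; ring
    rw [e]
    simp only [Pi.sub_apply]
    linear_combination h₁.equation y hy - h₂.equation y hy
  · intro δ hδ
    filter_upwards [hv.def (div_pos hδ hC)] with y hy
    refine hy.trans (le_of_eq ?_)
    rw [hvn]
    field_simp
  · filter_upwards [hbd, (tendsto_norm_cobounded_atTop (E := EuclideanSpace ℝ (Fin N))).eventually_gt_atTop ‖c‖]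
      with y hy hyc
    have hs : 0 < ‖y - c‖ := norm_pos_iff.2 (sub_ne_zero.2 fun h => by simp [h] at hyc)
    have h2 : ‖y - c‖ ≤ 2 * ‖y‖ := (norm_sub_le _ _).trans (by linarith)
    rw [← mul_sub, norm_mul, Complex.norm_real, norm_pow, norm_norm] at hy
    rw [← div_eq_mul_inv, le_div_iff₀ (by positivity)]
    calc ‖(g₁ - g₂) y‖ * ‖y - c‖ ^ (N - 2) ≤ ‖(g₁ - g₂) y‖ * (2 * ‖y‖) ^ (N - 2) := by gcongr
      _ = 2 ^ (N - 2) * (‖y‖ ^ (N - 2) * ‖(g₁ - g₂) y‖) := by ring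
      _ ≤ _ := by gcongr; exact hy.le

end Uniqueness

/-! ### Legendre forms, symmetry and special values. -/

section ClosedForms

variable {N : ℕ}

theorem ferrersP_half_dim (N : ℕ) (ν : ℂ) (x : ℝ) :
    ferrersP ν (-(N : ℝ) / 2 + 1) x =
      ((((1 - x) / (1 + x)) ^ ((N : ℝ) / 4 - 1 / 2) : ℝ) : ℂ) / Complex.Gamma ((N : ℂ) / 2) *
        ordinaryHypergeometric (-ν) (ν + 1) ((N : ℂ) / 2) ((((1 - x) / 2 : ℝ)) : ℂ) := by
  unfold ferrersP
  rw [show -(-(N : ℝ) / 2 + 1) / 2 = (N : ℝ) / 4 - 1 / 2 by ring,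
    show 1 - ((-(N : ℝ) / 2 + 1 : ℝ) : ℂ) = (N : ℂ) / 2 by push_cast; ring]

theorem sq_rpow_quarter_dim (N : ℕ) {x : ℝ} (hx : 0 ≤ x) :
    (x ^ 2) ^ ((N : ℝ) / 4 - 1 / 2) = x ^ ((N : ℝ) / 2 - 1) := by
  rw [← Real.rpow_natCast, ← Real.rpow_mul hx]
  congr 1
  push_cast
  ring

theorem rpow_half_dim_mul_self (hN : 2 ≤ N) {x : ℝ} (hx : 0 < x) :
    x ^ ((N : ℝ) / 2 - 1) * x ^ ((N : ℝ) / 2 - 1) = x ^ (N - 2) := by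
  rw [← Real.rpow_add hx, ← Real.rpow_natCast, Nat.cast_sub hN]
  congr 1
  push_cast
  ring

/-- `r² r'² + 2 ρ² r·r' + ρ⁴ = r'² |r + (ρ²/r'²) r'|²`. -/
theorem inversionQuadratic_eq_sq (ρ : ℝ) (r : EuclideanSpace ℝ (Fin N))
    {r' : EuclideanSpace ℝ (Fin N)} (hr' : r' ≠ 0) :
    ‖r‖ ^ 2 * ‖r'‖ ^ 2 + 2 * ρ ^ 2 * inner ℝ r r' + ρ ^ 4 =
      (‖r'‖ * ‖r + (ρ ^ 2 / ‖r'‖ ^ 2) • r'‖) ^ 2 := by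
  have h := norm_ne_zero_iff.2 hr'
  rw [mul_pow, norm_add_sq_real, inner_smul_right, norm_smul, mul_pow, Real.norm_eq_abs, sq_abs]
  field_simp

/-- Here (1-x)/(1+x) = Q/(ρ|r-r'|)². The algebraic factor of the Legendre function therefore
contains half of the power of |r-r'|, and the rest is Q^(N/4-1/2). -/
theorem fishEyeGreen_eq_ferrersP (hN : 2 ≤ N) {ρ : ℝ} (hρ : 0 < ρ) (ν : ℂ)
    {r r' : EuclideanSpace ℝ (Fin N)} (hr : r ≠ r')
    (hQ : ‖r‖ ^ 2 * ‖r'‖ ^ 2 + 2 * ρ ^ 2 * inner ℝ r r' + ρ ^ 4 ≠ 0) :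
    fishEyeGreen ρ ν r r' = greenPrefactor N ν *
      (((ρ ^ ((N : ℝ) / 2 - 1) : ℝ) : ℂ) *
          ferrersP ν (-(N : ℝ) / 2 + 1) (fishEyeArg ρ r r') /
        ((‖r - r'‖ ^ ((N : ℝ) / 2 - 1) *
          (‖r‖ ^ 2 * ‖r'‖ ^ 2 + 2 * ρ ^ 2 * inner ℝ r r' + ρ ^ 4) ^
            ((N : ℝ) / 4 - 1 / 2) : ℝ) : ℂ)) := by
  have hs := norm_pos_iff.2 (sub_ne_zero.2 hr)
  have hA : 0 < (‖r‖ ^ 2 + ρ ^ 2) * (‖r'‖ ^ 2 + ρ ^ 2) := by positivity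
  have hz := half_one_sub_fishEyeArg hρ r r'
  have hw := one_sub_half_one_sub_fishEyeArg ρ r r'
  have hz0 := (half_one_sub_fishEyeArg_mem hρ hr).1
  rw [fishEyeGreen_eq_div hN hρ ν hr, ferrersP_half_dim]
  set Q := ‖r‖ ^ 2 * ‖r'‖ ^ 2 + 2 * ρ ^ 2 * inner ℝ r r' + ρ ^ 4
  -- Q is (1-x)/2 times a positive factor, hence nonnegative, so nonvanishing means positive.
  have hQ0 : 0 < Q := by
    rw [hz] at hz0
    exact lt_of_le_of_ne (by simpa [div_mul_cancel₀ _ hA.ne'] using mul_nonneg hz0 hA.le) hQ.symm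
  have hratio : (1 - fishEyeArg ρ r r') / (1 + fishEyeArg ρ r r') = Q / (ρ * ‖r - r'‖) ^ 2 := by
    have e1 : 1 - fishEyeArg ρ r r' =
      2 * (Q / ((‖r‖ ^ 2 + ρ ^ 2) * (‖r'‖ ^ 2 + ρ ^ 2))) := by linarith
    have e2 : 1 + fishEyeArg ρ r r' =
      2 * (ρ ^ 2 * ‖r - r'‖ ^ 2 / ((‖r‖ ^ 2 + ρ ^ 2) * (‖r'‖ ^ 2 + ρ ^ 2))) := by linarith
    rw [e1, e2]
    field_simp
  rw [hratio, Real.div_rpow hQ0.le (by positivity), sq_rpow_quarter_dim N (by positivity),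
    Real.mul_rpow hρ.le hs.le, ← rpow_half_dim_mul_self hN hs]
  have c1 : ((ρ ^ ((N : ℝ) / 2 - 1) : ℝ) : ℂ) ≠ 0 := by
    exact_mod_cast (Real.rpow_pos_of_pos hρ _).ne'
  have c2 : ((‖r - r'‖ ^ ((N : ℝ) / 2 - 1) : ℝ) : ℂ) ≠ 0 := by
    exact_mod_cast (Real.rpow_pos_of_pos hs _).ne'
  have c3 : ((Q ^ ((N : ℝ) / 4 - 1 / 2) : ℝ) : ℂ) ≠ 0 := by
    exact_mod_cast (Real.rpow_pos_of_pos hQ0 _).ne'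
  generalize ordinaryHypergeometric (-ν) (ν + 1) ((N : ℂ) / 2) (((1 - fishEyeArg ρ r r') / 2 : ℝ) : ℂ) = x5
  rw [Complex.ofReal_mul, Complex.ofReal_mul, Complex.ofReal_div, Complex.ofReal_mul]
  generalize ((ρ ^ ((N : ℝ) / 2 - 1) : ℝ) : ℂ) = x1 at c1 ⊢
  generalize ((‖r - r'‖ ^ ((N : ℝ) / 2 - 1) : ℝ) : ℂ) = x2 at c2 ⊢
  generalize ((Q ^ ((N : ℝ) / 4 - 1 / 2) : ℝ) : ℂ) = x3 at c3 ⊢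
  generalize Complex.Gamma ((N : ℂ) / 2) = x4
  field_simp

theorem norm_add_smul_pos {ρ : ℝ} {r r' : EuclideanSpace ℝ (Fin N)}
    (hr : r ≠ -((ρ ^ 2 / ‖r'‖ ^ 2) • r')) : 0 < ‖r + (ρ ^ 2 / ‖r'‖ ^ 2) • r'‖ :=
  norm_pos_iff.2 fun h => hr (eq_neg_of_add_eq_zero_left h)

theorem fishEyeGreen_eq_ferrersP_image (hN : 2 ≤ N) {ρ : ℝ} (hρ : 0 < ρ) (ν : ℂ)
    {r r' : EuclideanSpace ℝ (Fin N)} (hr' : r' ≠ 0) (hr : r ≠ r')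
    (hi : r ≠ -((ρ ^ 2 / ‖r'‖ ^ 2) • r')) :
    fishEyeGreen ρ ν r r' = greenPrefactor N ν * (((ρ / ‖r'‖) ^ ((N : ℝ) / 2 - 1) : ℝ) : ℂ) *
      (ferrersP ν (-(N : ℝ) / 2 + 1) (fishEyeArg ρ r r') /
        ((‖r - r'‖ ^ ((N : ℝ) / 2 - 1) *
          ‖r + (ρ ^ 2 / ‖r'‖ ^ 2) • r'‖ ^ ((N : ℝ) / 2 - 1) : ℝ) : ℂ)) := by
  have hT := norm_add_smul_pos hi
  have h' := norm_pos_iff.2 hr'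
  have hQ := inversionQuadratic_eq_sq ρ r hr'
  rw [fishEyeGreen_eq_ferrersP hN hρ ν hr (by rw [hQ]; positivity), hQ,
    sq_rpow_quarter_dim N (by positivity), Real.mul_rpow h'.le hT.le, Real.div_rpow hρ.le h'.le]
  rw [Complex.ofReal_mul, Complex.ofReal_mul, Complex.ofReal_div, Complex.ofReal_mul]
  ring

/-- √Q is the distance to an image point scaled by |r'|, or equally with the roles of r and r'
exchanged; the power of Q is split evenly between the two descriptions. -/
theorem fishEyeGreen_eq_ferrersP_images (hN : 2 ≤ N) {ρ : ℝ} (hρ : 0 < ρ) (ν : ℂ)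
    {r r' : EuclideanSpace ℝ (Fin N)} (hr0 : r ≠ 0) (hr' : r' ≠ 0) (hr : r ≠ r')
    (hi : r ≠ -((ρ ^ 2 / ‖r'‖ ^ 2) • r')) :
    fishEyeGreen ρ ν r r' = greenPrefactor N ν *
      (((ρ ^ ((N : ℝ) / 2 - 1) : ℝ) : ℂ) *
          ferrersP ν (-(N : ℝ) / 2 + 1) (fishEyeArg ρ r r') /
        (((‖r‖ * ‖r'‖) ^ ((N : ℝ) / 4 - 1 / 2) * ‖r - r'‖ ^ ((N : ℝ) / 2 - 1) *
          ‖r + (ρ ^ 2 / ‖r'‖ ^ 2) • r'‖ ^ ((N : ℝ) / 4 - 1 / 2) *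
          ‖r' + (ρ ^ 2 / ‖r‖ ^ 2) • r‖ ^ ((N : ℝ) / 4 - 1 / 2) : ℝ) : ℂ)) := by
  have hT := norm_add_smul_pos hi
  have h' := norm_pos_iff.2 hr'
  have h0 := norm_pos_iff.2 hr0
  have hQ := inversionQuadratic_eq_sq ρ r hr'
  have hQ' := inversionQuadratic_eq_sq ρ r' hr0
  rw [real_inner_comm, mul_comm (‖r'‖ ^ 2), hQ] at hQ'
  have hTT : ‖r'‖ * ‖r + (ρ ^ 2 / ‖r'‖ ^ 2) • r'‖ = ‖r‖ * ‖r' + (ρ ^ 2 / ‖r‖ ^ 2) • r‖ :=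
    (sq_eq_sq₀ (by positivity) (by positivity)).1 hQ'
  rw [fishEyeGreen_eq_ferrersP hN hρ ν hr (by rw [hQ]; positivity)]
  congr 3
  rw [hQ, sq, Real.mul_rpow (by positivity) (by positivity)]
  nth_rewrite 2 [hTT]
  rw [Real.mul_rpow (by positivity) (by positivity), Real.mul_rpow (by positivity) (by positivity),
    Real.mul_rpow (by positivity) (by positivity)]
  ring

theorem fishEyeGreen_comm (hN : 2 ≤ N) {ρ : ℝ} (hρ : 0 < ρ) (ν : ℂ)
    {r r' : EuclideanSpace ℝ (Fin N)} (hr : r ≠ r') :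
    fishEyeGreen ρ ν r r' = fishEyeGreen ρ ν r' r := by
  rw [fishEyeGreen_eq_div hN hρ ν hr, fishEyeGreen_eq_div hN hρ ν hr.symm, fishEyeArg_comm,
    norm_sub_rev]

theorem ne_image {ρ : ℝ} {r' : EuclideanSpace ℝ (Fin N)} (hr' : r' ≠ 0) :
    -((ρ ^ 2 / ‖r'‖ ^ 2) • r') ≠ r' := by
  intro h
  have h1 : (1 + ρ ^ 2 / ‖r'‖ ^ 2) • r' = 0 := by
    rw [add_smul, one_smul]
    nth_rewrite 1 [← h]
    exact neg_add_cancel _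
  exact (smul_ne_zero (by positivity) hr') h1

/-- The image point is the antipode of the source: x = 1, z = 0, and the hypergeometric factor is 1.
-/
theorem fishEyeGreen_image (hN : 2 ≤ N) {ρ : ℝ} (hρ : 0 < ρ) (ν : ℂ)
    {r' : EuclideanSpace ℝ (Fin N)} (hr' : r' ≠ 0) :
    fishEyeGreen ρ ν (-((ρ ^ 2 / ‖r'‖ ^ 2) • r')) r' =
      greenPrefactor N ν / (Real.Gamma ((N : ℝ) / 2) : ℂ) *
        (((‖r'‖ / (‖r'‖ ^ 2 + ρ ^ 2)) ^ (N - 2) : ℝ) : ℂ) := by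
  have h' := norm_pos_iff.2 hr'
  have hz : (1 - fishEyeArg ρ (-((ρ ^ 2 / ‖r'‖ ^ 2) • r')) r') / 2 = 0 := by
    rw [half_one_sub_fishEyeArg hρ, inversionQuadratic_eq_sq ρ _ hr']
    simp
  have hs : ‖-((ρ ^ 2 / ‖r'‖ ^ 2) • r') - r'‖ = (‖r'‖ / (‖r'‖ ^ 2 + ρ ^ 2))⁻¹ := by
    rw [← neg_add', norm_neg, show (ρ ^ 2 / ‖r'‖ ^ 2) • r' + r' = (ρ ^ 2 / ‖r'‖ ^ 2 + 1) • r' by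
      rw [add_smul, one_smul], norm_smul, Real.norm_of_nonneg (by positivity)]
    field_simp
    ring
  rw [fishEyeGreen_eq_div hN hρ ν (ne_image hr'), hz, hs, Complex.ofReal_zero,
    ordinaryHypergeometric_zero, mul_one, ← Complex.Gamma_ofReal, inv_pow, Complex.ofReal_inv,
    div_inv_eq_mul]
  push_cast
  rfl

theorem tendsto_fishEyeGreen_infinity (hN : 2 ≤ N) {ρ : ℝ} (hρ : 0 < ρ) (ν : ℂ)
    {r' : EuclideanSpace ℝ (Fin N)} (hr' : r' ≠ 0) :
    Tendsto (fun r => ((‖r‖ ^ (N - 2) : ℝ) : ℂ) * fishEyeGreen ρ ν r r')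
      (Bornology.cobounded (EuclideanSpace ℝ (Fin N)))
      (𝓝 (greenPrefactor N ν * (((ρ / ‖r'‖) ^ ((N : ℝ) / 2 - 1) : ℝ) : ℂ) *
        ferrersP ν (-(N : ℝ) / 2 + 1) ((ρ ^ 2 - ‖r'‖ ^ 2) / (ρ ^ 2 + ‖r'‖ ^ 2)))) := by
  have h' := norm_pos_iff.2 hr'
  convert tendsto_norm_pow_mul_fishEyeGreen hN hρ ν r' using 2
  have hA : ρ ^ 2 + ‖r'‖ ^ 2 ≠ 0 := by positivity
  have e1 : (1 - (ρ ^ 2 - ‖r'‖ ^ 2) / (ρ ^ 2 + ‖r'‖ ^ 2)) / 2 = ‖r'‖ ^ 2 / (‖r'‖ ^ 2 + ρ ^ 2) := by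
    rw [add_comm (‖r'‖ ^ 2)]
    field_simp
    ring
  have e2 : (1 - (ρ ^ 2 - ‖r'‖ ^ 2) / (ρ ^ 2 + ‖r'‖ ^ 2)) /
      (1 + (ρ ^ 2 - ‖r'‖ ^ 2) / (ρ ^ 2 + ‖r'‖ ^ 2)) = (ρ / ‖r'‖)⁻¹ ^ 2 := by
    field_simp
    ring
  rw [ferrersP_half_dim, e1, e2, sq_rpow_quarter_dim N (by positivity),
    Real.inv_rpow (by positivity), Complex.ofReal_inv]
  have c1 : (((ρ / ‖r'‖) ^ ((N : ℝ) / 2 - 1) : ℝ) : ℂ) ≠ 0 := by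
    exact_mod_cast (Real.rpow_pos_of_pos (div_pos hρ h') _).ne'
  generalize (((ρ / ‖r'‖) ^ ((N : ℝ) / 2 - 1) : ℝ) : ℂ) = x at c1 ⊢
  field_simp

theorem tendsto_fishEyeGreen_infinity_zero (hN : 2 ≤ N) {ρ : ℝ} (hρ : 0 < ρ) (ν : ℂ) :
    Tendsto (fun r => ((‖r‖ ^ (N - 2) : ℝ) : ℂ) * fishEyeGreen ρ ν r 0)
      (Bornology.cobounded (EuclideanSpace ℝ (Fin N)))
      (𝓝 (greenPrefactor N ν / (Real.Gamma ((N : ℝ) / 2) : ℂ))) := by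
  convert tendsto_norm_pow_mul_fishEyeGreen hN hρ ν 0 using 2
  rw [← Complex.Gamma_ofReal]
  simp

end ClosedForms

/-! ### The Gegenbauer form and its limit in the index. -/

section GegenbauerForm

variable {N : ℕ}

/-- Legendre's duplication formula at (N-1)/2. -/
theorem pi_div_mul_Gamma_half_dim (hN : 2 ≤ N) :
    Real.pi / (4 * Real.pi ^ ((N : ℝ) / 2) * Real.Gamma ((N : ℝ) / 2)) =
      (2 : ℝ) ^ ((N : ℝ) - 4) * Real.Gamma (((N : ℝ) - 1) / 2) /
        (Real.pi ^ (((N : ℝ) - 1) / 2) * Real.Gamma ((N : ℝ) - 1)) := by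
  have h2 : (2 : ℝ) ≤ N := by exact_mod_cast hN
  have hdup := Real.Gamma_mul_Gamma_add_half (((N : ℝ) - 1) / 2)
  rw [show ((N : ℝ) - 1) / 2 + 1 / 2 = (N : ℝ) / 2 by ring,
    show 2 * (((N : ℝ) - 1) / 2) = (N : ℝ) - 1 by ring,
    show 1 - ((N : ℝ) - 1) = 2 - N by ring] at hdup
  have g1 := Real.Gamma_pos_of_pos (by linarith : 0 < (N : ℝ) / 2)
  have g2 := Real.Gamma_pos_of_pos (by linarith : 0 < (N : ℝ) - 1)
  have p1 := Real.rpow_pos_of_pos Real.pi_pos ((N : ℝ) / 2)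
  have p2 := Real.rpow_pos_of_pos Real.pi_pos (((N : ℝ) - 1) / 2)
  have e1 : Real.pi ^ ((N : ℝ) / 2) = Real.pi ^ (((N : ℝ) - 1) / 2) * Real.sqrt Real.pi := by
    rw [Real.sqrt_eq_rpow, ← Real.rpow_add Real.pi_pos]
    congr 1
    ring
  have e2 : (2 : ℝ) ^ ((N : ℝ) - 4) * 2 ^ (2 - (N : ℝ)) = 1 / 4 := by
    rw [← Real.rpow_add two_pos, show (N : ℝ) - 4 + (2 - N) = -2 by ring,
      Real.rpow_neg two_pos.le]
    norm_num
  have e3 := Real.mul_self_sqrt Real.pi_pos.le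
  have e4 := Real.sqrt_pos.2 Real.pi_pos
  rw [div_eq_div_iff (by positivity) (by positivity), e1]
  linear_combination (-4 * Real.pi ^ (((N : ℝ) - 1) / 2) * Real.sqrt Real.pi *
    2 ^ ((N : ℝ) - 4)) * hdup - 4 * Real.pi ^ (((N : ℝ) - 1) / 2) * (Real.sqrt Real.pi) ^ 2 *
    Real.Gamma ((N : ℝ) - 1) * e2 - Real.pi ^ (((N : ℝ) - 1) / 2) * Real.Gamma ((N : ℝ) - 1) * e3

/-- The hypergeometric functions coincide before any Euler transformation. The reflection formula
turns Γ(N/2-ν-1) into the sine and the Γ in the Gegenbauer denominator. -/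
theorem greenGegenbauer_eq_fishEyeGreen (hN : 2 ≤ N) {ρ : ℝ} (hρ : 0 < ρ) {ν : ℂ}
    (hsin : Complex.sin ((Real.pi : ℂ) * ((N : ℂ) / 2 - ν)) ≠ 0)
    (r r' : EuclideanSpace ℝ (Fin N)) :
    greenGegenbauer ρ ν r r' = fishEyeGreen ρ ν r r' := by
  have h2 : (2 : ℝ) ≤ N := by exact_mod_cast hN
  have hA : 0 < ‖r‖ ^ 2 + ρ ^ 2 := by positivity
  have hA' : 0 < ‖r'‖ ^ 2 + ρ ^ 2 := by positivity
  have hpi : (Real.pi : ℂ) ≠ 0 := by exact_mod_cast Real.pi_ne_zero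
  have hrefl := Complex.Gamma_mul_Gamma_one_sub ((N : ℂ) / 2 - ν - 1)
  have hs : Complex.sin ((Real.pi : ℂ) * ((N : ℂ) / 2 - ν - 1)) =
      -Complex.sin ((Real.pi : ℂ) * ((N : ℂ) / 2 - ν)) := by
    rw [← Complex.sin_sub_pi]
    congr 1
    ring
  rw [hs, show 1 - ((N : ℂ) / 2 - ν - 1) = ν - (N : ℂ) / 2 + 1 + 1 by ring] at hrefl
  have hΓ : Complex.Gamma (ν - (N : ℂ) / 2 + 1 + 1) ≠ 0 := by
    intro h
    rw [h, mul_zero, eq_comm, div_eq_zero_iff, neg_eq_zero] at hrefl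
    exact hrefl.elim hpi hsin
  have hΓ' : Complex.Gamma ((N : ℂ) / 2 - ν - 1) =
      -(Real.pi : ℂ) / (Complex.sin ((Real.pi : ℂ) * ((N : ℂ) / 2 - ν)) *
        Complex.Gamma (ν - (N : ℂ) / 2 + 1 + 1)) := by
    rw [eq_div_iff (mul_ne_zero hsin hΓ), mul_left_comm, hrefl, div_neg, mul_neg,
      mul_div_cancel₀ _ hsin]
  have hconst := congrArg (fun x : ℝ => (x : ℂ)) (pi_div_mul_Gamma_half_dim hN)
  simp only [Complex.ofReal_div, Complex.ofReal_mul] at hconst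
  rw [fishEyeGreen_eq hρ]
  unfold greenGegenbauer gegenbauerC greenPrefactor
  have d1 : ν - (N : ℂ) / 2 + 1 + 2 * ((((N : ℝ) - 1) / 2 : ℝ) : ℂ) = (N : ℂ) / 2 + ν := by
    push_cast; ring
  have d2 : -(ν - (N : ℂ) / 2 + 1) = (N : ℂ) / 2 - 1 - ν := by ring
  have d3 : ((((N : ℝ) - 1) / 2 : ℝ) : ℂ) + 1 / 2 = (N : ℂ) / 2 := by push_cast; ring
  have d4 : 2 * ((((N : ℝ) - 1) / 2 : ℝ) : ℂ) = (((N : ℝ) - 1 : ℝ) : ℂ) := by push_cast; ring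
  have d5 : (N : ℂ) / 2 = (((N : ℝ) / 2 : ℝ) : ℂ) := by push_cast; rfl
  have d6 : Complex.Gamma ((N : ℂ) / 2) = ((Real.Gamma ((N : ℝ) / 2) : ℝ) : ℂ) := by
    rw [← Complex.Gamma_ofReal, d5]
  rw [d1, d2, d3, d4, d6, hΓ', Complex.Gamma_ofReal,
    show 1 - (N : ℝ) / 2 = -((N : ℝ) / 2 - 1) by ring, Real.rpow_neg hA.le, Real.rpow_neg hA'.le]
  simp only [Complex.ofReal_mul, Complex.ofReal_inv]
  have c1 : (((‖r‖ ^ 2 + ρ ^ 2) ^ ((N : ℝ) / 2 - 1) : ℝ) : ℂ) ≠ 0 := by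
    exact_mod_cast (Real.rpow_pos_of_pos hA _).ne'
  have c2 : (((‖r'‖ ^ 2 + ρ ^ 2) ^ ((N : ℝ) / 2 - 1) : ℝ) : ℂ) ≠ 0 := by
    exact_mod_cast (Real.rpow_pos_of_pos hA' _).ne'
  have c3 : ((Real.Gamma ((N : ℝ) / 2) : ℝ) : ℂ) ≠ 0 := by
    exact_mod_cast (Real.Gamma_pos_of_pos (by linarith)).ne'
  have c4 : ((Real.Gamma ((N : ℝ) - 1) : ℝ) : ℂ) ≠ 0 :=
    Complex.ofReal_ne_zero.2 (Real.Gamma_pos_of_pos (by linarith)).ne'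
  have c5 : ((Real.pi ^ ((N : ℝ) / 2) : ℝ) : ℂ) ≠ 0 := by
    exact_mod_cast (Real.rpow_pos_of_pos Real.pi_pos _).ne'
  have c6 : ((Real.pi ^ (((N : ℝ) - 1) / 2) : ℝ) : ℂ) ≠ 0 := by
    exact_mod_cast (Real.rpow_pos_of_pos Real.pi_pos _).ne'
  generalize ordinaryHypergeometric ((N : ℂ) / 2 - 1 - ν) ((N : ℂ) / 2 + ν) ((N : ℂ) / 2)
    (((1 - fishEyeArg ρ r r') / 2 : ℝ) : ℂ) = F
  generalize Complex.Gamma ((N : ℂ) / 2 + ν) = G1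
  generalize Complex.Gamma (ν - (N : ℂ) / 2 + 1 + 1) = G2 at hΓ ⊢
  generalize Complex.sin ((Real.pi : ℂ) * ((N : ℂ) / 2 - ν)) = S at hsin ⊢
  generalize (((‖r‖ ^ 2 + ρ ^ 2) ^ ((N : ℝ) / 2 - 1) : ℝ) : ℂ) = x1 at c1 ⊢
  generalize (((‖r'‖ ^ 2 + ρ ^ 2) ^ ((N : ℝ) / 2 - 1) : ℝ) : ℂ) = x2 at c2 ⊢
  generalize ((ρ ^ (N - 2) : ℝ) : ℂ) = x3
  calc _ = (((2 : ℝ) ^ ((N : ℝ) - 4) : ℝ) : ℂ) * ((Real.Gamma (((N : ℝ) - 1) / 2) : ℝ) : ℂ) /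
        (((Real.pi ^ (((N : ℝ) - 1) / 2) : ℝ) : ℂ) * ((Real.Gamma ((N : ℝ) - 1) : ℝ) : ℂ)) *
        (G1 / (S * G2) * (x3 * x2⁻¹ * x1⁻¹) * F) := by
        generalize ((Real.Gamma ((N : ℝ) - 1) : ℝ) : ℂ) = y1 at c4 ⊢
        generalize ((Real.pi ^ (((N : ℝ) - 1) / 2) : ℝ) : ℂ) = y2 at c6 ⊢
        field_simp
    _ = _ := by
        rw [← hconst]
        generalize ((Real.Gamma ((N : ℝ) / 2) : ℝ) : ℂ) = y1 at c3 ⊢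
        generalize ((Real.pi ^ ((N : ℝ) / 2) : ℝ) : ℂ) = y2 at c5 ⊢
        field_simp

/-- Off the exceptional set both Gamma factors are regular, so this representation stays continuous
even where the sine in the Gegenbauer form vanishes. -/
theorem continuousAt_fishEyeGreen_index (hN : 2 ≤ N) {ρ : ℝ} (hρ : 0 < ρ) {ν : ℂ}
    (hex : ¬ IsExceptionalIndex N ν) {r r' : EuclideanSpace ℝ (Fin N)} (hr : r ≠ r') :
    ContinuousAt (fun ν => fishEyeGreen ρ ν r r') ν := by
  obtain ⟨ha, hb, -⟩ := exceptional_ne hex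
  obtain ⟨hz0, hz1⟩ := half_one_sub_fishEyeArg_mem hρ hr
  have hz : ‖(((1 - fishEyeArg ρ r r') / 2 : ℝ) : ℂ)‖ < 1 := by
    rwa [Complex.norm_real, Real.norm_of_nonneg hz0]
  have hF : ContinuousAt (fun ν : ℂ => ordinaryHypergeometric ((N : ℂ) / 2 - 1 - ν)
      ((N : ℂ) / 2 + ν) ((N : ℂ) / 2) ((((1 - fishEyeArg ρ r r') / 2 : ℝ)) : ℂ)) ν :=
    ((continuous_ordinaryHypergeometric_param (half_dim_ne_neg_nat hN) hz).comp
      (by fun_prop : Continuous fun ν : ℂ => ((N : ℂ) / 2 - 1 - ν, (N : ℂ) / 2 + ν))).continuousAt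
  have g1 : ContinuousAt (fun ν : ℂ => Complex.Gamma ((N : ℂ) / 2 + ν)) ν :=
    ContinuousAt.comp (f := fun ν : ℂ => (N : ℂ) / 2 + ν)
      (Complex.differentiableAt_Gamma _ hb).continuousAt (by fun_prop)
  have g2 : ContinuousAt (fun ν : ℂ => Complex.Gamma ((N : ℂ) / 2 - ν - 1)) ν :=
    ContinuousAt.comp (f := fun ν : ℂ => (N : ℂ) / 2 - ν - 1)
      (Complex.differentiableAt_Gamma _ fun m h => ha m (by rw [← h]; ring)).continuousAt
      (by fun_prop)
  simp only [fishEyeGreen_eq hρ]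
  unfold greenPrefactor
  exact (((((g1.mul g2).div_const _).neg).div_const _).mul continuousAt_const).mul hF

/-- Zeros of the sine are simple, hence isolated, so the Gegenbauer form is valid on a punctured
neighbourhood of every index. -/
theorem eventually_sin_index_ne_zero (N : ℕ) (ν : ℂ) :
    ∀ᶠ ν' in 𝓝[≠] ν, Complex.sin ((Real.pi : ℂ) * ((N : ℂ) / 2 - ν')) ≠ 0 := by
  have hpi : (Real.pi : ℂ) ≠ 0 := by exact_mod_cast Real.pi_ne_zero
  by_cases h0 : Complex.sin ((Real.pi : ℂ) * ((N : ℂ) / 2 - ν)) = 0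
  · have hlin : HasDerivAt (fun ν : ℂ => (Real.pi : ℂ) * ((N : ℂ) / 2 - ν)) (Real.pi * -1) ν :=
      ((hasDerivAt_id ν).const_sub _).const_mul _
    refine (hlin.csin).eventually_ne (mul_ne_zero ?_ (by simp))
    intro hc
    have := Complex.sin_sq_add_cos_sq ((Real.pi : ℂ) * ((N : ℂ) / 2 - ν))
    rw [h0, hc] at this
    norm_num at this
  · have hc : ContinuousAt (fun ν : ℂ => Complex.sin ((Real.pi : ℂ) * ((N : ℂ) / 2 - ν))) ν := by
      fun_prop
    exact (hc.eventually_ne h0).filter_mono nhdsWithin_le_nhds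

end GegenbauerForm

/-! ### Existence, uniqueness and the listed properties combined. -/

theorem mainTheorem1 (N : ℕ) (hN : 2 ≤ N) (ρ : ℝ) (hρ : 0 < ρ) (n₀ k ν : ℂ)
    (hν : IsFishEyeIndex n₀ k ρ ν) (hex : ¬ IsExceptionalIndex N ν) :
    -- a Green's function exists for every source point
    (∃ G : EuclideanSpace ℝ (Fin N) → EuclideanSpace ℝ (Fin N) → ℂ,
      ∀ r', IsFishEyeGreen N ρ n₀ k r' (fun r => G r r')) ∧
    -- it is unique, and has the following closed forms and properties
    (∀ G : EuclideanSpace ℝ (Fin N) → EuclideanSpace ℝ (Fin N) → ℂ,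
      (∀ r', IsFishEyeGreen N ρ n₀ k r' (fun r => G r r')) →
      -- closed form
      (∀ r r', r' ≠ 0 → r ≠ r' → r ≠ -((ρ ^ 2 / ‖r'‖ ^ 2) • r') →
        G r r' = greenPrefactor N ν * (((ρ / ‖r'‖) ^ ((N : ℝ) / 2 - 1) : ℝ) : ℂ) *
          (ferrersP ν (-(N : ℝ) / 2 + 1) (fishEyeArg ρ r r') /
            ((‖r - r'‖ ^ ((N : ℝ) / 2 - 1) *
              ‖r + (ρ ^ 2 / ‖r'‖ ^ 2) • r'‖ ^ ((N : ℝ) / 2 - 1) : ℝ) : ℂ))) ∧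
      -- value at the image of the source point
      (∀ r', r' ≠ 0 →
        G (-((ρ ^ 2 / ‖r'‖ ^ 2) • r')) r' =
          greenPrefactor N ν / (Real.Gamma ((N : ℝ) / 2) : ℂ) *
            (((‖r'‖ / (‖r'‖ ^ 2 + ρ ^ 2)) ^ (N - 2) : ℝ) : ℂ)) ∧
      -- constant at infinity
      (∀ r', r' ≠ 0 →
        Tendsto (fun r => ((‖r‖ ^ (N - 2) : ℝ) : ℂ) * G r r')
          (Bornology.cobounded (EuclideanSpace ℝ (Fin N)))
          (𝓝 (greenPrefactor N ν * (((ρ / ‖r'‖) ^ ((N : ℝ) / 2 - 1) : ℝ) : ℂ) *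
            ferrersP ν (-(N : ℝ) / 2 + 1)
              ((ρ ^ 2 - ‖r'‖ ^ 2) / (ρ ^ 2 + ‖r'‖ ^ 2))))) ∧
      Tendsto (fun r => ((‖r‖ ^ (N - 2) : ℝ) : ℂ) * G r 0)
        (Bornology.cobounded (EuclideanSpace ℝ (Fin N)))
        (𝓝 (greenPrefactor N ν / (Real.Gamma ((N : ℝ) / 2) : ℂ))) ∧
      -- symmetry
      (∀ r r', r ≠ r' → G r r' = G r' r) ∧
      -- first symmetric form (source at the origin allowed)
      (∀ r r', r ≠ r' →
        ‖r‖ ^ 2 * ‖r'‖ ^ 2 + 2 * ρ ^ 2 * inner ℝ r r' + ρ ^ 4 ≠ 0 →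
        G r r' = greenPrefactor N ν *
          (((ρ ^ ((N : ℝ) / 2 - 1) : ℝ) : ℂ) *
              ferrersP ν (-(N : ℝ) / 2 + 1) (fishEyeArg ρ r r') /
            ((‖r - r'‖ ^ ((N : ℝ) / 2 - 1) *
              (‖r‖ ^ 2 * ‖r'‖ ^ 2 + 2 * ρ ^ 2 * inner ℝ r r' + ρ ^ 4) ^
                ((N : ℝ) / 4 - 1 / 2) : ℝ) : ℂ))) ∧
      -- second symmetric form
      (∀ r r', r ≠ 0 → r' ≠ 0 → r ≠ r' → r ≠ -((ρ ^ 2 / ‖r'‖ ^ 2) • r') →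
        G r r' = greenPrefactor N ν *
          (((ρ ^ ((N : ℝ) / 2 - 1) : ℝ) : ℂ) *
              ferrersP ν (-(N : ℝ) / 2 + 1) (fishEyeArg ρ r r') /
            (((‖r‖ * ‖r'‖) ^ ((N : ℝ) / 4 - 1 / 2) * ‖r - r'‖ ^ ((N : ℝ) / 2 - 1) *
              ‖r + (ρ ^ 2 / ‖r'‖ ^ 2) • r'‖ ^ ((N : ℝ) / 4 - 1 / 2) *
              ‖r' + (ρ ^ 2 / ‖r‖ ^ 2) • r‖ ^ ((N : ℝ) / 4 - 1 / 2) : ℝ) : ℂ))) ∧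
      -- Gegenbauer form, as a limit in the degree where its right-hand side is of the form `0 / 0`
      (∀ r r', r ≠ r' →
        (Complex.sin ((Real.pi : ℂ) * ((N : ℂ) / 2 - ν)) ≠ 0 →
          G r r' = greenGegenbauer ρ ν r r') ∧
        (Complex.sin ((Real.pi : ℂ) * ((N : ℂ) / 2 - ν)) = 0 →
          Tendsto (fun ν' => greenGegenbauer ρ ν' r r') (𝓝[≠] ν) (𝓝 (G r r'))))) := by
  have main := isFishEyeGreen_fishEyeGreen hN hρ hν hex
  refine ⟨⟨fishEyeGreen ρ ν, main⟩, fun G hG => ?_⟩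
  have heq : ∀ r r', r ≠ r' → G r r' = fishEyeGreen ρ ν r r' := fun r r' hr =>
    (hG r').eq_of_ne hN hρ hν hex (main r') hr
  have hinf : ∀ r', (fun r => ((‖r‖ ^ (N - 2) : ℝ) : ℂ) * fishEyeGreen ρ ν r r')
      =ᶠ[Bornology.cobounded (EuclideanSpace ℝ (Fin N))]
      fun r => ((‖r‖ ^ (N - 2) : ℝ) : ℂ) * G r r' := fun r' => by
    filter_upwards [(tendsto_norm_cobounded_atTop
      (E := EuclideanSpace ℝ (Fin N))).eventually_gt_atTop ‖r'‖] with r hr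
    rw [heq r r' (by rintro rfl; exact lt_irrefl _ hr)]
  refine ⟨fun r r' hr' hr hi => ?_, fun r' hr' => ?_, fun r' hr' => ?_, ?_, fun r r' hr => ?_,
    fun r r' hr hQ => ?_, fun r r' hr0 hr' hr hi => ?_, fun r r' hr => ⟨fun hs => ?_, fun _ => ?_⟩⟩
  · rw [heq r r' hr, fishEyeGreen_eq_ferrersP_image hN hρ ν hr' hr hi]
  · rw [heq _ _ (ne_image hr'), fishEyeGreen_image hN hρ ν hr']
  · exact (tendsto_fishEyeGreen_infinity hN hρ ν hr').congr' (hinf r')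
  · exact (tendsto_fishEyeGreen_infinity_zero hN hρ ν).congr' (hinf 0)
  · rw [heq r r' hr, heq r' r hr.symm, fishEyeGreen_comm hN hρ ν hr]
  · rw [heq r r' hr, fishEyeGreen_eq_ferrersP hN hρ ν hr hQ]
  · rw [heq r r' hr, fishEyeGreen_eq_ferrersP_images hN hρ ν hr0 hr' hr hi]
  · rw [heq r r' hr, greenGegenbauer_eq_fishEyeGreen hN hρ hs]
  · rw [heq r r' hr]
    refine ((continuousAt_fishEyeGreen_index hN hρ hex hr).tendsto.mono_left
      nhdsWithin_le_nhds).congr' ?_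
    filter_upwards [eventually_sin_index_ne_zero N ν] with ν' hs
    rw [greenGegenbauer_eq_fishEyeGreen hN hρ hs]
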